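/- **Setting.** Let $(X,d,\mathfrak m)$ be a complete separable metric space with a locally finite Borel measure. $\mathrm{Geo}(X)$ denotes the constant-speed minimizing geodesics $\gamma:[0,1]\to X$ with the uniform topology, and $e_t(\gamma)=\gamma_t$. $P_2(X)$ (resp. $P_c(X)$) denotes the Borel probability measures with finite second moment (resp. bounded support). $\mathrm{OptGeo}(\mu_0,\mu_1)$ is the set of Borel probability measures $\nu$ on $\mathrm{Geo}(X)$ with $(e_i)_\sharp\nu=\mu_i$, $i=0,1$, such that $(e_0,e_1)_\sharp\nu$ minimizes $\int d(x,y)^2\,d\pi$ among all couplings $\pi$ of $\mu_0,\mu_1$. The space is *Monge* if for all $\mu_0,\mu_1\in P_2(X)$ with $\mu_0\ll\mathfrak m$ and $\mathrm{supp}\,\mu_1\subset\mathrm{supp}\,\mathfrak m$ there is a unique $\nu\in\mathrm{OptGeo}(\mu_0,\mu_1)$, it has the form $\nu=S_\sharp\mu_0$ for a map $S:X\to\mathrm{Geo}(X)$, and $(e_t)_\sharp\nu\ll\mathfrak m$ for all $t\in[0,1)$. For $K\in\mathbb R$, $N\in(1,\infty)$, $t\in(0,1)$, $\theta\ge 0$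 put $\sigma^{(t)}_{K,N-1}(\theta)=+\infty$ if $K\theta^2\ge\pi^2(N-1)$ and otherwise $\sigma^{(t)}_{K,N-1}(\theta)=s_{K/(N-1)}(t\theta)/s_{K/(N-1)}(\theta)$ (read as $t$ at $\theta=0$), where $s_\kappa(\theta)=\sin(\sqrt\kappa\,\theta)/\sqrt\kappa$, $\theta$, $\sinh(\sqrt{-\kappa}\,\theta)/\sqrt{-\kappa}$ for $\kappa>0$, $\kappa=0$, $\kappa<0$ respectively; and $\tau^{(t)}_{K,N}=t^{1/N}(\sigma^{(t)}_{K,N-1})^{1-1/N}$. For $Q\ge1$, a Monge space satisfies $\mathsf{QCD}(Q,K,N)$ if for all $\mu_0,\mu_1\in P_c(X)$ with $\mu_0,\mu_1\ll\mathfrak m$, with $\nu$ the element of $\mathrm{OptGeo}(\mu_0,\mu_1)$ and $\rho_t=d(e_t)_\sharp\nu/d\mathfrak m$, one has for all $t\in(0,1)$ and $\nu$-a.e. $\gamma$ $$\rho_t^{-1/N}(\gamma_t)\ \ge\ Q^{-1/N}\Big(\tau^{(1-t)}_{K,N}(d(\gamma_0,\gamma_1))\,\rho_0^{-1/N}(\gamma_0)+\tau^{(t)}_{K,N}(d(\gamma_0,\gamma_1))\,\rho_1^{-1/N}(\gamma_1)\Big).$$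 $\mathsf{CD}(K,N)$ is the same condition with $Q=1$. A Monge space satisfies $\mathsf{MCP}(K,N)$ if for all $\mu_0,\mu_1\in P_c(X)$ with $\mu_0\ll\mathfrak m$ and $\mathrm{supp}\,\mu_1\subset\mathrm{supp}\,\mathfrak m$, for all $t\in(0,1)$ and $\nu$-a.e. $\gamma$, $\rho_t^{-1/N}(\gamma_t)\ge\tau^{(1-t)}_{K,N}(d(\gamma_0,\gamma_1))\,\rho_0^{-1/N}(\gamma_0)$. $\mathsf{CD}_1(K,N)$ is the family of spaces $(\mathbb R,|\cdot|,h\,dx)$ with $0\le h\in L^1_{loc}(\mathbb R)$ satisfying $\mathsf{CD}(K,N)$. $\mathsf{QCD}_1(Q,K,N)$ is the family of such spaces satisfying $\mathsf{QCD}(Q,K,N)$ and $\mathsf{MCP}(K',N')$ for some $K'\in\mathbb R$ and $N'\in(1,\infty)$. Let $|\nabla_X f|(x)=\limsup_{y\to x}|f(y)-f(x)|/d(y,x)$ ($0$ at isolated points), and let $\mathrm{geo}(\Omega)$ be the union of all minimizing geodesics with endpoints in $\Omega$. For $p\in(1,\infty)$, $\lambda_p[\mathfrak m,\Omega]\in[0,\infty]$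 is the largest constant $\lambda$ such that every locally Lipschitz $f:X\to\mathbb R$ satisfies $$\int_\Omega|f|^{p-2}f\,d\mathfrak m=0\ \Rightarrow\ \lambda\int_\Omega|f|^p\,d\mathfrak m\le\int_{\mathrm{geo}(\Omega)}|\nabla_Xf|^p\,d\mathfrak m,$$ and $\lambda_{LS}[\mathfrak m,\Omega]\in[0,\infty]$ is the largest constant $\lambda$ such that every locally Lipschitz $f:X\to\mathbb R$ satisfies $$\int_\Omega(f^2-1)\,d\mathfrak m=0\ \Rightarrow\ \frac{\lambda}{2}\int_\Omega f^2\log(f^2)\,d\mathfrak m\le\int_{\mathrm{geo}(\Omega)}|\nabla_Xf|^2\,d\mathfrak m.$$ For a family $\mathscr X$ and $D\in(0,\infty)$, $\lambda_*[\mathscr X,D]$ is the infimum of $\lambda_*[\mathfrak m,\Omega]$ over all members of $\mathscr X$ and all closed $\Omega\subset\mathrm{supp}\,\mathfrak m$ with $\mathrm{diam}(\Omega)\le D$, and $\bar\lambda_*[\mathscr X,D]$ is the infimum of $\lambda_*[\mathfrak m,\mathrm{supp}\,\mathfrak m]$ over all members with $\mathrm{diam}(\mathrm{supp}\,\mathfrak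 m)\le D$. **Theorem.** For all $K\in\mathbb R$, $N\in(1,\infty)$, $D\in(0,\infty)$, $Q\ge 1$ and $\lambda_*\in\{\lambda_p\ (p\in(1,\infty)),\ \lambda_{LS}\}$: $$\bar\lambda_*[\mathsf{CD}_1(K,N),D]\ \ge\ \lambda_*[\mathsf{QCD}_1(Q,K,N),D]\ \ge\ \frac1Q\,\bar\lambda_*[\mathsf{CD}_1(K,N),D].$$ -/

import Mathlib

open MeasureTheory Set Filter Topology
open scoped ENNReal unitInterval

noncomputable section

namespace QuasiCD

/-! ### Distortion coefficients -/

/-- The function `s_κ`. -/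
def sFun (κ θ : ℝ) : ℝ :=
  if 0 < κ then Real.sin (√κ * θ) / √κ
  else if κ = 0 then θ
  else Real.sinh (√(-κ) * θ) / √(-κ)

/-- The coefficient `σ^{(t)}_{K, N-1}(θ)`, a function of `K`, `N`, `t`, `θ` with values in `[0, ∞]`.
At `θ = 0` the quotient `s(tθ) / s(θ)` is read as its limit `t`. -/
def sigmaCoef (K N t θ : ℝ) : ℝ≥0∞ :=
  if Real.pi ^ 2 * (N - 1) ≤ K * θ ^ 2 then ⊤
  else if θ = 0 then ENNReal.ofReal t
  else ENNReal.ofReal (sFun (K / (N - 1)) (t * θ) / sFun (K / (N - 1)) θ)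

/-- The coefficient `τ^{(t)}_{K, N}(θ) = t^{1/N} (σ^{(t)}_{K, N-1}(θ))^{1 - 1/N}`. -/
def tauCoef (K N t θ : ℝ) : ℝ≥0∞ :=
  ENNReal.ofReal t ^ (1 / N) * sigmaCoef K N t θ ^ (1 - 1 / N)

/-! ### Optimal transport

In this part `X` is a complete separable metric space with its Borel σ-algebra and `m` is a locally
finite Borel measure on `X`. -/

section Transport

variable {X : Type*} [MetricSpace X] [MeasurableSpace X]

/-- `Geo X` is the space of constant speed minimizing geodesics parametrized on `[0, 1]`, with the
topology of uniform convergence. -/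
def Geo (X : Type*) [MetricSpace X] : Type _ :=
  {γ : C(I, X) // ∀ s t : I, dist (γ s) (γ t) = |(s : ℝ) - t| * dist (γ 0) (γ 1)}

instance : TopologicalSpace (Geo X) :=
  inferInstanceAs (TopologicalSpace
    {γ : C(I, X) // ∀ s t : I, dist (γ s) (γ t) = |(s : ℝ) - t| * dist (γ 0) (γ 1)})

/-- `Geo X` carries its Borel σ-algebra. -/
instance : MeasurableSpace (Geo X) := borel (Geo X)

instance : BorelSpace (Geo X) := ⟨rfl⟩

/-- The evaluation map `e_t : γ ↦ γ_t`. -/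
def ev (t : I) (γ : Geo X) : X := γ.1 t

/-- The geodesic hull of a set. -/
def geoHull (A : Set X) : Set X :=
  {x | ∃ γ : Geo X, ev 0 γ ∈ A ∧ ev 1 γ ∈ A ∧ ∃ t : I, ev t γ = x}

/-- Probability measures with finite second moment. -/
def IsP2 (μ : Measure X) : Prop :=
  IsProbabilityMeasure μ ∧ ∃ x₀ : X, ∫⁻ x, edist x x₀ ^ 2 ∂μ < ⊤

/-- Probability measures with bounded support. -/
def IsPc (μ : Measure X) : Prop :=
  IsProbabilityMeasure μ ∧ Bornology.IsBounded μ.support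

/-- Transference plans: couplings of `μ₀` and `μ₁`. -/
def IsPlan (μ₀ μ₁ : Measure X) (π : Measure (X × X)) : Prop :=
  π.map Prod.fst = μ₀ ∧ π.map Prod.snd = μ₁

/-- The quadratic transport cost of a plan. -/
def cost (π : Measure (X × X)) : ℝ≥0∞ := ∫⁻ z, edist z.1 z.2 ^ 2 ∂π

/-- Optimal transference plans: the infimum defining `W₂²(μ₀, μ₁)` is attained at `π`. -/
def IsOptPlan (μ₀ μ₁ : Measure X) (π : Measure (X × X)) : Prop :=
  IsPlan μ₀ μ₁ π ∧ ∀ π' : Measure (X × X), IsPlan μ₀ μ₁ π' → cost π ≤ cost π'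

/-- Optimal dynamical plans from `μ₀` to `μ₁`. -/
def OptGeo (μ₀ μ₁ : Measure X) : Set (Measure (Geo X)) :=
  {ν | IsProbabilityMeasure ν ∧ ν.map (ev 0) = μ₀ ∧ ν.map (ev 1) = μ₁ ∧
    IsOptPlan μ₀ μ₁ (ν.map fun γ => (ev 0 γ, ev 1 γ))}

/-- Monge spaces. -/
def IsMonge (m : Measure X) : Prop :=
  ∀ μ₀ μ₁ : Measure X, IsP2 μ₀ → IsP2 μ₁ → μ₀ ≪ m → μ₁.support ⊆ m.support →
    (∃! ν, ν ∈ OptGeo μ₀ μ₁) ∧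
    ∀ ν ∈ OptGeo μ₀ μ₁,
      (∃ S : X → Geo X, AEMeasurable S μ₀ ∧ ν = μ₀.map S) ∧
      ∀ t : I, t < 1 → ν.map (ev t) ≪ m

/-- The quantity `ρ_t^{-1/N}(γ_t)` where `ρ_t` is the density of `(e_t)_♯ ν` with respect to `m`. -/
def invDens (m : Measure X) (N : ℝ) (ν : Measure (Geo X)) (t : I) (γ : Geo X) : ℝ≥0∞ :=
  (ν.map (ev t)).rnDeriv m (ev t γ) ^ (-(1 / N))

/-- The Curvature-Dimension condition `CD(K, N)` on Monge spaces. -/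
def CD (m : Measure X) (K N : ℝ) : Prop :=
  IsMonge m ∧ ∀ μ₀ μ₁ : Measure X, IsPc μ₀ → IsPc μ₁ → μ₀ ≪ m → μ₁ ≪ m →
    ∀ ν ∈ OptGeo μ₀ μ₁, ∀ t : I, 0 < t → t < 1 → ∀ᵐ γ ∂ν,
      tauCoef K N (1 - t) (dist (ev 0 γ) (ev 1 γ)) * invDens m N ν 0 γ
        + tauCoef K N t (dist (ev 0 γ) (ev 1 γ)) * invDens m N ν 1 γ ≤ invDens m N ν t γ

/-- The Quasi Curvature-Dimension condition `QCD(Q, K, N)` on Monge spaces. -/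
def QCD (m : Measure X) (Q K N : ℝ) : Prop :=
  IsMonge m ∧ ∀ μ₀ μ₁ : Measure X, IsPc μ₀ → IsPc μ₁ → μ₀ ≪ m → μ₁ ≪ m →
    ∀ ν ∈ OptGeo μ₀ μ₁, ∀ t : I, 0 < t → t < 1 → ∀ᵐ γ ∂ν,
      (ENNReal.ofReal Q ^ (1 / N))⁻¹ *
        (tauCoef K N (1 - t) (dist (ev 0 γ) (ev 1 γ)) * invDens m N ν 0 γ
          + tauCoef K N t (dist (ev 0 γ) (ev 1 γ)) * invDens m N ν 1 γ) ≤ invDens m N ν t γ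

/-- The Measure Contraction Property `MCP(K, N)` on Monge spaces. -/
def MCP (m : Measure X) (K N : ℝ) : Prop :=
  IsMonge m ∧ ∀ μ₀ μ₁ : Measure X, IsPc μ₀ → IsPc μ₁ → μ₀ ≪ m → μ₁.support ⊆ m.support →
    ∀ ν ∈ OptGeo μ₀ μ₁, ∀ t : I, 0 < t → t < 1 → ∀ᵐ γ ∂ν,
      tauCoef K N (1 - t) (dist (ev 0 γ) (ev 1 γ)) * invDens m N ν 0 γ ≤ invDens m N ν t γ

/-! ### Best constants -/

/-- The local Lipschitz constant `|∇_X f|(x)`, the limsup of `|f(y) - f(x)| / d(y, x)` as `y → x`,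
`y ≠ x`. It is `0` at an isolated point, where the filter is trivial. -/
def localLip (f : X → ℝ) (x : X) : ℝ≥0∞ :=
  limsup (fun y => edist (f y) (f x) / edist y x) (𝓝[≠] x)

/-- The best constant `λ_p[(X, d, m), Ω]` in the `L^p`-Poincaré inequality. -/
def poincareConst (p : ℝ) (m : Measure X) (Ω : Set X) : ℝ≥0∞ :=
  sSup {c : ℝ≥0∞ | ∀ f : X → ℝ, LocallyLipschitz f →
    ∫ x in Ω, |f x| ^ (p - 2) * f x ∂m = 0 →
      c * ∫⁻ x in Ω, ENNReal.ofReal (|f x| ^ p) ∂m ≤ ∫⁻ x in geoHull Ω, localLip f x ^ p ∂m}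

/-- The best constant `λ_LS[(X, d, m), Ω]` in the log-Sobolev inequality. The integral of
`f² log f²` is non-negative under the constraint on `f`, by convexity of `x log x`, so that it can
be read in `[0, ∞]`. -/
def logSobolevConst (m : Measure X) (Ω : Set X) : ℝ≥0∞ :=
  sSup {c : ℝ≥0∞ | ∀ f : X → ℝ, LocallyLipschitz f →
    ∫ x in Ω, (f x ^ 2 - 1) ∂m = 0 →
      c / 2 * ENNReal.ofReal (∫ x in Ω, f x ^ 2 * Real.log (f x ^ 2) ∂m)
        ≤ ∫⁻ x in geoHull Ω, localLip f x ^ 2 ∂m}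

/-- `λ_*[𝒳, D]`: the infimum of `λ_*[m, Ω]` over the members `m` of the family and all closed
`Ω ⊆ supp m` of diameter at most `D`. -/
def famConst (L : Measure X → Set X → ℝ≥0∞) (𝒳 : Set (Measure X)) (D : ℝ) : ℝ≥0∞ :=
  sInf {c | ∃ m ∈ 𝒳, ∃ Ω : Set X, IsClosed Ω ∧ Ω ⊆ m.support ∧
    Metric.ediam Ω ≤ ENNReal.ofReal D ∧ c = L m Ω}

/-- `λ̄_*[𝒳, D]`: the infimum of `λ_*[m, supp m]` over the members `m` of the family whose support
has diameter at most `D`. -/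
def famConstBar (L : Measure X → Set X → ℝ≥0∞) (𝒳 : Set (Measure X)) (D : ℝ) : ℝ≥0∞ :=
  sInf {c | ∃ m ∈ 𝒳, Metric.ediam m.support ≤ ENNReal.ofReal D ∧ c = L m m.support}

end Transport

/-! ### One-dimensional spaces -/

/-- The measure `m` on `ℝ` is `h` times Lebesgue measure for a non-negative locally integrable
function `h`. -/
def HasLocDensity (m : Measure ℝ) : Prop :=
  ∃ h : ℝ → ℝ, (∀ x, 0 ≤ h x) ∧ LocallyIntegrable h volume ∧
    m = volume.withDensity fun x => ENNReal.ofReal (h x)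

/-- The family `CD_1(K, N)` of one-dimensional spaces `(ℝ, |·|, m)`. -/
def CD1 (K N : ℝ) : Set (Measure ℝ) := {m | HasLocDensity m ∧ CD m K N}

/-- The family `QCD_1(Q, K, N)` of one-dimensional spaces `(ℝ, |·|, m)`. -/
def QCD1 (Q K N : ℝ) : Set (Measure ℝ) :=
  {m | HasLocDensity m ∧ QCD m Q K N ∧ ∃ K' N' : ℝ, 1 < N' ∧ MCP m K' N'}

end QuasiCD

end

/-! Write κ = K/(N-1), let h be the density of a space in the quasi family, and put v = h^(1/(N-1)),
C = Q^(1/(N-1)). Testing the transport inequality on small uniform measures moved by affine maps,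
and then optimizing the slope of the map, turns it into concavity with a loss at almost all points:
s(y-z) v(x) + s(z-x) v(y) ≤ s(y-x) C v(z) for x < z < y (`QCD.ae_affine`, `QCD.le_of_slope`,
`add_le_of_forall_slope`). The Monge property is what makes h positive almost everywhere between two
points of the support (`IsMonge.ae_pos`).

The core is a fact about convexity in dimension one. Solutions of w'' + κw = 0 play the role of
affine functions, and through the value C v(y) at y there passes a solution lying above v, because
the slopes forced by points to the right of y never exceed those allowed by points to its left
(`exists_sol_majorant`). Hence the lower envelope u of all solutions above v is concave in the
generalized sense and v ≤ u ≤ C v (`exists_solConcave_hull`). Raised to the power N-1, this gives a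
density u^(N-1) between h and Q h (`QCD.exists_solConcave`).

Conversely, such a density on [a, b] defines a genuine CD(K, N) space (`SolConcave.cd`). Optimal
transport on the line is monotone rearrangement, the Jacobian equation computes the interpolated
densities, and Hölder's inequality combines the Jacobian 1 - t + tT' with the concavity of u.

For the lower bound, let a and b be the extreme points of Ω and m' the model measure on [a, b]. Then
m ≤ m' on Ω and m' ≤ Q m on the geodesic hull of Ω. The left sides of both functional inequalities
are minima over a constant of integrals of nonnegative functions, hence monotone in the measure;
only the gradient side pays, and it pays Q (`poincareConst_comparison`,
`logSobolevConst_comparison`). For the upper bound, CD spaces of bounded support lie in the quasi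
family. Their contraction property comes from the case Q = 1, where the envelope reproduces the
density itself (`CD.mcp`). -/

namespace QuasiCD

/-! ### Solutions of `w'' + κ w = 0` -/

/-- The derivative of `s_κ`. -/
noncomputable def cFun (κ θ : ℝ) : ℝ :=
  if 0 < κ then Real.cos (√κ * θ)
  else if κ = 0 then 1
  else Real.cosh (√(-κ) * θ)

lemma sFun_zero (κ : ℝ) : sFun κ 0 = 0 := by
  unfold sFun; split_ifs <;> simp

lemma cFun_zero (κ : ℝ) : cFun κ 0 = 1 := by
  unfold cFun; split_ifs <;> simp

lemma sFun_neg (κ θ : ℝ) : sFun κ (-θ) = -sFun κ θ := by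
  unfold sFun; split_ifs <;> simp [neg_div]

lemma cFun_neg (κ θ : ℝ) : cFun κ (-θ) = cFun κ θ := by
  unfold cFun; split_ifs <;> simp

lemma continuous_sFun (κ : ℝ) : Continuous (sFun κ) := by
  unfold sFun; split_ifs <;> fun_prop

lemma continuous_cFun (κ : ℝ) : Continuous (cFun κ) := by
  unfold cFun; split_ifs <;> fun_prop

lemma sFun_add (κ x y : ℝ) :
    sFun κ (x + y) = sFun κ x * cFun κ y + cFun κ x * sFun κ y := by
  unfold sFun cFun
  split_ifs with h1 h2
  · rw [mul_add, Real.sin_add]; ring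
  · ring
  · rw [mul_add, Real.sinh_add]; ring

lemma cFun_add (κ x y : ℝ) :
    cFun κ (x + y) = cFun κ x * cFun κ y - κ * sFun κ x * sFun κ y := by
  unfold sFun cFun
  split_ifs with h1 h2
  · have : √κ ≠ 0 := (Real.sqrt_pos.2 h1).ne'
    have h3 : κ = √κ ^ 2 := (Real.sq_sqrt h1.le).symm
    rw [mul_add, Real.cos_add]
    generalize √κ = k at *
    subst h3; field_simp
  · simp [h2]
  · have h0 : 0 < -κ := by
      rcases lt_trichotomy κ 0 with h | h | h
      · linarith
      · exact absurd h h2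
      · exact absurd h h1
    have : √(-κ) ≠ 0 := (Real.sqrt_pos.2 h0).ne'
    have h3 : κ = -√(-κ) ^ 2 := by rw [Real.sq_sqrt h0.le]; ring
    rw [mul_add, Real.cosh_add]
    generalize √(-κ) = k at *
    subst h3; field_simp; ring

lemma sFun_pos {κ θ : ℝ} (hθ : 0 < θ) (h : κ * θ ^ 2 < Real.pi ^ 2) : 0 < sFun κ θ := by
  unfold sFun
  split_ifs with h1 h2
  · have hs := Real.sqrt_pos.2 h1
    refine div_pos (Real.sin_pos_of_pos_of_lt_pi (by positivity) ?_) hs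
    refine lt_of_pow_lt_pow_left₀ 2 Real.pi_pos.le ?_
    rw [mul_pow, Real.sq_sqrt h1.le]; exact h
  · exact hθ
  · have h0 : 0 < -κ := by
      rcases lt_trichotomy κ 0 with h | h | h
      · linarith
      · exact absurd h h2
      · exact absurd h h1
    have hs := Real.sqrt_pos.2 h0
    exact div_pos (Real.sinh_pos_iff.2 (by positivity)) hs

/-- The general solution of `w'' + κ w = 0`. -/
noncomputable def sol (κ : ℝ) (c : ℝ × ℝ) (x : ℝ) : ℝ := c.1 * cFun κ x + c.2 * sFun κ x

lemma continuous_sol (κ : ℝ) (c : ℝ × ℝ) : Continuous (sol κ c) := by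
  have := continuous_sFun κ
  have := continuous_cFun κ
  unfold sol; fun_prop

/-- Solutions are the "affine functions" of this theory: they give equality in the concavity
inequality, by the addition formulas centred at z. -/
lemma sol_interpolation (κ : ℝ) (c : ℝ × ℝ) (x z y : ℝ) :
    sFun κ (y - z) * sol κ c x + sFun κ (z - x) * sol κ c y = sFun κ (y - x) * sol κ c z := by
  obtain ⟨p, rfl⟩ : ∃ p, y = z + p := ⟨y - z, by ring⟩
  obtain ⟨q, rfl⟩ : ∃ q, x = z + -q := ⟨z - x, by ring⟩
  have e1 : z + p - z = p := by ring
  have e2 : z - (z + -q) = q := by ring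
  have e3 : z + p - (z + -q) = p + q := by ring
  rw [e1, e2, e3]
  simp only [sol, sFun_add, cFun_add, sFun_neg, cFun_neg]
  ring

/-- Translates of solutions are again solutions, by the addition formulas; A is the value and B the
slope at y. -/
lemma exists_sol_initial (κ y A B : ℝ) :
    ∃ c, ∀ x, sol κ c x = A * cFun κ (x - y) + B * sFun κ (x - y) := by
  refine ⟨(A * cFun κ y - B * sFun κ y, κ * A * sFun κ y + B * cFun κ y), fun x => ?_⟩
  simp only [sol, sub_eq_add_neg, sFun_add, cFun_add, sFun_neg, cFun_neg]
  ring

/-- A solution above `v` on `G` whose value at the point `y` of `G` is `C * v y`. -/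
lemma exists_sol_majorant {κ a b C : ℝ} {G : Set ℝ} {v : ℝ → ℝ} (hG : G ⊆ Ioo a b)
    (hd : Ioo a b ⊆ closure G) (hκ : κ * (b - a) ^ 2 ≤ Real.pi ^ 2) (hC : 1 ≤ C)
    (hv : ∀ x ∈ G, 0 < v x)
    (H : ∀ x ∈ G, ∀ y ∈ G, ∀ z ∈ G, x < z → z < y →
      sFun κ (y - z) * v x + sFun κ (z - x) * v y ≤ sFun κ (y - x) * (C * v z))
    {y : ℝ} (hy : y ∈ G) :
    ∃ c, (∀ x ∈ G, v x ≤ sol κ c x) ∧ sol κ c y = C * v y := by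
  have spos : ∀ x ∈ G, ∀ z ∈ G, x < z → 0 < sFun κ (z - x) := by
    intro x hx z hz hxz
    refine sFun_pos (by linarith) ?_
    have h1 := hG hx
    have h2 := hG hz
    have h3 : (z - x) ^ 2 < (b - a) ^ 2 := by
      have := h1.1; have := h2.2; nlinarith
    rcases le_or_gt κ 0 with h | h
    · have := Real.pi_pos; nlinarith [sq_nonneg (z - x), pow_pos this 2]
    · nlinarith
  obtain ⟨x1, hx1, hyx1⟩ : ∃ x1 ∈ G, y < x1 := by
    have hb := (hG hy).2
    have : (y + b) / 2 ∈ closure G := hd ⟨by linarith [(hG hy).1], by linarith⟩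
    obtain ⟨w, hw1, hw2⟩ := mem_closure_iff.1 this (Ioi y) isOpen_Ioi (by simp; linarith)
    exact ⟨w, hw2, hw1⟩
  obtain ⟨x0, hx0, hyx0⟩ : ∃ x0 ∈ G, x0 < y := by
    have hb := (hG hy).1
    have : (a + y) / 2 ∈ closure G := hd ⟨by linarith, by linarith [(hG hy).2]⟩
    obtain ⟨w, hw1, hw2⟩ := mem_closure_iff.1 this (Iio y) isOpen_Iio (by simp; linarith)
    exact ⟨w, hw2, hw1⟩
  set A := C * v y with hA
  -- Slopes at y of the solutions that take the value A at y and meet v at a point on the right.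
  -- Their supremum is the slope of the majorant.
  let S : Set ℝ := {B | ∃ x ∈ G, y < x ∧ B = (v x - A * cFun κ (x - y)) / sFun κ (x - y)}
  have key : ∀ x ∈ G, x < y → ∀ B ∈ S, B ≤ (A * cFun κ (y - x) - v x) / sFun κ (y - x) := by
    rintro x hx hxy B ⟨z, hz, hyz, rfl⟩
    rw [div_le_div_iff₀ (spos _ hy _ hz hyz) (spos _ hx _ hy hxy)]
    have h := H x hx z hz y hy hxy hyz
    -- Expanding s(z - x) at y makes the hypothesis on x < y < z a comparison of a right slope with
    -- a left slope.
    have e : z - x = (z - y) + (y - x) := by ring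
    rw [e, sFun_add] at h
    nlinarith
  have hne : S.Nonempty := ⟨_, x1, hx1, hyx1, rfl⟩
  have hbdd : BddAbove S := ⟨_, key x0 hx0 hyx0⟩
  obtain ⟨c, hc⟩ := exists_sol_initial κ y A (sSup S)
  refine ⟨c, fun x hx => ?_, by rw [hc]; simp [cFun_zero, sFun_zero]⟩
  rw [hc]
  rcases lt_trichotomy x y with h | rfl | h
  · have h1 := csSup_le hne (key x hx h)
    rw [le_div_iff₀ (spos _ hx _ hy h)] at h1
    have e : x - y = -(y - x) := by ring
    rw [e, cFun_neg, sFun_neg]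
    linarith
  · simp only [sub_self, cFun_zero, sFun_zero]
    have := hv x hx
    rw [hA]; nlinarith
  · have h1 := le_csSup hbdd ⟨x, hx, h, rfl⟩
    rw [div_le_iff₀ (spos _ hy _ hx h)] at h1
    linarith

/-- `u` is concave on `[a, b]` with respect to the solutions of `w'' + κ w = 0`, bounded,
and positive inside. -/
structure SolConcave (κ a b : ℝ) (u : ℝ → ℝ) : Prop where
  lt : a < b
  length_le : κ * (b - a) ^ 2 ≤ Real.pi ^ 2
  measurable : Measurable u
  nonneg : ∀ x, 0 ≤ u x
  bdd : ∃ M, ∀ x ∈ Icc a b, u x ≤ M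
  pos : ∀ x ∈ Ioo a b, 0 < u x
  concave : ∀ x ∈ Icc a b, ∀ y ∈ Icc a b, ∀ z, x < z → z < y → κ * (y - x) ^ 2 < Real.pi ^ 2 →
    sFun κ (y - z) * u x + sFun κ (z - x) * u y ≤ sFun κ (y - x) * u z

lemma kappa_mul_sq_lt {κ L θ : ℝ} (hκ : κ * L ^ 2 ≤ Real.pi ^ 2) (h0 : 0 ≤ θ) (h : θ < L) :
    κ * θ ^ 2 < Real.pi ^ 2 := by
  have h3 : θ ^ 2 < L ^ 2 := by nlinarith
  rcases le_or_gt κ 0 with h | h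
  · have := Real.pi_pos; nlinarith [sq_nonneg θ, pow_pos this 2]
  · nlinarith

/-- The hull of a quasi-concave function. -/
theorem exists_solConcave_hull {κ a b C : ℝ} {G : Set ℝ} {v : ℝ → ℝ} (hab : a < b)
    (hG : G ⊆ Ioo a b)
    (hd : Ioo a b ⊆ closure G) (hκ : κ * (b - a) ^ 2 ≤ Real.pi ^ 2) (hC : 1 ≤ C)
    (hv : ∀ x ∈ G, 0 < v x)
    (H : ∀ x ∈ G, ∀ y ∈ G, ∀ z ∈ G, x < z → z < y →
      sFun κ (y - z) * v x + sFun κ (z - x) * v y ≤ sFun κ (y - x) * (C * v z)) :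
    ∃ u, SolConcave κ a b u ∧ ∀ x ∈ G, v x ≤ u x ∧ u x ≤ C * v x := by
  let W := {c : ℝ × ℝ // ∀ x ∈ G, v x ≤ sol κ c x}
  obtain ⟨y0, hy0⟩ : G.Nonempty := by
    have : (a + b) / 2 ∈ closure G := hd ⟨by linarith, by linarith⟩
    exact closure_nonempty_iff.1 ⟨_, this⟩
  obtain ⟨c0, hc0, -⟩ := exists_sol_majorant hG hd hκ hC hv H hy0
  have : Nonempty W := ⟨⟨c0, hc0⟩⟩
  -- The truncation at 0 keeps the infimum bounded below on the whole line; it has no effect on [a,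
  -- b], where majorants are nonnegative.
  let u : ℝ → ℝ := fun x => ⨅ c : W, max (sol κ c.1 x) 0
  have hbdd : ∀ x, BddBelow (range fun c : W => max (sol κ c.1 x) 0) :=
    fun x => ⟨0, by rintro _ ⟨c, rfl⟩; exact le_max_right _ _⟩
  have hle : ∀ x (c : W), u x ≤ max (sol κ c.1 x) 0 := fun x c => ciInf_le (hbdd x) c
  have hIcc : Icc a b ⊆ closure G := by
    rw [← closure_Ioo hab.ne]
    exact closure_minimal hd isClosed_closure
  have hsol : ∀ (c : W), ∀ x ∈ Icc a b, 0 ≤ sol κ c.1 x := by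
    intro c x hx
    have hcl : IsClosed {x | 0 ≤ sol κ c.1 x} := isClosed_le continuous_const (continuous_sol κ c.1)
    exact closure_minimal (fun z hz => (hv z hz).le.trans (c.2 z hz)) hcl (hIcc hx)
  have hu0 : ∀ x, 0 ≤ u x := fun x => le_ciInf fun c => le_max_right _ _
  have hGu : ∀ x ∈ G, v x ≤ u x := fun x hx => le_ciInf fun c => (c.2 x hx).trans (le_max_left _ _)
  have hGu' : ∀ x ∈ G, u x ≤ C * v x := by
    intro x hx
    obtain ⟨c, hc, hcx⟩ := exists_sol_majorant hG hd hκ hC hv H hx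
    refine (hle x ⟨c, hc⟩).trans (max_le hcx.le ?_)
    have := hv x hx; positivity
  have hconc : ∀ x ∈ Icc a b, ∀ y ∈ Icc a b, ∀ z, x < z → z < y → κ * (y - x) ^ 2 < Real.pi ^ 2 →
      sFun κ (y - z) * u x + sFun κ (z - x) * u y ≤ sFun κ (y - x) * u z := by
    intro x hx y hy z hxz hzy h
    have p0 : 0 < sFun κ (y - x) := sFun_pos (by linarith) h
    have p1 : 0 < sFun κ (y - z) :=
      sFun_pos (by linarith) (kappa_mul_sq_lt h.le (by linarith) (by linarith))
    have p2 : 0 < sFun κ (z - x) :=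
      sFun_pos (by linarith) (kappa_mul_sq_lt h.le (by linarith) (by linarith))
    rw [← div_le_iff₀' p0]
    refine le_ciInf fun c => ?_
    refine le_trans ?_ (le_max_left _ _)
    rw [div_le_iff₀' p0, ← sol_interpolation]
    have h1 := hle x c
    have h2 := hle y c
    rw [max_eq_left (hsol c _ hx)] at h1
    rw [max_eq_left (hsol c _ hy)] at h2
    gcongr
  refine ⟨u, ⟨hab, hκ, ?_, hu0, ?_, ?_, hconc⟩, fun x hx => ⟨hGu x hx, hGu' x hx⟩⟩
  -- An infimum of continuous functions is upper semicontinuous: its strict sublevel sets are open.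
  · refine measurable_of_Iio fun r => ?_
    have : u ⁻¹' Iio r = ⋃ c : W, {x | max (sol κ c.1 x) 0 < r} := by
      ext x
      simp only [mem_preimage, mem_Iio, mem_iUnion, mem_ofPred_eq, u]
      exact ciInf_lt_iff (hbdd x)
    rw [this]
    exact (isOpen_iUnion fun c : W => isOpen_lt ((continuous_sol κ c.1).max continuous_const)
      continuous_const).measurableSet
  · obtain ⟨M, hM⟩ := (isCompact_Icc (a := a) (b := b)).bddAbove_image
      ((continuous_sol κ c0).max continuous_const : Continuous fun x => max (sol κ c0 x) 0).continuousOn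
    exact ⟨M, fun x hx => (hle x ⟨c0, hc0⟩).trans (hM ⟨x, hx, rfl⟩)⟩
  -- Positivity spreads by concavity from a point of G on the left of z; at the point on the right u
  -- ≥ 0 is enough.
  · intro z hz
    have : (a + z) / 2 ∈ closure G := hd ⟨by linarith [hz.1], by linarith [hz.1, hz.2]⟩
    obtain ⟨x, hxz, hx⟩ := mem_closure_iff.1 this (Iio z) isOpen_Iio (by simp; linarith [hz.1])
    have hxG := hG hx
    have hyb : (z + b) / 2 < b := by linarith [hz.2]
    have hxz' : x < z := hxz
    have hκ' : κ * ((z + b) / 2 - x) ^ 2 < Real.pi ^ 2 :=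
      kappa_mul_sq_lt hκ (by linarith [hz.2]) (by linarith [hxG.1])
    have h := hconc x (Ioo_subset_Icc_self hxG) ((z + b) / 2) ⟨by linarith [hz.1, hz.2], hyb.le⟩ z
      hxz (by linarith [hz.2]) hκ'
    have p0 : 0 < sFun κ ((z + b) / 2 - x) := sFun_pos (by linarith [hz.2]) hκ'
    have p1 : 0 < sFun κ ((z + b) / 2 - z) := sFun_pos (by linarith [hz.2])
      (kappa_mul_sq_lt hκ'.le (by linarith [hz.2]) (by linarith [hz.2]))
    have p2 : 0 < sFun κ (z - x) := sFun_pos (by linarith)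
      (kappa_mul_sq_lt hκ'.le (by linarith [hz.2]) (by linarith [hz.2]))
    have := hu0 ((z + b) / 2)
    have := (hv x hx).trans_le (hGu x hx)
    have : 0 < sFun κ ((z + b) / 2 - x) * u z := lt_of_lt_of_le (by positivity) h
    exact pos_of_mul_pos_right this p0.le

/-! ### Geodesics of the real line -/

/-- The affine geodesic from `z.1` to `z.2`. -/
noncomputable def seg (z : ℝ × ℝ) : Geo ℝ :=
  ⟨⟨fun t : I => (1 - (t : ℝ)) * z.1 + t * z.2, by fun_prop⟩, fun s t => by
    simp only [ContinuousMap.coe_mk, Real.dist_eq, Icc.coe_zero, Icc.coe_one]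
    rw [← abs_mul, ← abs_neg]
    congr 1; ring⟩

@[simp] lemma ev_seg (t : I) (z : ℝ × ℝ) : ev t (seg z) = (1 - (t : ℝ)) * z.1 + t * z.2 := rfl

lemma continuous_seg : Continuous seg := by
  refine Continuous.subtype_mk ?_ _
  exact (ContinuousMap.curry
    ⟨fun p : (ℝ × ℝ) × I => (1 - (p.2 : ℝ)) * p.1.1 + p.2 * p.1.2, by fun_prop⟩).continuous

lemma continuous_ev {X : Type*} [MetricSpace X] (t : I) : Continuous (ev t : Geo X → X) :=
  (continuous_eval_const (F := C(I, X)) t).comp continuous_subtype_val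

lemma measurable_seg : Measurable seg := continuous_seg.measurable

lemma measurable_ev (t : I) : Measurable (ev t : Geo ℝ → ℝ) := (continuous_ev t).measurable

/-- Strict convexity: the two distances to the endpoints determine a point of the segment. So
geodesics of the line correspond to pairs of endpoints. -/
lemma ev_eq (t : I) (γ : Geo ℝ) : ev t γ = (1 - (t : ℝ)) * ev 0 γ + t * ev 1 γ := by
  have h1 : dist (ev 0 γ) (ev t γ) = t * dist (ev 0 γ) (ev 1 γ) := by
    have := γ.2 0 t
    simpa [ev, abs_of_nonneg t.2.1] using this
  have h2 : dist (ev t γ) (ev 1 γ) = (1 - t) * dist (ev 0 γ) (ev 1 γ) := by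
    have := γ.2 t 1
    rw [abs_sub_comm] at this
    simpa [ev, abs_of_nonneg (sub_nonneg.2 t.2.2)] using this
  have := eq_lineMap_of_dist_eq_mul_of_dist_eq_mul h1 h2
  rw [this, AffineMap.lineMap_apply]
  simp; ring

lemma seg_ev (γ : Geo ℝ) : seg (ev 0 γ, ev 1 γ) = γ := by
  refine Subtype.ext (ContinuousMap.ext fun t => ?_)
  exact (ev_eq t γ).symm

lemma measurable_ends : Measurable fun γ : Geo ℝ => (ev 0 γ, ev 1 γ) :=
  (measurable_ev 0).prodMk (measurable_ev 1)

lemma Icc_subset_geoHull {Ω : Set ℝ} {a b : ℝ} (hab : a < b) (ha : a ∈ Ω) (hb : b ∈ Ω) :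
    Icc a b ⊆ geoHull Ω := by
  intro x hx
  have hba : 0 < b - a := sub_pos.2 hab
  refine ⟨seg (a, b), by simpa using ha, by simpa using hb, ⟨(x - a) / (b - a), ?_, ?_⟩, ?_⟩
  · exact div_nonneg (by linarith [hx.1]) hba.le
  · rw [div_le_one hba]; linarith [hx.2]
  · simp; field_simp; ring

/-! ### Optimal transport on a bounded interval -/

/-- The product of the excesses is the area of the rectangle (a, z₁) × (a, z₂), and Tonelli
exchanges this area with π. A plan is thereby seen only through its masses of quadrants. -/
lemma lintegral_excess_mul (a : ℝ) (π : Measure (ℝ × ℝ)) [SFinite π] :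
    ∫⁻ z, ENNReal.ofReal (z.1 - a) * ENNReal.ofReal (z.2 - a) ∂π =
      ∫⁻ w, π (Ioi w.1 ×ˢ Ioi w.2)
        ∂((volume.restrict (Ioi a)).prod (volume.restrict (Ioi a)) : Measure (ℝ × ℝ)) := by
  set l : Measure (ℝ × ℝ) := (volume.restrict (Ioi a)).prod (volume.restrict (Ioi a)) with hl
  let S : Set ((ℝ × ℝ) × (ℝ × ℝ)) := {p | p.2.1 < p.1.1 ∧ p.2.2 < p.1.2}
  have hS : MeasurableSet S :=
    (measurableSet_lt (f := fun p : (ℝ × ℝ) × (ℝ × ℝ) => p.2.1) (g := fun p => p.1.1)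
      (by fun_prop) (by fun_prop)).inter
    (measurableSet_lt (f := fun p : (ℝ × ℝ) × (ℝ × ℝ) => p.2.2) (g := fun p => p.1.2)
      (by fun_prop) (by fun_prop))
  have h1 := Measure.prod_apply (μ := π) (ν := l) hS
  have h2 := Measure.prod_apply_symm (μ := π) (ν := l) hS
  have e1 : ∀ z : ℝ × ℝ, l (Prod.mk z ⁻¹' S) =
      ENNReal.ofReal (z.1 - a) * ENNReal.ofReal (z.2 - a) := by
    intro z
    have : Prod.mk z ⁻¹' S = Iio z.1 ×ˢ Iio z.2 := by ext w; simp [S]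
    rw [this, hl, Measure.prod_prod, Measure.restrict_apply measurableSet_Iio,
      Measure.restrict_apply measurableSet_Iio, inter_comm, Ioi_inter_Iio, inter_comm,
      Ioi_inter_Iio, Real.volume_Ioo, Real.volume_Ioo]
  have e2 : ∀ w : ℝ × ℝ, (fun z => (z, w)) ⁻¹' S = Ioi w.1 ×ˢ Ioi w.2 := by
    intro w; ext z; simp [S]
  simp_rw [e1] at h1
  simp_rw [e2] at h2
  rw [← h1, h2]

/-- This is (x-y)² + 2(x-a)(y-a) = (x-a)² + (y-a)² integrated. The right side depends on the
marginals only, so minimizing the cost means maximizing the product term. -/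
lemma cost_add_excess {a : ℝ} {μ₀ μ₁ : Measure ℝ} {π : Measure (ℝ × ℝ)} (hπ : IsPlan μ₀ μ₁ π)
    (h0 : ∀ᵐ x ∂μ₀, a ≤ x) (h1 : ∀ᵐ x ∂μ₁, a ≤ x) :
    cost π + 2 * ∫⁻ z, ENNReal.ofReal (z.1 - a) * ENNReal.ofReal (z.2 - a) ∂π =
      ∫⁻ x, ENNReal.ofReal (x - a) ^ 2 ∂μ₀ + ∫⁻ x, ENNReal.ofReal (x - a) ^ 2 ∂μ₁ := by
  have hm : Measurable fun x : ℝ => ENNReal.ofReal (x - a) ^ 2 := by fun_prop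
  rw [← hπ.1, ← hπ.2, lintegral_map hm measurable_fst, lintegral_map hm measurable_snd,
    cost, ← lintegral_const_mul _ (by fun_prop), ← lintegral_add_right _ (by fun_prop),
    ← lintegral_add_right _ (by fun_prop)]
  refine lintegral_congr_ae ?_
  rw [← hπ.1] at h0
  rw [← hπ.2] at h1
  filter_upwards [ae_of_ae_map measurable_fst.aemeasurable h0,
    ae_of_ae_map measurable_snd.aemeasurable h1] with z hz1 hz2
  have g1 : 0 ≤ z.1 - a := by linarith
  have g2 : 0 ≤ z.2 - a := by linarith
  rw [edist_dist, ← ENNReal.ofReal_pow dist_nonneg, ← ENNReal.ofReal_pow g1,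
    ← ENNReal.ofReal_pow g2, ← ENNReal.ofReal_mul g1, ← ENNReal.ofReal_add (by positivity)
    (by positivity), ← ENNReal.ofReal_ofNat 2, ← ENNReal.ofReal_mul (by norm_num),
    ← ENNReal.ofReal_add (by positivity) (by positivity), Real.dist_eq, sq_abs]
  congr 1; ring

lemma measure_Ioi_prod_le {μ₀ μ₁ : Measure ℝ} {π : Measure (ℝ × ℝ)} (hπ : IsPlan μ₀ μ₁ π)
    (w : ℝ × ℝ) : π (Ioi w.1 ×ˢ Ioi w.2) ≤ min (μ₀ (Ioi w.1)) (μ₁ (Ioi w.2)) := by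
  rw [← hπ.1, ← hπ.2, Measure.map_apply measurable_fst measurableSet_Ioi,
    Measure.map_apply measurable_snd measurableSet_Ioi]
  exact le_min (measure_mono fun z hz => hz.1) (measure_mono fun z hz => hz.2)

lemma isPlan_graph (μ : Measure ℝ) {T : ℝ → ℝ} (hT : Measurable T) :
    IsPlan μ (μ.map T) (μ.map fun x => (x, T x)) := by
  constructor
  · rw [Measure.map_map measurable_fst (by fun_prop)]
    exact Measure.map_id
  · rw [Measure.map_map measurable_snd (by fun_prop)]; rfl

/-- Upper sets of the line are nested, so the intersection of a half-line with the preimage of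
another is the smaller of the two. Monotone graphs thus attain the bound of `measure_Ioi_prod_le` on
every quadrant at once. -/
lemma measure_Ioi_prod_graph (μ : Measure ℝ) {T : ℝ → ℝ} (hT : Monotone T) (w : ℝ × ℝ) :
    (μ.map fun x => (x, T x)) (Ioi w.1 ×ˢ Ioi w.2) = min (μ (Ioi w.1)) (μ.map T (Ioi w.2)) := by
  have hTm := hT.measurable
  rw [Measure.map_apply (by fun_prop) (measurableSet_Ioi.prod measurableSet_Ioi),
    Measure.map_apply hTm measurableSet_Ioi]
  have : (fun x => (x, T x)) ⁻¹' (Ioi w.1 ×ˢ Ioi w.2) = Ioi w.1 ∩ T ⁻¹' Ioi w.2 := by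
    ext x; simp
  rw [this]
  have hup : IsUpperSet (T ⁻¹' Ioi w.2) := (isUpperSet_Ioi _).preimage hT
  rcases IsUpperSet.total (isUpperSet_Ioi w.1) hup with h | h
  · rw [inter_eq_left.2 h, min_eq_left (measure_mono h)]
  · rw [inter_eq_right.2 h, min_eq_right (measure_mono h)]

lemma excess_sq_lt_top {a b : ℝ} {μ : Measure ℝ} [IsFiniteMeasure μ]
    (h : ∀ᵐ x ∂μ, x ∈ Icc a b) : ∫⁻ x, ENNReal.ofReal (x - a) ^ 2 ∂μ < ⊤ := by
  calc ∫⁻ x, ENNReal.ofReal (x - a) ^ 2 ∂μ ≤ ∫⁻ x, ENNReal.ofReal (b - a) ^ 2 ∂μ := by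
        refine lintegral_mono_ae ?_
        filter_upwards [h] with x hx
        gcongr; exact hx.2
    _ < ⊤ := by
        rw [lintegral_const]
        exact ENNReal.mul_lt_top (by simp) (measure_lt_top _ _)

/-- Each quadrant has its largest possible mass under the monotone graph, so the product term is
maximal and the cost minimal. Bounded supports make that term finite, so that it can be cancelled.
-/
theorem isOptPlan_graph {a b : ℝ} {μ : Measure ℝ} [IsProbabilityMeasure μ] {T : ℝ → ℝ}
    (hT : Monotone T) (h0 : ∀ᵐ x ∂μ, x ∈ Icc a b) (h1 : ∀ᵐ x ∂μ, T x ∈ Icc a b) :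
    IsOptPlan μ (μ.map T) (μ.map fun x => (x, T x)) := by
  have hTm := hT.measurable
  have h1' : ∀ᵐ x ∂(μ.map T), x ∈ Icc a b := (ae_map_iff hTm.aemeasurable measurableSet_Icc).2 h1
  have : IsProbabilityMeasure (μ.map T) := Measure.isProbabilityMeasure_map hTm.aemeasurable
  have hp := isPlan_graph μ hTm
  refine ⟨hp, fun π' hπ' => ?_⟩
  have : IsFiniteMeasure π' := by
    constructor
    have : π' univ = μ univ := by
      rw [← hπ'.1, Measure.map_apply measurable_fst MeasurableSet.univ]; rfl
    rw [this]; exact measure_lt_top _ _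
  have g0 : ∀ᵐ x ∂μ, a ≤ x := h0.mono fun x h => h.1
  have g1 : ∀ᵐ x ∂(μ.map T), a ≤ x := h1'.mono fun x h => h.1
  have e := cost_add_excess hp g0 g1
  have e' := cost_add_excess hπ' g0 g1
  rw [← e] at e'
  rw [lintegral_excess_mul, lintegral_excess_mul] at e'
  have hle : ∫⁻ w, π' (Ioi w.1 ×ˢ Ioi w.2)
        ∂((volume.restrict (Ioi a)).prod (volume.restrict (Ioi a)) : Measure (ℝ × ℝ)) ≤
      ∫⁻ w, (μ.map fun x => (x, T x)) (Ioi w.1 ×ˢ Ioi w.2)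
        ∂((volume.restrict (Ioi a)).prod (volume.restrict (Ioi a)) : Measure (ℝ × ℝ)) := by
    refine lintegral_mono fun w => ?_
    rw [measure_Ioi_prod_graph μ hT w]
    exact measure_Ioi_prod_le hπ' w
  have hfin : ∫⁻ w, (μ.map fun x => (x, T x)) (Ioi w.1 ×ˢ Ioi w.2)
        ∂((volume.restrict (Ioi a)).prod (volume.restrict (Ioi a)) : Measure (ℝ × ℝ)) ≠ ⊤ := by
    rw [← lintegral_excess_mul]
    intro htop
    rw [htop] at e
    have := ENNReal.add_lt_top.2 ⟨excess_sq_lt_top h0, excess_sq_lt_top h1'⟩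
    rw [← e] at this
    simp at this
  have : cost (μ.map fun x => (x, T x)) + 2 * ∫⁻ w, (μ.map fun x => (x, T x)) (Ioi w.1 ×ˢ Ioi w.2)
        ∂((volume.restrict (Ioi a)).prod (volume.restrict (Ioi a)) : Measure (ℝ × ℝ)) ≤
      cost π' + 2 * ∫⁻ w, (μ.map fun x => (x, T x)) (Ioi w.1 ×ˢ Ioi w.2)
        ∂((volume.restrict (Ioi a)).prod (volume.restrict (Ioi a)) : Measure (ℝ × ℝ)) := by
    rw [← e']; gcongr
  exact (ENNReal.add_le_add_iff_right (ENNReal.mul_ne_top (by simp) hfin)).1 this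

/-- An open quadrant is the increasing union of quadrants with corners moved up and right, and
between two such corners there is always one where the equality holds. -/
lemma measure_Ioi_prod_le_of_ae {a : ℝ} {π π' : Measure (ℝ × ℝ)}
    (h : ∀ᵐ w ∂((volume.restrict (Ioi a)).prod (volume.restrict (Ioi a)) : Measure (ℝ × ℝ)),
      π (Ioi w.1 ×ˢ Ioi w.2) = π' (Ioi w.1 ×ˢ Ioi w.2)) (w : ℝ × ℝ) (hw1 : a ≤ w.1)
    (hw2 : a ≤ w.2) : π (Ioi w.1 ×ˢ Ioi w.2) ≤ π' (Ioi w.1 ×ˢ Ioi w.2) := by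
  let f : ℕ → ℝ := fun n => 1 / ((n : ℝ) + 1)
  have hfpos : ∀ n, 0 < f n := fun n => by positivity
  let s : ℕ → Set (ℝ × ℝ) := fun n => Ioi (w.1 + f n) ×ˢ Ioi (w.2 + f n)
  have hanti : ∀ m n, m ≤ n → f n ≤ f m := fun m n h => one_div_le_one_div_of_le (by positivity)
    (by gcongr)
  have hmono : Monotone s := fun m n hmn => prod_mono
    (Ioi_subset_Ioi (by linarith [hanti m n hmn])) (Ioi_subset_Ioi (by linarith [hanti m n hmn]))
  have hU : ⋃ n, s n = Ioi w.1 ×ˢ Ioi w.2 := by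
    ext z
    simp only [s, mem_iUnion, mem_prod, mem_Ioi]
    constructor
    · rintro ⟨n, h1, h2⟩
      exact ⟨by linarith [hfpos n], by linarith [hfpos n]⟩
    · rintro ⟨h1, h2⟩
      obtain ⟨n, hn⟩ := exists_nat_one_div_lt (lt_min (sub_pos.2 h1) (sub_pos.2 h2))
      refine ⟨n, ?_, ?_⟩
      · have := hn.trans_le (min_le_left _ _); simp only [f]; linarith
      · have := hn.trans_le (min_le_right _ _); simp only [f]; linarith
  have htend := tendsto_measure_iUnion_atTop (μ := π) hmono
  rw [hU] at htend
  refine le_of_tendsto' htend fun n => ?_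
  have hpos : ((volume.restrict (Ioi a)).prod (volume.restrict (Ioi a)) : Measure (ℝ × ℝ))
      (Ioo w.1 (w.1 + f n) ×ˢ Ioo w.2 (w.2 + f n)) ≠ 0 := by
    rw [Measure.prod_prod, Measure.restrict_apply measurableSet_Ioo,
      Measure.restrict_apply measurableSet_Ioo,
      inter_eq_left.2 (Ioo_subset_Ioi_self.trans (Ioi_subset_Ioi hw1)),
      inter_eq_left.2 (Ioo_subset_Ioi_self.trans (Ioi_subset_Ioi hw2)), Real.volume_Ioo,
      Real.volume_Ioo]
    have := hfpos n
    simp [this]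
  obtain ⟨u, hu, hu'⟩ : ∃ u ∈ Ioo w.1 (w.1 + f n) ×ˢ Ioo w.2 (w.2 + f n),
      π (Ioi u.1 ×ˢ Ioi u.2) = π' (Ioi u.1 ×ˢ Ioi u.2) := by
    by_contra! hcon
    exact hpos (measure_mono_null (fun u hu => hcon u hu) h)
  calc π (s n) ≤ π (Ioi u.1 ×ˢ Ioi u.2) := measure_mono
        (prod_mono (Ioi_subset_Ioi hu.1.2.le) (Ioi_subset_Ioi hu.2.2.le))
    _ = π' (Ioi u.1 ×ˢ Ioi u.2) := hu'
    _ ≤ _ := measure_mono (prod_mono (Ioi_subset_Ioi hu.1.1.le) (Ioi_subset_Ioi hu.2.1.le))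

lemma ext_of_Ioi_prod {π π' : Measure (ℝ × ℝ)} [IsFiniteMeasure π] (huniv : π univ = π' univ)
    (h : ∀ s t : ℝ, π (Ioi s ×ˢ Ioi t) = π' (Ioi s ×ˢ Ioi t)) : π = π' := by
  have hspan : IsCountablySpanning (range (Ioi : ℝ → Set ℝ)) :=
    ⟨fun n : ℕ => Ioi (-(n : ℝ)), fun n => ⟨_, rfl⟩, by
      ext x
      simp only [mem_iUnion, mem_Ioi, mem_univ, iff_true]
      obtain ⟨n, hn⟩ := exists_nat_gt (-x)
      exact ⟨n, by linarith⟩⟩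
  have hgen : MeasurableSpace.generateFrom (range (Ioi : ℝ → Set ℝ)) =
      (inferInstance : MeasurableSpace ℝ) := by
    rw [← borel_eq_generateFrom_Ioi]; exact (BorelSpace.measurable_eq).symm
  refine ext_of_generate_finite _ (generateFrom_eq_prod hgen hgen hspan hspan).symm
    (isPiSystem_Ioi.prod isPiSystem_Ioi) ?_ huniv
  rintro _ ⟨_, ⟨s, rfl⟩, _, ⟨t, rfl⟩, rfl⟩
  exact h s t

/-- Equal costs give equal integrals of quadrant masses; since these are ordered pointwise they
agree almost everywhere, then everywhere, and quadrants determine a finite measure. -/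
theorem IsOptPlan.eq_graph {a b : ℝ} {μ : Measure ℝ} [IsProbabilityMeasure μ] {T : ℝ → ℝ}
    (hT : Monotone T) (h0 : ∀ᵐ x ∂μ, x ∈ Icc a b) (h1 : ∀ᵐ x ∂μ, T x ∈ Icc a b)
    {π : Measure (ℝ × ℝ)} (hπ : IsOptPlan μ (μ.map T) π) : π = μ.map fun x => (x, T x) := by
  have hTm := hT.measurable
  set π' := μ.map fun x => (x, T x) with hπ'def
  have hπ' : IsOptPlan μ (μ.map T) π' := isOptPlan_graph hT h0 h1
  have hcost : cost π = cost π' := le_antisymm (hπ.2 _ hπ'.1) (hπ'.2 _ hπ.1)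
  have h1' : ∀ᵐ x ∂(μ.map T), x ∈ Icc a b := (ae_map_iff hTm.aemeasurable measurableSet_Icc).2 h1
  have : IsProbabilityMeasure (μ.map T) := Measure.isProbabilityMeasure_map hTm.aemeasurable
  have : IsProbabilityMeasure π' := Measure.isProbabilityMeasure_map (by fun_prop)
  have hu : π univ = μ univ := by
    rw [← hπ.1.1, Measure.map_apply measurable_fst MeasurableSet.univ]; rfl
  have : IsFiniteMeasure π := ⟨by rw [hu]; exact measure_lt_top _ _⟩
  -- The base point is left free below a, so that quadrants with arbitrarily low corners are
  -- reached.
  have main : ∀ c, c ≤ a →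
      ∀ᵐ w ∂((volume.restrict (Ioi c)).prod (volume.restrict (Ioi c)) : Measure (ℝ × ℝ)),
      π (Ioi w.1 ×ˢ Ioi w.2) = π' (Ioi w.1 ×ˢ Ioi w.2) := by
    intro c hc
    have k0 : ∀ᵐ x ∂μ, x ∈ Icc c b := h0.mono fun x h => ⟨hc.trans h.1, h.2⟩
    have k1 : ∀ᵐ x ∂(μ.map T), x ∈ Icc c b := h1'.mono fun x h => ⟨hc.trans h.1, h.2⟩
    have e := cost_add_excess hπ.1 (k0.mono fun x h => h.1) (k1.mono fun x h => h.1)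
    have e' := cost_add_excess hπ'.1 (k0.mono fun x h => h.1) (k1.mono fun x h => h.1)
    have hfin := ENNReal.add_lt_top.2 ⟨excess_sq_lt_top k0, excess_sq_lt_top k1⟩
    rw [← e] at hfin
    rw [← e', hcost, lintegral_excess_mul, lintegral_excess_mul] at e
    rw [lintegral_excess_mul, hcost, ENNReal.add_lt_top] at hfin
    have e2 := (ENNReal.add_right_inj hfin.1.ne).1 e
    have e3 := (ENNReal.mul_right_inj (by simp) (by simp)).1 e2
    refine ae_eq_of_ae_le_of_lintegral_le (Eventually.of_forall fun w => ?_) ?_ ?_ e3.ge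
    · simp only
      rw [hπ'def, measure_Ioi_prod_graph μ hT w]
      exact measure_Ioi_prod_le hπ.1 w
    · intro htop
      rw [htop] at hfin
      simp at hfin
    · have : ∀ w : ℝ × ℝ, π' (Ioi w.1 ×ˢ Ioi w.2) = min (μ (Ioi w.1)) (μ.map T (Ioi w.2)) :=
        measure_Ioi_prod_graph μ hT
      simp_rw [this]
      have ha : ∀ ρ : Measure ℝ, Measurable fun x => ρ (Ioi x) := fun ρ =>
        Antitone.measurable fun x y h => measure_mono (Ioi_subset_Ioi h)
      exact (((ha μ).comp measurable_fst).min ((ha _).comp measurable_snd)).aemeasurable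
  refine ext_of_Ioi_prod (by rw [hu, measure_univ, measure_univ]) fun s t => ?_
  have hm := main (min a (min s t)) (min_le_left _ _)
  have hs : min a (min s t) ≤ s := (min_le_right _ _).trans (min_le_left _ _)
  have ht : min a (min s t) ≤ t := (min_le_right _ _).trans (min_le_right _ _)
  exact le_antisymm (measure_Ioi_prod_le_of_ae hm (s, t) hs ht)
    (measure_Ioi_prod_le_of_ae (hm.mono fun w h => h.symm) (s, t) hs ht)

/-! ### Monotone rearrangement -/

open ProbabilityTheory in
-- Without atoms the distribution function is continuous, so a sublevel set that is nonempty and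
-- bounded above is a closed half-line at whose end the value is exactly c. The sublevel set is the
-- whole line if c = 1, and it can be empty only if c = 0.
lemma measure_cdf_le (μ : Measure ℝ) [IsProbabilityMeasure μ] [NullSingletonClass μ] {c : ℝ} (h0 : 0 ≤ c)
    (h1 : c ≤ 1) : μ {x | cdf μ x ≤ c} = ENNReal.ofReal c := by
  rcases h1.eq_or_lt with rfl | h1
  · have : {x | cdf μ x ≤ 1} = univ := eq_univ_of_forall fun x => cdf_le_one μ x
    rw [this]; simp
  set S := {x | cdf μ x ≤ c} with hS
  have hlow : ∀ x ∈ S, ∀ y, y ≤ x → y ∈ S := fun x hx y hy => (monotone_cdf μ hy).trans hx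
  rcases S.eq_empty_or_nonempty with hemp | hne
  · have : c ≤ 0 := by
      refine ge_of_tendsto' (tendsto_cdf_atBot μ) fun x => ?_
      by_contra! hx
      have : x ∈ S := hx.le
      rw [hemp] at this; exact this
    rw [hemp, le_antisymm this h0]; simp
  have hbdd : BddAbove S := by
    obtain ⟨x, hx⟩ := ((tendsto_cdf_atTop μ).eventually (lt_mem_nhds h1)).exists
    refine ⟨x, fun y hy => ?_⟩
    by_contra! hxy
    exact absurd (monotone_cdf μ hxy.le) (not_le.2 (lt_of_le_of_lt hy hx))
  set s := sSup S with hs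
  have hgt : ∀ x, s < x → c < cdf μ x := fun x hx => by
    by_contra! h
    exact absurd (le_csSup hbdd h) (not_le.2 hx)
  have hlt : ∀ x, x < s → cdf μ x ≤ c := fun x hx => by
    obtain ⟨y, hy, hxy⟩ := exists_lt_of_lt_csSup hne hx
    exact hlow y hy x hxy.le
  have hge : c ≤ cdf μ s := by
    have := ((cdf μ).right_continuous s).tendsto.mono_left (nhdsWithin_mono s Ioi_subset_Ici_self)
    exact ge_of_tendsto this (eventually_mem_nhdsWithin.mono fun x hx => (hgt x hx).le)
  have hle : cdf μ s ≤ c := by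
    have hsing := (cdf μ).measure_singleton s
    rw [measure_cdf, measure_singleton, eq_comm, ENNReal.ofReal_eq_zero] at hsing
    have := (cdf μ).mono.tendsto_leftLim s
    have := le_of_tendsto this (eventually_mem_nhdsWithin.mono fun x hx => hlt x hx)
    linarith
  have hSI : S = Iic s := by
    ext x
    refine ⟨fun hx => le_csSup hbdd hx, fun hx => ?_⟩
    exact hlow s hle x hx
  rw [hSI, ← ofReal_cdf, le_antisymm hle hge]

open ProbabilityTheory in
/-- Monotone rearrangement of an atomless probability measure. -/
theorem exists_monotone_map_eq {a b : ℝ} (μ₀ μ₁ : Measure ℝ) [IsProbabilityMeasure μ₀]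
    [NullSingletonClass μ₀] [IsProbabilityMeasure μ₁] (h1 : ∀ᵐ x ∂μ₁, x ∈ Icc a b) :
    ∃ T : ℝ → ℝ, Monotone T ∧ (∀ x, T x ∈ Icc a b) ∧ μ₀.map T = μ₁ := by
  have hc1 : μ₁ (Icc a b)ᶜ = 0 := mem_ae_iff.1 h1
  have hb : ∀ y, b ≤ y → cdf μ₁ y = 1 := by
    intro y hy
    rw [cdf_eq_real, measureReal_def, prob_compl_eq_zero_iff measurableSet_Iic |>.1]
    · simp
    · refine measure_mono_null ?_ hc1
      exact compl_subset_compl.2 fun x hx => hx.2.trans hy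
  have ha : ∀ y, y < a → μ₁ (Iic y) = 0 := fun y hy => by
    refine measure_mono_null (subset_compl_comm.1 fun x hx => ?_) hc1
    exact not_le.2 (hy.trans_le hx.1)
  have hab : a ≤ b := by
    obtain ⟨x, hx⟩ := h1.exists
    exact hx.1.trans hx.2
  -- The generalized inverse of the second distribution function, applied to the first. Restricting
  -- y to [a, b] makes the infimum meaningful at every x, also where the first one vanishes.
  let S : ℝ → Set ℝ := fun x => {y | y ∈ Icc a b ∧ cdf μ₀ x ≤ cdf μ₁ y}
  have hbS : ∀ x, b ∈ S x := fun x => ⟨⟨hab, le_rfl⟩, by rw [hb b le_rfl]; exact cdf_le_one _ _⟩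
  have hbdd : ∀ x, BddBelow (S x) := fun x => ⟨a, fun y hy => hy.1.1⟩
  let T : ℝ → ℝ := fun x => sInf (S x)
  have hTm : Monotone T := fun x x' h =>
    csInf_le_csInf (hbdd x) ⟨b, hbS x'⟩ fun y hy => ⟨hy.1, (monotone_cdf _ h).trans hy.2⟩
  have hTI : ∀ x, T x ∈ Icc a b := fun x =>
    ⟨le_csInf ⟨b, hbS x⟩ fun y hy => hy.1.1, csInf_le (hbdd x) (hbS x)⟩
  have : IsProbabilityMeasure (μ₀.map T) :=
    Measure.isProbabilityMeasure_map hTm.measurable.aemeasurable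
  refine ⟨T, hTm, hTI, Measure.ext_of_Iic _ _ fun y => ?_⟩
  rw [Measure.map_apply hTm.measurable measurableSet_Iic]
  rcases lt_or_ge y a with hy | hy
  · rw [ha y hy]
    have : T ⁻¹' Iic y = ∅ := by
      ext x; simp only [mem_preimage, mem_Iic, mem_empty_iff_false, iff_false, not_le]
      exact hy.trans_le (hTI x).1
    rw [this, measure_empty]
  · have : T ⁻¹' Iic y = {x | cdf μ₀ x ≤ cdf μ₁ y} := by
      ext x
      simp only [mem_preimage, mem_Iic, mem_ofPred_eq]
      constructor
      · intro hx
        have hc : ∀ z, y < z → cdf μ₀ x ≤ cdf μ₁ z := by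
          intro z hz
          obtain ⟨u, hu, huz⟩ := exists_lt_of_csInf_lt ⟨b, hbS x⟩ (lt_of_le_of_lt hx hz)
          exact hu.2.trans (monotone_cdf _ huz.le)
        have := ((cdf μ₁).right_continuous y).tendsto.mono_left
          (nhdsWithin_mono y Ioi_subset_Ici_self)
        exact ge_of_tendsto this (eventually_mem_nhdsWithin.mono fun z hz => hc z hz)
      · intro hx
        rcases le_or_gt y b with hyb | hyb
        · exact csInf_le (hbdd x) ⟨⟨hy, hyb⟩, hx⟩
        · exact (hTI x).2.trans hyb.le
    rw [this, measure_cdf_le μ₀ (cdf_nonneg _ _) (cdf_le_one _ _), ofReal_cdf]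

/-! ### Dynamical plans -/

/-- The dynamical plan of the transport map `T`. -/
noncomputable def dynPlan (μ : Measure ℝ) (T : ℝ → ℝ) : Measure (Geo ℝ) :=
  μ.map fun x => seg (x, T x)

lemma measurable_seg_graph {T : ℝ → ℝ} (hT : Measurable T) : Measurable fun x => seg (x, T x) :=
  measurable_seg.comp (measurable_id.prodMk hT)

lemma map_ev_dynPlan (μ : Measure ℝ) {T : ℝ → ℝ} (hT : Measurable T) (t : I) :
    (dynPlan μ T).map (ev t) = μ.map fun x => (1 - (t : ℝ)) * x + t * T x := by
  rw [dynPlan, Measure.map_map (measurable_ev t) (measurable_seg_graph hT)]; rfl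

lemma map_ends_dynPlan (μ : Measure ℝ) {T : ℝ → ℝ} (hT : Measurable T) :
    (dynPlan μ T).map (fun γ => (ev 0 γ, ev 1 γ)) = μ.map fun x => (x, T x) := by
  rw [dynPlan, Measure.map_map measurable_ends (measurable_seg_graph hT)]
  congr 1
  ext x <;> simp

theorem dynPlan_mem_optGeo {a b : ℝ} {μ : Measure ℝ} [IsProbabilityMeasure μ] {T : ℝ → ℝ}
    (hT : Monotone T) (h0 : ∀ᵐ x ∂μ, x ∈ Icc a b) (h1 : ∀ᵐ x ∂μ, T x ∈ Icc a b) :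
    dynPlan μ T ∈ OptGeo μ (μ.map T) := by
  have hTm := hT.measurable
  refine ⟨Measure.isProbabilityMeasure_map (measurable_seg_graph hTm).aemeasurable,
    ?_, ?_, ?_⟩
  · rw [map_ev_dynPlan μ hTm]; simp
  · rw [map_ev_dynPlan μ hTm]; simp
  · rw [map_ends_dynPlan μ hTm]
    exact isOptPlan_graph hT h0 h1

/-- A dynamical plan on the line is the image under `seg` of its endpoint plan, and the optimal
endpoint plan is unique. -/
theorem eq_dynPlan_of_mem_optGeo {a b : ℝ} {μ : Measure ℝ} [IsProbabilityMeasure μ] {T : ℝ → ℝ}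
    (hT : Monotone T) (h0 : ∀ᵐ x ∂μ, x ∈ Icc a b) (h1 : ∀ᵐ x ∂μ, T x ∈ Icc a b)
    {ν : Measure (Geo ℝ)} (hν : ν ∈ OptGeo μ (μ.map T)) : ν = dynPlan μ T := by
  have hTm := hT.measurable
  have h := IsOptPlan.eq_graph hT h0 h1 hν.2.2.2
  have h2 : (ν.map fun γ => (ev 0 γ, ev 1 γ)).map seg = ν := by
    rw [Measure.map_map measurable_seg measurable_ends]
    have : (seg ∘ fun γ : Geo ℝ => (ev 0 γ, ev 1 γ)) = id := funext seg_ev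
    rw [this, Measure.map_id]
  rw [← h2, h, Measure.map_map measurable_seg (by fun_prop)]
  rfl

/-! ### Densities along a monotone transport -/

open ProbabilityTheory in
-- The image measure has no atoms, so fibres of S are null and the distribution functions satisfy F₁
-- ∘ S = F₀. Differentiating this identity almost everywhere is the change of variables formula.
lemma ae_rnDeriv_map_monotone {μ : Measure ℝ} [IsProbabilityMeasure μ] {S : ℝ → ℝ}
    (hS : Monotone S) (h1 : μ ≪ volume) (h2 : μ.map S ≪ volume) :
    ∀ᵐ x ∂μ, DifferentiableAt ℝ S x ∧ (μ.rnDeriv volume x).toReal =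
      ((μ.map S).rnDeriv volume (S x)).toReal * deriv S x := by
  have hSm := hS.measurable
  have : IsProbabilityMeasure (μ.map S) := Measure.isProbabilityMeasure_map hSm.aemeasurable
  have hF : ∀ x, cdf (μ.map S) (S x) = cdf μ x := by
    intro x
    rw [cdf_eq_real, cdf_eq_real, measureReal_def, measureReal_def]
    congr 1
    rw [Measure.map_apply hSm measurableSet_Iic]
    refine le_antisymm ?_ (measure_mono fun y hy => hS hy)
    have hsub : S ⁻¹' Iic (S x) ⊆ Iic x ∪ S ⁻¹' {S x} := by
      intro y hy
      rcases le_or_gt y x with h | h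
      · exact Or.inl h
      · exact Or.inr (le_antisymm hy (hS h.le))
    have hz : μ (S ⁻¹' {S x}) = 0 := by
      rw [← Measure.map_apply hSm (measurableSet_singleton _)]
      exact h2 (by simp)
    calc μ (S ⁻¹' Iic (S x)) ≤ μ (Iic x ∪ S ⁻¹' {S x}) := measure_mono hsub
      _ ≤ μ (Iic x) + μ (S ⁻¹' {S x}) := measure_union_le _ _
      _ = μ (Iic x) := by rw [hz, add_zero]
  have d0 := (cdf μ).ae_hasDerivAt
  have d1 := (cdf (μ.map S)).ae_hasDerivAt
  rw [measure_cdf] at d0 d1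
  filter_upwards [h1.ae_le d0, ae_of_ae_map hSm.aemeasurable (h2.ae_le d1),
    h1.ae_le hS.ae_differentiableAt] with x e0 e1 e2
  refine ⟨e2, ?_⟩
  have hc : HasDerivAt (fun x => cdf (μ.map S) (S x)) _ x := e1.comp x e2.hasDerivAt
  simp_rw [hF] at hc
  exact e0.unique hc

lemma ae_rnDeriv_withDensity {h : ℝ → ℝ} (hm : Measurable h) {μ : Measure ℝ}
    [IsProbabilityMeasure μ] (h1 : μ ≪ volume.withDensity fun x => ENNReal.ofReal (h x)) :
    ∀ᵐ x ∂μ, ∃ r, 0 < r ∧ 0 < h x ∧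
      μ.rnDeriv (volume.withDensity fun x => ENNReal.ofReal (h x)) x = ENNReal.ofReal r ∧
      (μ.rnDeriv volume x).toReal = r * h x := by
  set m := volume.withDensity fun x => ENNReal.ofReal (h x) with hmdef
  have hv : μ ≪ volume := h1.trans (withDensity_absolutelyContinuous _ _)
  have : SigmaFinite m := SigmaFinite.withDensity_ofReal h
  have e1 := Measure.rnDeriv_mul_rnDeriv (κ := volume) h1
  have e2 : m.rnDeriv volume =ᵐ[volume] _ := Measure.rnDeriv_withDensity volume hm.ennreal_ofReal
  filter_upwards [hv.ae_le e1, hv.ae_le e2, Measure.rnDeriv_pos h1,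
    h1.ae_le (Measure.rnDeriv_lt_top μ m), Measure.rnDeriv_pos hv] with x h1 h2 h3 h4 h5
  rw [Pi.mul_apply, h2] at h1
  have hpos : 0 < h x := by
    by_contra! hx
    rw [← h1, ENNReal.ofReal_of_nonpos hx, mul_zero] at h5
    exact lt_irrefl _ h5
  refine ⟨(μ.rnDeriv m x).toReal, ENNReal.toReal_pos h3.ne' h4.ne, hpos,
    (ENNReal.ofReal_toReal h4.ne).symm, ?_⟩
  rw [← h1, ENNReal.toReal_mul, ENNReal.toReal_ofReal hpos.le]

/-- The Jacobian equation for densities relative to h dx. Its left side is positive, which forces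
the derivative of S to be positive. -/
theorem ae_density_transport {h : ℝ → ℝ} (hm : Measurable h) {μ : Measure ℝ}
    [IsProbabilityMeasure μ] {S : ℝ → ℝ} (hS : Monotone S)
    (h1 : μ ≪ volume.withDensity fun x => ENNReal.ofReal (h x))
    (h2 : μ.map S ≪ volume.withDensity fun x => ENNReal.ofReal (h x)) :
    ∀ᵐ x ∂μ, DifferentiableAt ℝ S x ∧ 0 < h x ∧ 0 < h (S x) ∧ 0 < deriv S x ∧
      ∃ r s, 0 < r ∧ 0 < s ∧
      μ.rnDeriv (volume.withDensity fun x => ENNReal.ofReal (h x)) x = ENNReal.ofReal r ∧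
      (μ.map S).rnDeriv (volume.withDensity fun x => ENNReal.ofReal (h x)) (S x) =
        ENNReal.ofReal s ∧
      r * h x = s * h (S x) * deriv S x := by
  have hSm := hS.measurable
  have : IsProbabilityMeasure (μ.map S) := Measure.isProbabilityMeasure_map hSm.aemeasurable
  have hv := withDensity_absolutelyContinuous volume fun x => ENNReal.ofReal (h x)
  filter_upwards [ae_rnDeriv_map_monotone hS (h1.trans hv) (h2.trans hv),
    ae_rnDeriv_withDensity hm h1, ae_of_ae_map hSm.aemeasurable (ae_rnDeriv_withDensity hm h2)]
    with x ⟨hd, e⟩ ⟨r, r0, hx, e1, e2⟩ ⟨s, s0, hy, e3, e4⟩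
  rw [e2, e4] at e
  refine ⟨hd, hx, hy, ?_, r, s, r0, s0, e1, e3, e⟩
  have : 0 < s * h (S x) * deriv S x := e ▸ mul_pos r0 hx
  exact pos_of_mul_pos_right this (by positivity)

/-- Lebesgue measure is the one-dimensional Hausdorff measure, for which antilipschitz maps control
preimages. -/
lemma volume_preimage_le {S : ℝ → ℝ} {c : ℝ} (hc : 0 < c)
    (hS : ∀ x y, c * |x - y| ≤ |S x - S y|) (A : Set ℝ) :
    volume (S ⁻¹' A) ≤ ENNReal.ofReal c⁻¹ * volume A := by
  have h : AntilipschitzWith (Real.toNNReal c⁻¹) S := by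
    refine AntilipschitzWith.of_le_mul_dist fun x y => ?_
    rw [Real.coe_toNNReal _ (by positivity), Real.dist_eq, Real.dist_eq,
      le_inv_mul_iff₀ hc]
    exact hS x y
  have := h.hausdorffMeasure_preimage_le zero_le_one A
  rwa [hausdorffMeasure_real, ENNReal.rpow_one] at this

lemma volume_preimage_eq_zero {S : ℝ → ℝ} {c : ℝ} (hc : 0 < c)
    (hS : ∀ x y, c * |x - y| ≤ |S x - S y|) {A : Set ℝ} (hA : volume A = 0) :
    volume (S ⁻¹' A) = 0 := by
  have := volume_preimage_le hc hS A
  rw [hA, mul_zero] at this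
  exact le_antisymm this zero_le

lemma volume_restrict_ac_withDensity {h : ℝ → ℝ} (hm : Measurable h) {s : Set ℝ}
    (hs : MeasurableSet s) (hpos : ∀ᵐ x, x ∈ s → 0 < h x) :
    volume.restrict s ≪ volume.withDensity fun x => ENNReal.ofReal (h x) := by
  have h : volume.restrict s ≪ (volume.restrict s).withDensity
      fun x => ENNReal.ofReal (h x) := by
    refine withDensity_absolutelyContinuous' hm.ennreal_ofReal.aemeasurable ?_
    filter_upwards [(ae_restrict_iff' hs).2 hpos] with x hx
    exact (ENNReal.ofReal_pos.2 hx).ne'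
  rw [← restrict_withDensity hs] at h
  exact h.trans (Measure.restrict_le_self.absolutelyContinuous)

lemma map_ac_of_expanding {m μ : Measure ℝ} {s : Set ℝ} (hsm : volume.restrict s ≪ m) (hμ : μ ≪ volume) {S : ℝ → ℝ} (hSm : Measurable S) {c : ℝ}
    (hc : 0 < c) (hS : ∀ x y, c * |x - y| ≤ |S x - S y|) (hI : ∀ᵐ x ∂μ, S x ∈ s) :
    μ.map S ≪ m := by
  refine Measure.AbsolutelyContinuous.mk fun A hA hA0 => ?_
  rw [Measure.map_apply hSm hA]
  have h1 := hsm hA0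
  rw [Measure.restrict_apply hA] at h1
  refine measure_mono_null ?_
    (measure_union_null (hμ (volume_preimage_eq_zero hc hS h1)) (mem_ae_iff.1 hI))
  intro x hx
  by_cases hxI : S x ∈ s
  · exact Or.inl ⟨hx, hxI⟩
  · exact Or.inr hxI

/-! ### Distortion coefficients as real numbers -/

/-- The coefficient `σ` in terms of `κ = K / (N - 1)`, as a real number. -/
noncomputable def sig (κ t θ : ℝ) : ℝ := if θ = 0 then t else sFun κ (t * θ) / sFun κ θ

lemma kappa_cond {K N θ : ℝ} (hN : 1 < N) :
    K / (N - 1) * θ ^ 2 < Real.pi ^ 2 ↔ K * θ ^ 2 < Real.pi ^ 2 * (N - 1) := by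
  have : 0 < N - 1 := by linarith
  rw [div_mul_eq_mul_div, div_lt_iff₀ this]

lemma sigmaCoef_eq {K N t θ : ℝ} (hN : 1 < N) (h : K / (N - 1) * θ ^ 2 < Real.pi ^ 2) :
    sigmaCoef K N t θ = ENNReal.ofReal (sig (K / (N - 1)) t θ) := by
  rw [kappa_cond hN] at h
  rw [sigmaCoef, if_neg (not_le.2 h), sig]
  split_ifs <;> rfl

lemma sig_nonneg {κ t θ : ℝ} (ht : 0 ≤ t) (ht1 : t ≤ 1) (hθ : 0 ≤ θ)
    (h : κ * θ ^ 2 < Real.pi ^ 2) : 0 ≤ sig κ t θ := by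
  unfold sig
  split_ifs with h0
  · exact ht
  · have hθ' : 0 < θ := lt_of_le_of_ne hθ (Ne.symm h0)
    refine div_nonneg ?_ (sFun_pos hθ' h).le
    rcases ht.eq_or_lt with rfl | ht
    · simp [sFun_zero]
    · refine (sFun_pos (by positivity) ?_).le
      rcases ht1.eq_or_lt with rfl | ht1
      · simpa using h
      · exact kappa_mul_sq_lt h.le (by positivity) (by nlinarith)

lemma tauCoef_eq {K N t θ : ℝ} (hN : 1 < N) (ht : 0 ≤ t) (ht1 : t ≤ 1) (hθ : 0 ≤ θ)
    (h : K / (N - 1) * θ ^ 2 < Real.pi ^ 2) :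
    tauCoef K N t θ = ENNReal.ofReal (t ^ (1 / N) * sig (K / (N - 1)) t θ ^ (1 - 1 / N)) := by
  have h1 : 1 / N ≤ 1 := by rw [div_le_one (by linarith)]; exact hN.le
  have h2 : 0 ≤ 1 / N := by positivity
  rw [tauCoef, sigmaCoef_eq hN h, ENNReal.ofReal_rpow_of_nonneg ht h2,
    ENNReal.ofReal_rpow_of_nonneg (sig_nonneg ht ht1 hθ h) (by linarith),
    ENNReal.ofReal_mul (by positivity)]

lemma measurable_tauCoef (K N t : ℝ) : Measurable (tauCoef K N t) := by
  unfold tauCoef sigmaCoef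
  have := (continuous_sFun (K / (N - 1))).measurable
  refine Measurable.const_mul (Measurable.pow_const ?_ _) _
  refine Measurable.ite (measurableSet_le (by fun_prop) (by fun_prop)) measurable_const ?_
  refine Measurable.ite (measurableSet_eq) measurable_const ?_
  fun_prop

lemma SolConcave.sig_le {κ a b : ℝ} {u : ℝ → ℝ} (hu : SolConcave κ a b u) {x y t : ℝ}
    (hx : x ∈ Icc a b) (hy : y ∈ Icc a b) (ht : 0 < t) (ht1 : t < 1)
    (h : κ * |x - y| ^ 2 < Real.pi ^ 2) :
    sig κ (1 - t) |x - y| * u x + sig κ t |x - y| * u y ≤ u ((1 - t) * x + t * y) := by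
  rcases lt_trichotomy x y with hxy | rfl | hxy
  · have e : |x - y| = y - x := by rw [abs_sub_comm, abs_of_pos (by linarith)]
    rw [e] at h ⊢
    have hp := sFun_pos (sub_pos.2 hxy) h
    have := hu.concave x hx y hy ((1 - t) * x + t * y) (by nlinarith) (by nlinarith) h
    rw [show y - ((1 - t) * x + t * y) = (1 - t) * (y - x) by ring,
      show (1 - t) * x + t * y - x = t * (y - x) by ring] at this
    rw [sig, sig, if_neg (by linarith), if_neg (by linarith), div_mul_eq_mul_div,
      div_mul_eq_mul_div, ← add_div, div_le_iff₀' hp]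
    exact this
  · simp only [sub_self, abs_zero, sig, if_true]
    rw [← add_mul, ← add_mul]; simp
  · have e : |x - y| = x - y := abs_of_pos (by linarith)
    rw [e] at h ⊢
    have hp := sFun_pos (sub_pos.2 hxy) h
    have := hu.concave y hy x hx ((1 - t) * x + t * y) (by nlinarith) (by nlinarith) h
    rw [show x - ((1 - t) * x + t * y) = t * (x - y) by ring,
      show (1 - t) * x + t * y - y = (1 - t) * (x - y) by ring] at this
    rw [sig, sig, if_neg (by linarith), if_neg (by linarith), div_mul_eq_mul_div,
      div_mul_eq_mul_div, ← add_div, div_le_iff₀' hp]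
    linarith

/-- Hölder's inequality for two terms: divide by the sums and apply the weighted
arithmetic-geometric inequality to each term. -/
lemma rpow_mul_add_rpow_mul_le {w p P q R : ℝ} (hw0 : 0 < w) (hw1 : w < 1) (hp : 0 ≤ p)
    (hP : 0 ≤ P) (hq : 0 ≤ q) (hR : 0 ≤ R) :
    p ^ w * q ^ (1 - w) + P ^ w * R ^ (1 - w) ≤ (p + P) ^ w * (q + R) ^ (1 - w) := by
  have hw1' : 0 < 1 - w := by linarith
  rcases (add_nonneg hp hP).eq_or_lt with h | h
  · have h1 : p = 0 := by linarith
    have h2 : P = 0 := by linarith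
    simp [h1, h2, Real.zero_rpow hw0.ne']
  rcases (add_nonneg hq hR).eq_or_lt with h' | h'
  · have h1 : q = 0 := by linarith
    have h2 : R = 0 := by linarith
    simp [h1, h2, Real.zero_rpow hw1'.ne']
  have key : ∀ c d : ℝ, 0 ≤ c → 0 ≤ d → c ^ w * d ^ (1 - w) ≤
      (w * (c / (p + P)) + (1 - w) * (d / (q + R))) * ((p + P) ^ w * (q + R) ^ (1 - w)) := by
    intro c d hc hd
    have := Real.geom_mean_le_arith_mean2_weighted hw0.le hw1'.le (div_nonneg hc h.le)
      (div_nonneg hd h'.le) (by ring)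
    rw [Real.div_rpow hc h.le, Real.div_rpow hd h'.le, div_mul_div_comm,
      div_le_iff₀ (by positivity)] at this
    exact this
  have e : w * (p / (p + P)) + (1 - w) * (q / (q + R)) +
      (w * (P / (p + P)) + (1 - w) * (R / (q + R))) = 1 := by
    field_simp; ring
  calc _ ≤ _ := add_le_add (key p q hp hq) (key P R hP hR)
    _ = _ := by rw [← add_mul, e, one_mul]

/-- In the Jacobian equation f is the conserved quantity, e the derivative of the transport map and
u^(N-1) the reference density. All transported densities then share the factor f^(-1/N). -/
lemma rpow_neg_of_mul_eq {N r f u e : ℝ} (hN : 1 < N) (hr : 0 < r) (hu : 0 < u) (he : 0 < e)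
    (hf : f = r * u ^ (N - 1) * e) :
    r ^ (-(1 / N)) = f ^ (-(1 / N)) * (e ^ (1 / N) * u ^ (1 - 1 / N)) := by
  have hN0 : N ≠ 0 := by linarith
  rw [hf, Real.mul_rpow (by positivity) he.le, Real.mul_rpow hr.le (by positivity),
    ← Real.rpow_mul hu.le, Real.rpow_neg he.le, show (N - 1) * -(1 / N) = -(1 - 1 / N) by
      field_simp, Real.rpow_neg hu.le]
  have h1 : 0 < e ^ (1 / N) := Real.rpow_pos_of_pos he _
  have h2 : 0 < u ^ (1 - 1 / N) := Real.rpow_pos_of_pos hu _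
  field_simp

/-! ### Spaces with a concave density -/

/-- The function equal to `u ^ (N - 1)` on `[a, b]` and to `0` outside. -/
noncomputable def icDens (N a b : ℝ) (u : ℝ → ℝ) (x : ℝ) : ℝ :=
  (Icc a b).indicator (fun x => u x ^ (N - 1)) x

/-- The measure with density `u ^ (N - 1)` on `[a, b]`. -/
noncomputable def icMeasure (N a b : ℝ) (u : ℝ → ℝ) : Measure ℝ :=
  volume.withDensity fun x => ENNReal.ofReal (icDens N a b u x)

namespace SolConcave

variable {κ K N a b : ℝ} {u : ℝ → ℝ}

lemma measurable_icDens (hu : SolConcave κ a b u) : Measurable (icDens N a b u) :=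
  (hu.measurable.pow_const _).indicator measurableSet_Icc

lemma icDens_pos (hu : SolConcave κ a b u) {x : ℝ} (hx : x ∈ Ioo a b) : 0 < icDens N a b u x := by
  rw [icDens, indicator_of_mem (Ioo_subset_Icc_self hx)]
  exact Real.rpow_pos_of_pos (hu.pos x hx) _

lemma icDens_nonneg (hu : SolConcave κ a b u) (x : ℝ) : 0 ≤ icDens N a b u x :=
  indicator_nonneg (fun x _ => Real.rpow_nonneg (hu.nonneg x) _) x

lemma hasLocDensity (hN : 1 < N) (hu : SolConcave κ a b u) : HasLocDensity (icMeasure N a b u) := by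
  refine ⟨icDens N a b u, hu.icDens_nonneg, ?_, rfl⟩
  refine Integrable.locallyIntegrable ?_
  obtain ⟨M, hM⟩ := hu.bdd
  refine (integrable_indicator_iff measurableSet_Icc).2 ?_
  refine Measure.integrableOn_of_bounded (M := M ^ (N - 1)) (by simp)
    (hu.measurable.pow_const _).aestronglyMeasurable ?_
  filter_upwards [ae_restrict_mem measurableSet_Icc] with x hx
  rw [Real.norm_of_nonneg (Real.rpow_nonneg (hu.nonneg x) _)]
  exact Real.rpow_le_rpow (hu.nonneg x) (hM x hx) (by linarith)

lemma icMeasure_ac : icMeasure N a b u ≪ volume := withDensity_absolutelyContinuous _ _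

lemma icMeasure_compl_Icc : icMeasure N a b u (Icc a b)ᶜ = 0 := by
  rw [icMeasure, withDensity_apply _ measurableSet_Icc.compl]
  refine setLIntegral_eq_zero measurableSet_Icc.compl fun x hx => ?_
  simp [icDens, indicator_of_notMem hx]

lemma ae_mem_Ioo : ∀ᵐ x ∂icMeasure N a b u, x ∈ Ioo a b := by
  have h1 : ∀ᵐ x ∂icMeasure N a b u, x ∈ Icc a b := mem_ae_iff.2 icMeasure_compl_Icc
  have h2 : ∀ᵐ x ∂icMeasure N a b u, x ≠ a := icMeasure_ac.ae_le (compl_mem_ae_iff.2 (measure_singleton a))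
  have h3 : ∀ᵐ x ∂icMeasure N a b u, x ≠ b := icMeasure_ac.ae_le (compl_mem_ae_iff.2 (measure_singleton b))
  filter_upwards [h1, h2, h3] with x e1 e2 e3
  exact ⟨lt_of_le_of_ne e1.1 (Ne.symm e2), lt_of_le_of_ne e1.2 e3⟩

lemma volume_restrict_ac (hu : SolConcave κ a b u) :
    volume.restrict (Ioo a b) ≪ icMeasure N a b u :=
  volume_restrict_ac_withDensity hu.measurable_icDens measurableSet_Ioo
    (Eventually.of_forall fun _ hx => hu.icDens_pos hx)

lemma support_icMeasure (hu : SolConcave κ a b u) : (icMeasure N a b u).support = Icc a b := by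
  refine subset_antisymm (Measure.support_subset_of_isClosed isClosed_Icc
    (mem_ae_iff.2 icMeasure_compl_Icc)) ?_
  rw [← closure_Ioo hu.lt.ne]
  refine closure_minimal (fun x hx => ?_) Measure.isClosed_support
  rw [Measure.mem_support_iff_forall]
  intro U hU
  obtain ⟨V, hVU, hV, hxV⟩ := mem_nhds_iff.1 hU
  refine lt_of_lt_of_le ?_ (measure_mono hVU)
  rw [pos_iff_ne_zero]
  intro h0
  have := hu.volume_restrict_ac (N := N) h0
  rw [Measure.restrict_apply hV.measurableSet] at this
  exact ((hV.inter isOpen_Ioo).measure_pos volume ⟨x, hxV, hx⟩).ne' this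

/-- The interpolating maps of a monotone transport into `[a, b]` preserve absolute continuity. -/
lemma map_interp_ac (hu : SolConcave κ a b u) {μ : Measure ℝ} (hμ : μ ≪ icMeasure N a b u)
    {T : ℝ → ℝ} (hT : Monotone T) (hTI : ∀ x, T x ∈ Icc a b) {t : ℝ} (ht : 0 ≤ t) (ht1 : t < 1) :
    μ.map (fun x => (1 - t) * x + t * T x) ≪ icMeasure N a b u := by
  have hTm := hT.measurable
  have hexp : ∀ x y, (1 - t) * |x - y| ≤
      |((1 - t) * x + t * T x) - ((1 - t) * y + t * T y)| := by
    have key : ∀ x y, y ≤ x → (1 - t) * |x - y| ≤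
      |((1 - t) * x + t * T x) - ((1 - t) * y + t * T y)| := by
      intro x y h
      rw [abs_of_nonneg (by linarith : 0 ≤ x - y)]
      refine le_trans ?_ (le_abs_self _)
      have := mul_nonneg ht (sub_nonneg.2 (hT h))
      linarith
    intro x y
    rcases le_total y x with h | h
    · exact key x y h
    · rw [abs_sub_comm x y, abs_sub_comm (_ + _)]; exact key y x h
  refine map_ac_of_expanding (hu.volume_restrict_ac (N := N))
    (hμ.trans icMeasure_ac) (by fun_prop) (by linarith : 0 < 1 - t) hexp ?_
  filter_upwards [hμ.ae_le ae_mem_Ioo] with x hxI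
  constructor
  · have := (hTI x).1; have := hxI.1; nlinarith
  · have := (hTI x).2; have := hxI.2; nlinarith

lemma nullSingletonClass {μ : Measure ℝ} (hμ : μ ≪ volume) : NullSingletonClass μ :=
  ⟨fun x => hμ (by simp)⟩

lemma exists_map (hu : SolConcave κ a b u) {μ₀ μ₁ : Measure ℝ} [IsProbabilityMeasure μ₀]
    [IsProbabilityMeasure μ₁] (h0 : μ₀ ≪ icMeasure N a b u)
    (h1 : μ₁.support ⊆ (icMeasure N a b u).support) :
    (∀ᵐ x ∂μ₀, x ∈ Ioo a b) ∧
    ∃ T : ℝ → ℝ, Monotone T ∧ (∀ x, T x ∈ Icc a b) ∧ μ₀.map T = μ₁ := by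
  have := nullSingletonClass (h0.trans icMeasure_ac)
  refine ⟨h0.ae_le ae_mem_Ioo, exists_monotone_map_eq μ₀ μ₁ ?_⟩
  rw [hu.support_icMeasure] at h1
  exact mem_of_superset (mem_ae_iff.2 Measure.measure_compl_support) h1

lemma isMonge (hu : SolConcave κ a b u) : IsMonge (icMeasure N a b u) := by
  intro μ₀ μ₁ hp0 hp1 h0 h1
  have := hp0.1
  have := hp1.1
  obtain ⟨hI, T, hT, hTI, rfl⟩ := hu.exists_map h0 h1
  have hI' : ∀ᵐ x ∂μ₀, x ∈ Icc a b := hI.mono fun x hx => Ioo_subset_Icc_self hx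
  have hTI' : ∀ᵐ x ∂μ₀, T x ∈ Icc a b := Eventually.of_forall hTI
  refine ⟨⟨dynPlan μ₀ T, dynPlan_mem_optGeo hT hI' hTI', fun ν hν =>
    eq_dynPlan_of_mem_optGeo hT hI' hTI' hν⟩, fun ν hν => ?_⟩
  obtain rfl := eq_dynPlan_of_mem_optGeo hT hI' hTI' hν
  refine ⟨⟨_, (measurable_seg_graph hT.measurable).aemeasurable, rfl⟩, fun t ht => ?_⟩
  rw [map_ev_dynPlan _ hT.measurable]
  exact hu.map_interp_ac h0 hT hTI t.2.1 ht

end SolConcave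

/-! ### Densities along monotone dynamical plans, and the curvature conditions for concave densities
-/

lemma invDens_dynPlan (m : Measure ℝ) (N : ℝ) (μ : Measure ℝ) {T : ℝ → ℝ} (hT : Measurable T)
    (t : I) (x : ℝ) : invDens m N (dynPlan μ T) t (seg (x, T x)) =
      (μ.map fun x => (1 - (t : ℝ)) * x + t * T x).rnDeriv m ((1 - (t : ℝ)) * x + t * T x) ^
        (-(1 / N)) := by
  rw [invDens, map_ev_dynPlan μ hT]; rfl

lemma invDens_dynPlan_zero (m : Measure ℝ) (N : ℝ) (μ : Measure ℝ) {T : ℝ → ℝ} (hT : Measurable T)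
    (x : ℝ) : invDens m N (dynPlan μ T) 0 (seg (x, T x)) = μ.rnDeriv m x ^ (-(1 / N)) := by
  rw [invDens_dynPlan m N μ hT]; simp

lemma invDens_dynPlan_one (m : Measure ℝ) (N : ℝ) (μ : Measure ℝ) {T : ℝ → ℝ} (hT : Measurable T)
    (x : ℝ) : invDens m N (dynPlan μ T) 1 (seg (x, T x)) =
      (μ.map T).rnDeriv m (T x) ^ (-(1 / N)) := by
  rw [invDens_dynPlan m N μ hT]; simp

lemma dist_ev_seg (x y : ℝ) : dist (ev 0 (seg (x, y))) (ev 1 (seg (x, y))) = |x - y| := by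
  simp [Real.dist_eq]

lemma measurable_invDens (m : Measure ℝ) (N : ℝ) (ν : Measure (Geo ℝ)) (t : I) :
    Measurable (invDens m N ν t) :=
  ((Measure.measurable_rnDeriv _ _).comp (measurable_ev t)).pow_const _

lemma measurable_tauCoef_dist (K N t : ℝ) :
    Measurable fun γ : Geo ℝ => tauCoef K N t (dist (ev 0 γ) (ev 1 γ)) :=
  (measurable_tauCoef K N t).comp ((measurable_ev 0).dist (measurable_ev 1))

lemma monotone_interp {T : ℝ → ℝ} (hT : Monotone T) {t : ℝ} (ht : 0 ≤ t) (ht1 : t ≤ 1) :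
    Monotone fun x => (1 - t) * x + t * T x := by
  intro x y h
  have h1 := hT h
  have h2 : 0 ≤ 1 - t := by linarith
  dsimp only
  gcongr

lemma deriv_interp {T : ℝ → ℝ} {x : ℝ} (h : DifferentiableAt ℝ T x) (t : ℝ) :
    deriv (fun x => (1 - t) * x + t * T x) x = (1 - t) + t * deriv T x := by
  have := ((hasDerivAt_id x).const_mul (1 - t)).add (h.hasDerivAt.const_mul t)
  rw [mul_one] at this
  exact this.deriv

lemma ofReal_rpow_mul {N a b : ℝ} (ha : 0 ≤ a) (hb : 0 < b) :
    ENNReal.ofReal a * ENNReal.ofReal b ^ (-(1 / N)) = ENNReal.ofReal (a * b ^ (-(1 / N))) := by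
  rw [ENNReal.ofReal_rpow_of_pos hb, ENNReal.ofReal_mul ha]

namespace SolConcave

variable {K N a b : ℝ} {u : ℝ → ℝ}

lemma icDens_of_mem {x : ℝ} (hx : x ∈ Icc a b) : icDens N a b u x = u x ^ (N - 1) := by
  rw [icDens, indicator_of_mem hx]

lemma mem_Icc_of_icDens_pos {x : ℝ} (hx : 0 < icDens N a b u x) : x ∈ Icc a b := by
  by_contra h
  rw [icDens, indicator_of_notMem h] at hx
  exact lt_irrefl _ hx

lemma pos_of_icDens_pos {κ : ℝ} (hN : 1 < N) (hu : SolConcave κ a b u) {x : ℝ}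
    (hx : 0 < icDens N a b u x) : 0 < u x := by
  rw [icDens_of_mem (mem_Icc_of_icDens_pos hx)] at hx
  rcases (hu.nonneg x).eq_or_lt with h | h
  · rw [← h, Real.zero_rpow (by linarith)] at hx
    exact absurd hx (lt_irrefl _)
  · exact h

lemma ae_interp (hN : 1 < N) (hu : SolConcave (K / (N - 1)) a b u) {μ : Measure ℝ}
    [IsProbabilityMeasure μ] (hμ : μ ≪ icMeasure N a b u) {T : ℝ → ℝ} (hT : Monotone T)
    (hTI : ∀ x, T x ∈ Icc a b) {t : ℝ} (ht : 0 < t) (ht1 : t < 1) :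
    ∀ᵐ x ∂μ, x ∈ Ioo a b ∧ K / (N - 1) * |x - T x| ^ 2 < Real.pi ^ 2 ∧ 0 < u x ∧
      0 < u ((1 - t) * x + t * T x) ∧ ∃ r s, 0 < r ∧ 0 < s ∧
      μ.rnDeriv (icMeasure N a b u) x = ENNReal.ofReal r ∧
      (μ.map fun x => (1 - t) * x + t * T x).rnDeriv (icMeasure N a b u) ((1 - t) * x + t * T x) =
        ENNReal.ofReal s ∧
      r * u x ^ (N - 1) =
        s * u ((1 - t) * x + t * T x) ^ (N - 1) * ((1 - t) + t * deriv T x) := by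
  filter_upwards [hμ.ae_le ae_mem_Ioo, (hμ.trans icMeasure_ac).ae_le hT.ae_differentiableAt,
    ae_density_transport hu.measurable_icDens (monotone_interp hT ht.le ht1.le) hμ
      (hu.map_interp_ac hμ hT hTI ht.le ht1)] with x hx hd
      ⟨_, h1, h2, _, r, s, hr, hs, e1, e2, e3⟩
  -- T x may be an endpoint but x is interior, so the distance is strictly below b - a. The
  -- coefficients therefore stay finite even when κ(b-a)² = π².
  have hxy : |x - T x| < b - a := by
    have := hTI x
    rw [abs_lt]; constructor <;> linarith [hx.1, hx.2, this.1, this.2]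
  refine ⟨hx, kappa_mul_sq_lt hu.length_le (abs_nonneg _) hxy, hu.pos_of_icDens_pos hN h1,
    hu.pos_of_icDens_pos hN h2, r, s, hr, hs, e1, e2, ?_⟩
  rw [deriv_interp hd, icDens_of_mem (mem_Icc_of_icDens_pos h1),
    icDens_of_mem (mem_Icc_of_icDens_pos h2)] at e3
  exact e3

/-- The target may be singular, so T' may vanish. Both nonnegative contributions of the target are
dropped, tT' from the Jacobian and the second term from the concavity of u. -/
theorem mcp (hN : 1 < N) (hu : SolConcave (K / (N - 1)) a b u) : MCP (icMeasure N a b u) K N := by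
  refine ⟨hu.isMonge, fun μ₀ μ₁ hp0 hp1 h0 h1 ν hν t ht0 ht1' => ?_⟩
  have := hp0.1
  have := hp1.1
  obtain ⟨hI, T, hT, hTI, rfl⟩ := hu.exists_map h0 h1
  have hI' : ∀ᵐ x ∂μ₀, x ∈ Icc a b := hI.mono fun x hx => Ioo_subset_Icc_self hx
  obtain rfl := eq_dynPlan_of_mem_optGeo hT hI' (Eventually.of_forall hTI) hν
  have ht : (0 : ℝ) < t := ht0
  have ht1 : (t : ℝ) < 1 := ht1'
  refine (ae_map_iff (measurable_seg_graph hT.measurable).aemeasurable (measurableSet_le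
    ((measurable_tauCoef_dist _ _ _).mul (measurable_invDens _ _ _ _))
    (measurable_invDens _ _ _ _))).2 ?_
  filter_upwards [hu.ae_interp hN h0 hT hTI ht ht1] with x ⟨hx, hκ, hux, huz, r, s, hr, hs, e1, e2, e3⟩
  simp only [Pi.mul_apply]
  rw [invDens_dynPlan_zero _ _ _ hT.measurable, invDens_dynPlan _ _ _ hT.measurable, dist_ev_seg,
    e1, e2, tauCoef_eq hN (by linarith) (by linarith) (abs_nonneg _) hκ,
    ENNReal.ofReal_rpow_of_pos hs]
  have hd := hT.deriv_nonneg (x := x)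
  have hs0 := sig_nonneg (t := 1 - t) (by linarith) (by linarith) (abs_nonneg _) hκ
  have hs1 := sig_nonneg (t := t) ht.le ht1.le (abs_nonneg _) hκ
  have h1t : 0 < 1 - (t : ℝ) := by linarith
  rw [ofReal_rpow_mul (by positivity) hr]
  refine ENNReal.ofReal_le_ofReal ?_
  have hle := hu.sig_le (Ioo_subset_Icc_self hx) (hTI x) ht ht1 hκ
  have hle' : sig (K / (N - 1)) (1 - t) |x - T x| * u x ≤ u ((1 - t) * x + t * T x) :=
    le_trans (le_add_of_nonneg_right (mul_nonneg hs1 (hu.nonneg _))) hle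
  have hw : 1 / N ≤ 1 := by rw [div_le_one (by linarith)]; exact hN.le
  rw [rpow_neg_of_mul_eq hN hr hux one_pos (mul_one _).symm,
    rpow_neg_of_mul_eq hN hs huz (by positivity) e3, Real.one_rpow, one_mul]
  calc _ = (r * u x ^ (N - 1)) ^ (-(1 / N)) * ((1 - (t : ℝ)) ^ (1 / N) *
        (sig (K / (N - 1)) (1 - t) |x - T x| * u x) ^ (1 - 1 / N)) := by
        rw [Real.mul_rpow hs0 hux.le]; ring
    _ ≤ _ := by
        have : 0 ≤ 1 - 1 / N := by linarith
        gcongr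
        exact le_add_of_nonneg_right (by positivity)

/-- After removal of the conserved factor, the τ coefficients split into a length part, with
Jacobian 1 - t + tT', and a part with exponent 1 - 1/N governed by u. Hölder recombines the two
parts and the concavity of u finishes. -/
theorem cd (hN : 1 < N) (hu : SolConcave (K / (N - 1)) a b u) : CD (icMeasure N a b u) K N := by
  refine ⟨hu.isMonge, fun μ₀ μ₁ hp0 hp1 h0 h1 ν hν t ht0 ht1' => ?_⟩
  have := hp0.1
  have := hp1.1
  obtain ⟨hI, T, hT, hTI, rfl⟩ := hu.exists_map h0 h1.support_mono
  have hI' : ∀ᵐ x ∂μ₀, x ∈ Icc a b := hI.mono fun x hx => Ioo_subset_Icc_self hx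
  obtain rfl := eq_dynPlan_of_mem_optGeo hT hI' (Eventually.of_forall hTI) hν
  have ht : (0 : ℝ) < t := ht0
  have ht1 : (t : ℝ) < 1 := ht1'
  refine (ae_map_iff (measurable_seg_graph hT.measurable).aemeasurable (measurableSet_le
    (((measurable_tauCoef_dist _ _ _).mul (measurable_invDens _ _ _ _)).add
      ((measurable_tauCoef_dist _ _ _).mul (measurable_invDens _ _ _ _)))
    (measurable_invDens _ _ _ _))).2 ?_
  filter_upwards [hu.ae_interp hN h0 hT hTI ht ht1,
    ae_density_transport hu.measurable_icDens hT h0 h1] with x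
    ⟨hx, hκ, hux, huz, r, s, hr, hs, e1, e2, e3⟩
    ⟨_, g1, g2, hd, r', s', hr', hs', f1, f2, f3⟩
  have hrr : r' = r := by
    have : ENNReal.ofReal r' = ENNReal.ofReal r := by rw [← e1, ← f1]; rfl
    exact (ENNReal.ofReal_eq_ofReal_iff hr'.le hr.le).1 this
  subst hrr
  have huy := hu.pos_of_icDens_pos hN g2
  rw [icDens_of_mem (mem_Icc_of_icDens_pos g1), icDens_of_mem (mem_Icc_of_icDens_pos g2)] at f3
  have f2' : (μ₀.map T).rnDeriv (icMeasure N a b u) (T x) = ENNReal.ofReal s' := f2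
  simp only [Pi.mul_apply, Pi.add_apply]
  rw [invDens_dynPlan_zero _ _ _ hT.measurable, invDens_dynPlan_one _ _ _ hT.measurable,
    invDens_dynPlan _ _ _ hT.measurable, dist_ev_seg, e1, e2, f2',
    tauCoef_eq hN (by linarith) (by linarith) (abs_nonneg _) hκ,
    tauCoef_eq hN ht.le ht1.le (abs_nonneg _) hκ, ENNReal.ofReal_rpow_of_pos hs]
  have hs0 := sig_nonneg (t := 1 - t) (by linarith) (by linarith) (abs_nonneg _) hκ
  have hs1 := sig_nonneg (t := t) ht.le ht1.le (abs_nonneg _) hκ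
  have h1t : 0 < 1 - (t : ℝ) := by linarith
  have hw : 1 / N < 1 := by rw [div_lt_one (by linarith)]; exact hN
  have hw0 : 0 < 1 / N := by positivity
  rw [ofReal_rpow_mul (by positivity) hr, ofReal_rpow_mul (by positivity) hs',
    ← ENNReal.ofReal_add (by positivity) (by positivity)]
  refine ENNReal.ofReal_le_ofReal ?_
  have hle := hu.sig_le (Ioo_subset_Icc_self hx) (hTI x) ht ht1 hκ
  rw [rpow_neg_of_mul_eq hN hr hux one_pos (mul_one _).symm,
    rpow_neg_of_mul_eq hN hs huz (by positivity) e3,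
    rpow_neg_of_mul_eq hN hs' huy hd f3, Real.one_rpow, one_mul]
  calc _ = (r' * u x ^ (N - 1)) ^ (-(1 / N)) * ((1 - (t : ℝ)) ^ (1 / N) *
        (sig (K / (N - 1)) (1 - t) |x - T x| * u x) ^ (1 - 1 / N) +
        (t * deriv T x) ^ (1 / N) *
        (sig (K / (N - 1)) t |x - T x| * u (T x)) ^ (1 - 1 / N)) := by
        rw [Real.mul_rpow hs0 hux.le, Real.mul_rpow hs1 huy.le, Real.mul_rpow ht.le hd.le]; ring
    _ ≤ (r' * u x ^ (N - 1)) ^ (-(1 / N)) * ((1 - t + t * deriv T x) ^ (1 / N) *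
        (sig (K / (N - 1)) (1 - t) |x - T x| * u x +
          sig (K / (N - 1)) t |x - T x| * u (T x)) ^ (1 - 1 / N)) := by
        gcongr
        exact rpow_mul_add_rpow_mul_le hw0 hw h1t.le (by positivity) (by positivity)
          (by positivity)
    _ ≤ _ := by
        have : 0 ≤ 1 - 1 / N := by linarith
        gcongr

end SolConcave

/-! ### Approximate continuity -/

/-- Approximate continuity of a function at a point. -/
def ApproxCont (h : ℝ → ℝ) (x : ℝ) : Prop :=
  ∀ δ > 0, ∀ η > 0, ∀ᶠ r in 𝓝[>] (0 : ℝ),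
    volume ({y | δ ≤ |h y - h x|} ∩ Metric.closedBall x r) ≤ ENNReal.ofReal (η * r)

/-- Lebesgue density, applied to the countably many preimages of rational intervals: almost every x
is a density point of each preimage containing it. -/
lemma ae_approxCont {h : ℝ → ℝ} (hm : Measurable h) : ∀ᵐ x, ApproxCont h x := by
  have key : ∀ q : ℚ × ℚ, ∀ᵐ x, x ∈ h ⁻¹' Ioo (q.1 : ℝ) q.2 → Tendsto (fun r =>
      volume (h ⁻¹' Ioo (q.1 : ℝ) q.2 ∩ Metric.closedBall x r) / volume (Metric.closedBall x r))
      (𝓝[>] 0) (𝓝 1) := fun q =>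
    (ae_restrict_iff' (hm measurableSet_Ioo)).1
      (Besicovitch.ae_tendsto_measure_inter_div volume (h ⁻¹' Ioo (q.1 : ℝ) q.2))
  filter_upwards [ae_all_iff.2 key] with x hx δ hδ η hη
  obtain ⟨q1, h1, h2⟩ := exists_rat_btwn (sub_lt_self (h x) hδ)
  obtain ⟨q2, h3, h4⟩ := exists_rat_btwn (lt_add_of_pos_right (h x) hδ)
  have ht := hx (q1, q2) ⟨h2, h3⟩
  set A := h ⁻¹' Ioo (q1 : ℝ) q2 with hA
  have hlt : ENNReal.ofReal (1 - η / 2) < 1 := by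
    rw [ENNReal.ofReal_lt_one]; linarith
  filter_upwards [ht.eventually (lt_mem_nhds hlt), self_mem_nhdsWithin] with r hr hr0
  have hr0 : 0 < r := hr0
  have hB : volume (Metric.closedBall x r) = ENNReal.ofReal (2 * r) := Real.volume_closedBall x r
  rw [hB] at hr
  have h5 : ENNReal.ofReal (1 - η / 2) * ENNReal.ofReal (2 * r) ≤
      volume (A ∩ Metric.closedBall x r) := by
    have := (ENNReal.lt_div_iff_mul_lt (Or.inl (by simpa using hr0)) (Or.inl ENNReal.ofReal_ne_top)).1 hr
    exact this.le
  have hsub : {y | δ ≤ |h y - h x|} ∩ Metric.closedBall x r ⊆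
      Metric.closedBall x r \ (A ∩ Metric.closedBall x r) := by
    rintro y ⟨hy, hyB⟩
    refine ⟨hyB, fun hyA => ?_⟩
    have := hyA.1
    have h6 : |h y - h x| < δ := by
      rw [abs_lt]; constructor <;> linarith [this.1, this.2]
    exact absurd hy (not_le.2 h6)
  calc _ ≤ _ := measure_mono hsub
    _ = ENNReal.ofReal (2 * r) - volume (A ∩ Metric.closedBall x r) := by
        rw [measure_sdiff inter_subset_right ((hm measurableSet_Ioo).inter
          Metric.isClosed_closedBall.measurableSet).nullMeasurableSet
          (measure_ne_top_of_subset inter_subset_right (by rw [hB]; exact ENNReal.ofReal_ne_top)), hB]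
    _ ≤ ENNReal.ofReal (2 * r) - ENNReal.ofReal (1 - η / 2) * ENNReal.ofReal (2 * r) := by
        gcongr
    _ ≤ ENNReal.ofReal (η * r) := by
        rw [tsub_le_iff_right]
        rcases le_total 0 (1 - η / 2) with h7 | h7
        · rw [← ENNReal.ofReal_mul h7, ← ENNReal.ofReal_add (by positivity) (by positivity)]
          refine ENNReal.ofReal_le_ofReal ?_
          linarith
        · refine le_trans (ENNReal.ofReal_le_ofReal ?_) le_self_add
          nlinarith

/-- Rescaling by c costs a factor 1/c that the radius c r compensates. The constant 1/2 is small
enough that three such bad sets do not fill an interval of length 2r. -/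
lemma volume_bad_le {h : ℝ → ℝ} {x₀ y₀ c δ : ℝ} (hc : 0 < c) (hy : ApproxCont h y₀) (hδ : 0 < δ) :
    ∀ᶠ r in 𝓝[>] (0 : ℝ), volume ({x | δ ≤ |h (y₀ + c * (x - x₀)) - h y₀|} ∩
      Metric.closedBall x₀ r) ≤ ENNReal.ofReal (1 / 2 * r) := by
  have h1 := hy δ hδ (1 / 2) (by norm_num)
  have h2 : Tendsto (fun r : ℝ => c * r) (𝓝[>] 0) (𝓝[>] 0) := by
    refine tendsto_nhdsWithin_iff.2 ⟨?_, ?_⟩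
    · have : Tendsto (fun r : ℝ => c * r) (𝓝 0) (𝓝 (c * 0)) := tendsto_id.const_mul c
      rw [mul_zero] at this
      exact this.mono_left nhdsWithin_le_nhds
    · filter_upwards [self_mem_nhdsWithin] with r hr
      exact mul_pos hc hr
  filter_upwards [h2.eventually h1, self_mem_nhdsWithin] with r hr hr0
  have hr0 : 0 < r := hr0
  have hS : ∀ x y, c * |x - y| ≤ |(y₀ + c * (x - x₀)) - (y₀ + c * (y - x₀))| := by
    intro x y
    rw [show (y₀ + c * (x - x₀)) - (y₀ + c * (y - x₀)) = c * (x - y) by ring, abs_mul,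
      abs_of_pos hc]
  have h3 := volume_preimage_le (S := fun x => y₀ + c * (x - x₀)) hc hS
    ({y | δ ≤ |h y - h y₀|} ∩ Metric.closedBall y₀ (c * r))
  refine le_trans (measure_mono ?_) (h3.trans ?_)
  · rintro x ⟨hx, hxB⟩
    refine ⟨hx, ?_⟩
    rw [Metric.mem_closedBall, Real.dist_eq] at hxB ⊢
    rw [add_sub_cancel_left, abs_mul, abs_of_pos hc]
    gcongr
  · calc _ ≤ ENNReal.ofReal c⁻¹ * ENNReal.ofReal (1 / 2 * (c * r)) := by gcongr
      _ = _ := by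
        rw [← ENNReal.ofReal_mul (by positivity)]
        congr 1; field_simp

/-- A property that holds almost everywhere near `x₀` holds at points close to `x₀` where the
values of `h` along three affine maps are close to those at three approximate continuity points. -/
lemma exists_near_approxCont {h : ℝ → ℝ} {x₀ x₁ z c d ε : ℝ} (hc : 0 < c) (hd : 0 < d)
    (h0 : ApproxCont h x₀) (h1 : ApproxCont h x₁) (hz : ApproxCont h z) {p : ℝ → Prop} (hε : 0 < ε)
    (hp : ∀ᵐ x ∂volume.restrict (Metric.closedBall x₀ ε), p x) {δ : ℝ} (hδ : 0 < δ) :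
    ∃ x, |x - x₀| < δ ∧ |h x - h x₀| < δ ∧ |h (x₁ + c * (x - x₀)) - h x₁| < δ ∧
      |h (z + d * (x - x₀)) - h z| < δ ∧ p x := by
  have e0 := volume_bad_le (x₀ := x₀) one_pos h0 hδ
  have e1 := volume_bad_le (x₀ := x₀) hc h1 hδ
  have e2 := volume_bad_le (x₀ := x₀) hd hz hδ
  obtain ⟨r, f0, f1, f2, hr0, hr1, hr2⟩ := (e0.and (e1.and (e2.and ((eventually_mem_nhdsWithin).and
    (((gt_mem_nhds hε).filter_mono nhdsWithin_le_nhds).and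
      ((gt_mem_nhds hδ).filter_mono nhdsWithin_le_nhds)))))).exists
  have hr0 : 0 < r := hr0
  have f3 : volume ({x | ¬ p x} ∩ Metric.closedBall x₀ r) = 0 := by
    rw [ae_restrict_iff' Metric.isClosed_closedBall.measurableSet] at hp
    refine measure_mono_null ?_ (ae_iff.1 hp)
    rintro x ⟨hx, hxB⟩ hcon
    exact hx (hcon (Metric.closedBall_subset_closedBall hr1.le hxB))
  by_contra! hcon
  set E0 := {x | δ ≤ |h (x₀ + 1 * (x - x₀)) - h x₀|} ∩ Metric.closedBall x₀ r
  set E1 := {x | δ ≤ |h (x₁ + c * (x - x₀)) - h x₁|} ∩ Metric.closedBall x₀ r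
  set E2 := {x | δ ≤ |h (z + d * (x - x₀)) - h z|} ∩ Metric.closedBall x₀ r
  set E3 := {x | ¬ p x} ∩ Metric.closedBall x₀ r
  have hcov : Metric.closedBall x₀ r ⊆ (E0 ∪ E1) ∪ (E2 ∪ E3) := by
    intro x hx
    have hx' : |x - x₀| < δ := by
      rw [Metric.mem_closedBall, Real.dist_eq] at hx
      exact lt_of_le_of_lt hx hr2
    by_cases g0 : δ ≤ |h x - h x₀|
    · exact Or.inl (Or.inl ⟨by simpa using g0, hx⟩)
    by_cases g1 : δ ≤ |h (x₁ + c * (x - x₀)) - h x₁|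
    · exact Or.inl (Or.inr ⟨g1, hx⟩)
    by_cases g2 : δ ≤ |h (z + d * (x - x₀)) - h z|
    · exact Or.inr (Or.inl ⟨g2, hx⟩)
    exact Or.inr (Or.inr ⟨hcon x hx' (not_le.1 g0) (not_le.1 g1) (not_le.1 g2), hx⟩)
  -- Three bad sets of measure at most r/2 and a null set would cover an interval of length 2r.
  have hle : ENNReal.ofReal (2 * r) ≤ ENNReal.ofReal (3 / 2 * r) := by
    calc ENNReal.ofReal (2 * r) = volume (Metric.closedBall x₀ r) :=
          (Real.volume_closedBall x₀ r).symm
      _ ≤ (volume E0 + volume E1) + (volume E2 + volume E3) :=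
          (measure_mono hcov).trans ((measure_union_le _ _).trans
            (add_le_add (measure_union_le _ _) (measure_union_le _ _)))
      _ ≤ (ENNReal.ofReal (1 / 2 * r) + ENNReal.ofReal (1 / 2 * r)) +
          (ENNReal.ofReal (1 / 2 * r) + 0) := by
          gcongr
          exact f3.le
      _ = ENNReal.ofReal (3 / 2 * r) := by
          rw [add_zero, ← ENNReal.ofReal_add (by positivity) (by positivity),
            ← ENNReal.ofReal_add (by positivity) (by positivity)]
          congr 1; ring
  rw [ENNReal.ofReal_le_ofReal_iff (by positivity)] at hle
  linarith

/-! ### Positivity of the density -/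

lemma HasLocDensity.exists_measurable {m : Measure ℝ} (hm : HasLocDensity m) :
    ∃ h : ℝ → ℝ, Measurable h ∧ (∀ x, 0 ≤ h x) ∧
      m = volume.withDensity (fun x => ENNReal.ofReal (h x)) ∧
      ∀ a b, m (Icc a b) < ⊤ := by
  obtain ⟨h, h0, hloc, rfl⟩ := hm
  have hae := hloc.aestronglyMeasurable
  refine ⟨fun x => max (hae.mk h x) 0, hae.stronglyMeasurable_mk.measurable.max measurable_const,
    fun x => le_max_right _ _, ?_, fun a b => ?_⟩
  · refine withDensity_congr_ae ?_
    filter_upwards [hae.ae_eq_mk] with x hx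
    rw [← hx, max_eq_left (h0 x)]
  · rw [withDensity_apply _ measurableSet_Icc]
    have := (hloc.integrableOn_isCompact (isCompact_Icc (a := a) (b := b))).2
    refine lt_of_le_of_lt (lintegral_mono fun x => ?_) this
    rw [← ofReal_norm, Real.norm_of_nonneg (h0 x)]

lemma isP2_of_ae_Icc {μ : Measure ℝ} [IsProbabilityMeasure μ] {a b : ℝ}
    (h : ∀ᵐ x ∂μ, x ∈ Icc a b) : IsP2 μ := by
  refine ⟨inferInstance, a, lt_of_le_of_lt (lintegral_mono_ae ?_) (excess_sq_lt_top h)⟩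
  filter_upwards [h] with x hx
  rw [edist_dist, Real.dist_eq, abs_of_nonneg (by linarith [hx.1])]

lemma isPc_of_ae_Icc {μ : Measure ℝ} [IsProbabilityMeasure μ] {a b : ℝ}
    (h : ∀ᵐ x ∂μ, x ∈ Icc a b) : IsPc μ :=
  ⟨inferInstance, (Metric.isBounded_Icc a b).subset
    (Measure.support_subset_of_isClosed isClosed_Icc h)⟩

/-- Mass near a is transported to a Dirac mass at b. All intermediate measures are absolutely
continuous and so do not charge the zeros of h, while the geodesics sweep out everything up to b. -/
lemma IsMonge.ae_pos {h : ℝ → ℝ} (hh : Measurable h)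
    (hfin : ∀ a b, volume.withDensity (fun x => ENNReal.ofReal (h x)) (Icc a b) < ⊤)
    (hM : IsMonge (volume.withDensity fun x => ENNReal.ofReal (h x))) {a b : ℝ}
    (ha : a ∈ (volume.withDensity fun x => ENNReal.ofReal (h x)).support)
    (hb : b ∈ (volume.withDensity fun x => ENNReal.ofReal (h x)).support) :
    ∀ᵐ x, x ∈ Ioo a b → 0 < h x := by
  set m := volume.withDensity fun x => ENNReal.ofReal (h x) with hmdef
  have hPm : MeasurableSet {x | 0 < h x} := measurableSet_lt measurable_const hh
  have hP : m {x | 0 < h x}ᶜ = 0 := by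
    rw [hmdef, withDensity_apply _ hPm.compl]
    refine setLIntegral_eq_zero hPm.compl fun x hx => ?_
    exact ENNReal.ofReal_of_nonpos (not_lt.1 hx)
  have main : ∀ c, a < c → c < b → ∀ᵐ x, x ∈ Ioo c b → 0 < h x := by
    intro c hac hcb
    set s := Icc (a - 1) c with hs
    have hms0 : m s ≠ 0 := by
      have := (Measure.mem_support_iff_forall a).1 ha s (Icc_mem_nhds (by linarith) hac)
      exact this.ne'
    set μ := ProbabilityTheory.cond m s with hμ
    have : IsProbabilityMeasure μ :=
      ProbabilityTheory.cond_isProbabilityMeasure_of_finite hms0 (hfin _ _).ne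
    have hμs : ∀ᵐ x ∂μ, x ∈ s := ProbabilityTheory.ae_cond_mem measurableSet_Icc
    have hT : Monotone fun _ : ℝ => b := monotone_const
    have h0 : ∀ᵐ x ∂μ, x ∈ Icc (a - 1) b := hμs.mono fun x hx => ⟨hx.1, hx.2.trans hcb.le⟩
    have h1 : ∀ᵐ x ∂μ, b ∈ Icc (a - 1) b :=
      Eventually.of_forall fun x => ⟨by linarith, le_rfl⟩
    have : IsProbabilityMeasure (μ.map fun _ => b) :=
      Measure.isProbabilityMeasure_map (by fun_prop)
    have h1' : ∀ᵐ x ∂(μ.map fun _ => b), x ∈ Icc b b :=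
      (ae_map_iff (by fun_prop) measurableSet_Icc).2 (by simp)
    have hac : ∀ t : I, t < 1 → μ.map (fun x => (1 - (t : ℝ)) * x + t * b) ≪ m := by
      intro t ht
      have := (hM μ (μ.map fun _ => b) (isP2_of_ae_Icc h0) (isP2_of_ae_Icc h1')
        ProbabilityTheory.cond_absolutelyContinuous ?_).2 _ (dynPlan_mem_optGeo hT h0 h1)
      · have := this.2 t ht
        rwa [map_ev_dynPlan _ measurable_const] at this
      · refine (Measure.support_subset_of_isClosed isClosed_Icc h1').trans ?_
        rw [Icc_self, singleton_subset_iff]; exact hb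
    -- Every slice of B at fixed t is null, hence so is almost every slice at fixed x. A single x ≤
    -- c is enough: its segment to b covers (c, b).
    let B : Set (ℝ × ℝ) := {p | p.2 ∈ Ico (0 : ℝ) 1 ∧ (1 - p.2) * p.1 + p.2 * b ∈ {x | 0 < h x}ᶜ}
    have hB : MeasurableSet B :=
      (measurable_snd measurableSet_Ico).inter
        ((by fun_prop : Measurable fun p : ℝ × ℝ => (1 - p.2) * p.1 + p.2 * b) hPm.compl)
    have hB0 : (μ.prod volume) B = 0 := by
      rw [Measure.prod_apply_symm hB, lintegral_eq_zero_iff' (by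
        exact (measurable_measure_prodMk_right hB).aemeasurable)]
      refine Eventually.of_forall fun t => ?_
      by_cases ht : t ∈ Ico (0 : ℝ) 1
      · have h2 := hac ⟨t, ht.1, ht.2.le⟩ ht.2 hP
        rw [Measure.map_apply (by fun_prop) hPm.compl] at h2
        exact measure_mono_null (fun x hx => hx.2) h2
      · have : (fun x => (x, t)) ⁻¹' B = ∅ := by
          ext x; simp only [B, mem_preimage, mem_ofPred_eq, ht, false_and, mem_empty_iff_false]
        simp [this]
    have hB1 := (Measure.measure_prod_null hB).1 hB0
    obtain ⟨x, hx, hxs⟩ := (hB1.and hμs).exists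
    have hx : volume (Prod.mk x ⁻¹' B) = 0 := hx
    have hxb : 0 < b - x := by linarith [hxs.2]
    have hS : ∀ y y', (b - x)⁻¹ * |y - y'| ≤ |(b - x)⁻¹ * (y - x) - (b - x)⁻¹ * (y' - x)| := by
      intro y y'
      rw [← mul_sub, abs_mul, abs_of_pos (inv_pos.2 hxb), sub_sub_sub_cancel_right]
    have h3 := volume_preimage_eq_zero (S := fun y => (b - x)⁻¹ * (y - x)) (inv_pos.2 hxb) hS hx
    rw [ae_iff]
    refine measure_mono_null ?_ h3
    intro y hy
    simp only [mem_ofPred_eq, Classical.not_imp] at hy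
    obtain ⟨⟨hy1, hy2⟩, hy3⟩ := hy
    refine ⟨⟨mul_nonneg (inv_pos.2 hxb).le (by linarith [hxs.2]), ?_⟩, ?_⟩
    · change (b - x)⁻¹ * (y - x) < 1
      rw [inv_mul_lt_iff₀ hxb]; linarith
    · change ¬ (0 < h _)
      have : (1 - (b - x)⁻¹ * (y - x)) * x + (b - x)⁻¹ * (y - x) * b = y := by
        field_simp; ring
      rwa [this]
  rcases le_or_gt b a with hab | hab
  · exact Eventually.of_forall fun x hx => absurd (hx.1.trans hx.2) (not_lt.2 hab)
  have key : ∀ q : ℚ, ∀ᵐ x, a < q → x ∈ Ioo (q : ℝ) b → 0 < h x := by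
    intro q
    by_cases hq : a < q
    · rcases lt_or_ge (q : ℝ) b with hqb | hqb
      · filter_upwards [main q hq hqb] with x hx _ using hx
      · exact Eventually.of_forall fun x _ hx => absurd (hx.1.trans hx.2) (not_lt.2 hqb)
    · exact Eventually.of_forall fun x h => absurd h hq
  filter_upwards [ae_all_iff.2 key] with x hx hxI
  obtain ⟨q, h1, h2⟩ := exists_rat_btwn hxI.1
  exact hx q h1 ⟨h2, hxI.2⟩

/-! ### From the quasi curvature-dimension condition to the density -/

lemma rpow_neg_inv_of_eq_mul {N r e f : ℝ} (hr : 0 < r) (he : 0 < e) (hf : f = r * e) :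
    r ^ (-(1 / N)) = f ^ (-(1 / N)) * e ^ (1 / N) := by
  rw [hf, Real.mul_rpow hr.le he.le, Real.rpow_neg he.le, mul_assoc, inv_mul_cancel₀, mul_one]
  exact (Real.rpow_pos_of_pos he _).ne'

/-- The test measure is uniform on a small ball around x₀ and is sent near x₁ by the affine map of
slope α. All Jacobians are then constants, and what remains of the condition involves h alone. -/
lemma QCD.ae_affine {Q K N a b : ℝ} {h : ℝ → ℝ} (hh : Measurable h)
    (hq : QCD (volume.withDensity fun x => ENNReal.ofReal (h x)) Q K N)
    (hpos : ∀ᵐ x, x ∈ Ioo a b → 0 < h x) {x₀ x₁ : ℝ} (hx₀ : x₀ ∈ Ioo a b) (hx₁ : x₁ ∈ Ioo a b)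
    {α t : ℝ} (hα : 0 < α) (ht : 0 < t) (ht1 : t < 1) :
    ∃ ε > 0, ∀ᵐ x ∂volume.restrict (Metric.closedBall x₀ ε),
      (ENNReal.ofReal Q ^ (1 / N))⁻¹ *
        (tauCoef K N (1 - t) |x - (x₁ + α * (x - x₀))| * ENNReal.ofReal (h x ^ (1 / N)) +
          tauCoef K N t |x - (x₁ + α * (x - x₀))| *
            ENNReal.ofReal ((α * h (x₁ + α * (x - x₀))) ^ (1 / N))) ≤
      ENNReal.ofReal
        (((1 - t + t * α) * h (((1 - t) * x₀ + t * x₁) + (1 - t + t * α) * (x - x₀))) ^ (1 / N)) := by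
  set m := volume.withDensity fun x => ENNReal.ofReal (h x) with hmdef
  obtain ⟨ε₀, hε₀, hB₀⟩ := Metric.isOpen_iff.1 isOpen_Ioo x₀ hx₀
  obtain ⟨ε₁, hε₁, hB₁⟩ := Metric.isOpen_iff.1 isOpen_Ioo x₁ hx₁
  obtain ⟨ε, hε, hε'⟩ := exists_between (lt_min hε₀ (div_pos hε₁ hα))
  have h1 := hε'.trans_le (min_le_left _ _)
  have h2 := hε'.trans_le (min_le_right _ _)
  rw [lt_div_iff₀ hα] at h2
  refine ⟨ε, hε, ?_⟩
  set s := Metric.closedBall x₀ ε with hs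
  have hms : MeasurableSet s := Metric.isClosed_closedBall.measurableSet
  have hvs : volume s = ENNReal.ofReal (2 * ε) := Real.volume_closedBall x₀ ε
  have hvs0 : volume s ≠ 0 := by rw [hvs]; simpa using hε
  have hvst : volume s ≠ ⊤ := by rw [hvs]; exact ENNReal.ofReal_ne_top
  set μ := ProbabilityTheory.cond volume s with hμ
  have : IsProbabilityMeasure μ :=
    ProbabilityTheory.cond_isProbabilityMeasure_of_finite hvs0 hvst
  have hμs : ∀ᵐ x ∂μ, x ∈ s := ProbabilityTheory.ae_cond_mem hms
  have hμv : μ ≪ volume := ProbabilityTheory.cond_absolutelyContinuous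
  suffices hsuff : ∀ᵐ x ∂μ, _ by
    rw [hμ, ProbabilityTheory.cond] at hsuff
    exact (Measure.ae_ennreal_smul_measure_iff (ENNReal.inv_ne_zero.2 hvst)).1 hsuff
  set T : ℝ → ℝ := fun x => x₁ + α * (x - x₀) with hT
  have hTm : Monotone T := by
    intro x y hxy
    simp only [hT]; gcongr
  have hTmeas := hTm.measurable
  have hsI : ∀ x ∈ s, x ∈ Ioo a b := fun x hx => hB₀ (lt_of_le_of_lt hx h1)
  have hTI : ∀ x ∈ s, T x ∈ Ioo a b := by
    intro x hx
    refine hB₁ ?_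
    rw [hs, Metric.mem_closedBall, Real.dist_eq] at hx
    rw [Metric.mem_ball, Real.dist_eq, hT, add_sub_cancel_left, abs_mul, abs_of_pos hα]
    nlinarith
  have hI : ∀ᵐ x ∂μ, x ∈ Ioo a b := hμs.mono hsI
  have hI' : ∀ᵐ x ∂μ, T x ∈ Ioo a b := hμs.mono hTI
  have hr := volume_restrict_ac_withDensity hh measurableSet_Ioo hpos
  have hμm : μ ≪ m := by
    have := map_ac_of_expanding hr hμv measurable_id one_pos
      (fun x y => by simp) hI
    rwa [Measure.map_id] at this
  have hμ₁m : μ.map T ≪ m := map_ac_of_expanding hr hμv hTmeas hα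
    (fun x y => by
      rw [hT, show x₁ + α * (x - x₀) - (x₁ + α * (y - x₀)) = α * (x - y) by ring, abs_mul,
        abs_of_pos hα]) hI'
  have hTt : ∀ x, (1 - t) * x + t * T x =
      ((1 - t) * x₀ + t * x₁) + (1 - t + t * α) * (x - x₀) := fun x => by simp only [hT]; ring
  have hβ : 0 < 1 - t + t * α := by have := mul_pos ht hα; linarith
  have hμtm : μ.map (fun x => (1 - t) * x + t * T x) ≪ m :=
    map_ac_of_expanding hr hμv (by fun_prop) hβ
    (fun x y => by
      rw [hTt, hTt, show ∀ c : ℝ, c + (1 - t + t * α) * (x - x₀) - (c + (1 - t + t * α) * (y - x₀))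
        = (1 - t + t * α) * (x - y) by intro c; ring, abs_mul, abs_of_pos hβ]) (by
      filter_upwards [hI, hI'] with x g1 g2
      constructor
      · nlinarith [g1.1, g2.1]
      · nlinarith [g1.2, g2.2])
  have hIc : ∀ᵐ x ∂μ, x ∈ Icc a b := hI.mono fun x hx => Ioo_subset_Icc_self hx
  have hIc' : ∀ᵐ x ∂μ, T x ∈ Icc a b := hI'.mono fun x hx => Ioo_subset_Icc_self hx
  have : IsProbabilityMeasure (μ.map T) := Measure.isProbabilityMeasure_map hTmeas.aemeasurable
  have hQ := hq.2 μ (μ.map T) (isPc_of_ae_Icc hIc)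
    (isPc_of_ae_Icc ((ae_map_iff hTmeas.aemeasurable measurableSet_Icc).2 hIc')) hμm hμ₁m
    _ (dynPlan_mem_optGeo hTm hIc hIc') ⟨t, ht.le, ht1.le⟩ ht ht1
  have hQ' := ae_of_ae_map (measurable_seg_graph hTmeas).aemeasurable hQ
  filter_upwards [hQ', ae_density_transport hh hTm hμm hμ₁m,
    ae_density_transport hh (monotone_interp hTm ht.le ht1.le) hμm hμtm] with x hx
    ⟨hd, f1, f2, hd', r, s₁, hr, hs₁, e1, e2, e3⟩ ⟨_, _, f4, _, r', sₜ, hr', hsₜ, e1', e4, e5⟩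
  have hrr : r' = r := by
    refine (ENNReal.ofReal_eq_ofReal_iff hr'.le hr.le).1 ?_
    rw [← e1, ← e1']
  subst hrr
  have hdT : deriv T x = α := by
    have : HasDerivAt T (α * 1) x := (((hasDerivAt_id x).sub_const x₀).const_mul α).const_add x₁
    rw [this.deriv, mul_one]
  rw [deriv_interp hd, hdT] at e5
  rw [hdT] at e3
  rw [invDens_dynPlan_zero _ _ _ hTmeas, invDens_dynPlan_one _ _ _ hTmeas,
    invDens_dynPlan _ _ _ hTmeas, dist_ev_seg] at hx
  simp only at hx
  -- All three densities are expressed through the conserved quantity r' * h x, whose power is then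
  -- cancelled.
  rw [e1, e2, e4, ENNReal.ofReal_rpow_of_pos hr, ENNReal.ofReal_rpow_of_pos hs₁,
    ENNReal.ofReal_rpow_of_pos hsₜ, rpow_neg_inv_of_eq_mul hr f1 rfl,
    rpow_neg_inv_of_eq_mul (f := r' * h x) hs₁ (mul_pos hα f2) (by rw [e3]; ring),
    rpow_neg_inv_of_eq_mul (f := r' * h x) hsₜ (mul_pos hβ f4) (by rw [e5]; ring)] at hx
  have hf : 0 < (r' * h x) ^ (-(1 / N)) := Real.rpow_pos_of_pos (mul_pos hr f1) _
  rw [ENNReal.ofReal_mul hf.le, ENNReal.ofReal_mul hf.le, ENNReal.ofReal_mul hf.le] at hx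
  rw [hTt] at hx
  refine (ENNReal.mul_le_mul_iff_right (a := ENNReal.ofReal ((r' * h x) ^ (-(1 / N))))
    (ENNReal.ofReal_pos.2 hf).ne' ENNReal.ofReal_ne_top).1 (le_trans (le_of_eq ?_) hx)
  ring

lemma continuousAt_sig {κ t θ : ℝ} (hθ : 0 < θ) (h : κ * θ ^ 2 < Real.pi ^ 2) :
    ContinuousAt (sig κ t) θ := by
  have h1 : sig κ t =ᶠ[𝓝 θ] fun θ => sFun κ (t * θ) / sFun κ θ := by
    filter_upwards [lt_mem_nhds hθ] with x hx
    rw [sig, if_neg hx.ne']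
  refine ContinuousAt.congr ?_ h1.symm
  have := continuous_sFun κ
  exact ContinuousAt.div (by fun_prop) (by fun_prop) (sFun_pos hθ h).ne'

lemma tauCoef_eq_top {K N t θ : ℝ} (hN : 1 < N) (ht : 0 < t)
    (h : Real.pi ^ 2 < K / (N - 1) * θ ^ 2) : tauCoef K N t θ = ⊤ := by
  have h0 : 0 < N - 1 := by linarith
  rw [div_mul_eq_mul_div, lt_div_iff₀ h0] at h
  have hw : 0 < 1 - 1 / N := by
    have : 1 / N < 1 := by rw [div_lt_one (by linarith)]; exact hN
    linarith
  rw [tauCoef, sigmaCoef, if_pos h.le, ENNReal.top_rpow_of_pos hw, ENNReal.mul_top]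
  exact (ENNReal.rpow_pos (ENNReal.ofReal_pos.2 ht) ENNReal.ofReal_ne_top).ne'

section

variable {Q K N a b : ℝ} {h : ℝ → ℝ}

lemma QCD.exists_seq (hh : Measurable h)
    (hq : QCD (volume.withDensity fun x => ENNReal.ofReal (h x)) Q K N)
    (hpos : ∀ᵐ x, x ∈ Ioo a b → 0 < h x) {x₀ x₁ : ℝ} (hx₀ : x₀ ∈ Ioo a b) (hx₁ : x₁ ∈ Ioo a b)
    {α t : ℝ} (hα : 0 < α) (ht : 0 < t) (ht1 : t < 1) (h0 : ApproxCont h x₀)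
    (h1 : ApproxCont h x₁) (hz : ApproxCont h ((1 - t) * x₀ + t * x₁)) :
    ∃ θ u v w : ℕ → ℝ, Tendsto θ atTop (𝓝 |x₀ - x₁|) ∧ Tendsto u atTop (𝓝 (h x₀)) ∧
      Tendsto v atTop (𝓝 (h x₁)) ∧ Tendsto w atTop (𝓝 (h ((1 - t) * x₀ + t * x₁))) ∧
      (∀ n, 0 ≤ θ n) ∧ ∀ n, (ENNReal.ofReal Q ^ (1 / N))⁻¹ *
        (tauCoef K N (1 - t) (θ n) * ENNReal.ofReal (u n ^ (1 / N)) +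
          tauCoef K N t (θ n) * ENNReal.ofReal ((α * v n) ^ (1 / N))) ≤
      ENNReal.ofReal (((1 - t + t * α) * w n) ^ (1 / N)) := by
  obtain ⟨ε, hε, hae⟩ := hq.ae_affine hh hpos hx₀ hx₁ hα ht ht1
  have hβ : 0 < 1 - t + t * α := by have := mul_pos ht hα; linarith
  have := fun n : ℕ => exists_near_approxCont hα hβ h0 h1 hz hε hae
    (Nat.one_div_pos_of_nat (α := ℝ) (n := n))
  choose x hx1 hx2 hx3 hx4 hx5 using this
  have key : ∀ (f : ℕ → ℝ) (l : ℝ), (∀ n : ℕ, |f n - l| < 1 / ((n : ℝ) + 1)) →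
      Tendsto f atTop (𝓝 l) := by
    intro f l hf
    rw [tendsto_iff_dist_tendsto_zero]
    exact squeeze_zero (fun n => dist_nonneg) (fun n => (hf n).le) tendsto_one_div_add_atTop_nhds_zero_nat
  have hx : Tendsto x atTop (𝓝 x₀) := key x x₀ hx1
  refine ⟨fun n => |x n - (x₁ + α * (x n - x₀))|, fun n => h (x n),
    fun n => h (x₁ + α * (x n - x₀)), _, ?_, key _ _ hx2, key _ _ hx3, key _ _ hx4,
    fun n => abs_nonneg _, hx5⟩
  have : Tendsto (fun n => |x n - (x₁ + α * (x n - x₀))|) atTop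
      (𝓝 |x₀ - (x₁ + α * (x₀ - x₀))|) :=
    (hx.sub (((hx.sub_const x₀).const_mul α).const_add x₁)).abs
  simpa using this

/-- A Bonnet-Myers bound: beyond this distance τ is infinite also at all nearby distances, while the
interpolated side stays finite. -/
lemma QCD.not_lt (hN : 1 < N) (hh : Measurable h)
    (hq : QCD (volume.withDensity fun x => ENNReal.ofReal (h x)) Q K N)
    (hpos : ∀ᵐ x, x ∈ Ioo a b → 0 < h x) {x₀ x₁ : ℝ} (hx₀ : x₀ ∈ Ioo a b) (hx₁ : x₁ ∈ Ioo a b)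
    {t : ℝ} (ht : 0 < t) (ht1 : t < 1) (h0 : ApproxCont h x₀)
    (h1 : ApproxCont h x₁) (hz : ApproxCont h ((1 - t) * x₀ + t * x₁)) (hp : 0 < h x₀) :
    K / (N - 1) * |x₀ - x₁| ^ 2 ≤ Real.pi ^ 2 := by
  by_contra! hcon
  obtain ⟨θ, u, v, w, hθ, hu, hv, hw, hθ0, H⟩ :=
    hq.exists_seq hh hpos hx₀ hx₁ one_pos ht ht1 h0 h1 hz
  have e1 := ((hθ.pow 2).const_mul (K / (N - 1))).eventually (lt_mem_nhds hcon)
  have e2 := hu.eventually (lt_mem_nhds hp)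
  obtain ⟨n, g1, g2⟩ := (e1.and e2).exists
  have := H n
  rw [tauCoef_eq_top hN (by linarith) g1, ENNReal.top_mul
    (ENNReal.ofReal_pos.2 (Real.rpow_pos_of_pos g2 _)).ne', top_add, ENNReal.mul_top, top_le_iff] at this
  · exact ENNReal.ofReal_ne_top this
  · refine ENNReal.inv_ne_zero.2 (ENNReal.rpow_ne_top_of_nonneg ?_ ENNReal.ofReal_ne_top)
    have : 0 < N := by linarith
    positivity

/-- Limit of the almost everywhere inequality along points approaching x₀. Distinct points at
distance strictly below the critical one make σ continuous there. -/
lemma QCD.le_of_slope (hN : 1 < N) (hQ : 1 ≤ Q) (hh : Measurable h)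
    (hq : QCD (volume.withDensity fun x => ENNReal.ofReal (h x)) Q K N)
    (hpos : ∀ᵐ x, x ∈ Ioo a b → 0 < h x) {x₀ x₁ : ℝ} (hx₀ : x₀ ∈ Ioo a b) (hx₁ : x₁ ∈ Ioo a b)
    {α t : ℝ} (hα : 0 < α) (ht : 0 < t) (ht1 : t < 1) (h0 : ApproxCont h x₀)
    (h1 : ApproxCont h x₁) (hz : ApproxCont h ((1 - t) * x₀ + t * x₁)) (hne : x₀ ≠ x₁)
    (hp0 : 0 < h x₀) (hp1 : 0 < h x₁) (hpz : 0 < h ((1 - t) * x₀ + t * x₁))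
    (hκ : K / (N - 1) * |x₀ - x₁| ^ 2 < Real.pi ^ 2) :
    (Q ^ (1 / N))⁻¹ *
      ((1 - t) ^ (1 / N) * sig (K / (N - 1)) (1 - t) |x₀ - x₁| ^ (1 - 1 / N) * h x₀ ^ (1 / N) +
        t ^ (1 / N) * sig (K / (N - 1)) t |x₀ - x₁| ^ (1 - 1 / N) * (α * h x₁) ^ (1 / N)) ≤
      ((1 - t + t * α) * h ((1 - t) * x₀ + t * x₁)) ^ (1 / N) := by
  obtain ⟨θ, u, v, w, hθ, hu, hv, hw, hθ0, H⟩ :=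
    hq.exists_seq hh hpos hx₀ hx₁ hα ht ht1 h0 h1 hz
  have hN0 : 0 < 1 / N := by have : 0 < N := by linarith
                             positivity
  have hw1 : 0 ≤ 1 - 1 / N := by
    have : 1 / N < 1 := by rw [div_lt_one (by linarith)]; exact hN
    linarith
  have hθpos : 0 < |x₀ - x₁| := abs_pos.2 (sub_ne_zero.2 hne)
  have s0 := (continuousAt_sig (t := 1 - t) hθpos hκ).tendsto.comp hθ
  have s1 := (continuousAt_sig (t := t) hθpos hκ).tendsto.comp hθ
  refine le_of_tendsto_of_tendsto ((((s0.rpow_const (Or.inr hw1)).const_mul _).mul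
    (hu.rpow_const (Or.inr hN0.le))).add (((s1.rpow_const (Or.inr hw1)).const_mul _).mul
    ((hv.const_mul α).rpow_const (Or.inr hN0.le))) |>.const_mul _)
    ((hw.const_mul _).rpow_const (Or.inr hN0.le)) ?_
  filter_upwards [((hθ.pow 2).const_mul (K / (N - 1))).eventually (gt_mem_nhds hκ),
    hu.eventually (lt_mem_nhds hp0), hv.eventually (lt_mem_nhds hp1),
    hw.eventually (lt_mem_nhds hpz)] with n g1 g2 g3 g4
  have hn := H n
  have hβ : 0 < 1 - t + t * α := by have := mul_pos ht hα; linarith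
  have hs0 := sig_nonneg (t := 1 - t) (by linarith) (by linarith) (hθ0 n) g1
  have hs1 := sig_nonneg (t := t) ht.le ht1.le (hθ0 n) g1
  have h1t : 0 < 1 - t := by linarith
  have hQ0 : 0 < Q := by linarith
  rw [tauCoef_eq hN (by linarith) (by linarith) (hθ0 n) g1, tauCoef_eq hN ht.le ht1.le (hθ0 n) g1,
    ← ENNReal.ofReal_mul (by positivity), ← ENNReal.ofReal_mul (by positivity),
    ← ENNReal.ofReal_add (by positivity) (by positivity), ENNReal.ofReal_rpow_of_pos hQ0,
    ← ENNReal.ofReal_inv_of_pos (by positivity), ← ENNReal.ofReal_mul (by positivity),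
    ENNReal.ofReal_le_ofReal_iff (by positivity)] at hn
  exact hn

/-- Optimizing the slope of the transport map. -/
lemma add_le_of_forall_slope (hN : 1 < N) (hQ : 1 ≤ Q) {t s₀ s₁ y₀ y₁ z : ℝ} (ht : 0 < t)
    (ht1 : t < 1) (hs₀ : 0 < s₀) (hs₁ : 0 < s₁) (hy₀ : 0 < y₀) (hy₁ : 0 < y₁) (hz : 0 < z)
    (H : ∀ α > 0, (Q ^ (1 / N))⁻¹ * ((1 - t) ^ (1 / N) * s₀ ^ (1 - 1 / N) * y₀ ^ (1 / N) +
        t ^ (1 / N) * s₁ ^ (1 - 1 / N) * (α * y₁) ^ (1 / N)) ≤ ((1 - t + t * α) * z) ^ (1 / N)) :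
    s₀ * y₀ ^ (1 / (N - 1)) + s₁ * y₁ ^ (1 / (N - 1)) ≤
      Q ^ (1 / (N - 1)) * z ^ (1 / (N - 1)) := by
  have hN0 : 0 < N := by linarith
  have hN1 : 0 < N - 1 := by linarith
  have hQ0 : 0 < Q := by linarith
  have h1t : 0 < 1 - t := by linarith
  have ew : 1 - 1 / N = (N - 1) / N := by field_simp
  set A := s₀ * y₀ ^ (1 / (N - 1)) with hA
  set B := s₁ * y₁ ^ (1 / (N - 1)) with hB
  have hA0 : 0 < A := by positivity
  have hB0 : 0 < B := by positivity
  have eA : s₀ ^ (1 - 1 / N) * y₀ ^ (1 / N) = A ^ (1 - 1 / N) := by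
    rw [hA, Real.mul_rpow hs₀.le (by positivity), ← Real.rpow_mul hy₀.le]
    congr 2; rw [ew]; field_simp
  have eB : s₁ ^ (1 - 1 / N) * y₁ ^ (1 / N) = B ^ (1 - 1 / N) := by
    rw [hB, Real.mul_rpow hs₁.le (by positivity), ← Real.rpow_mul hy₁.le]
    congr 2; rw [ew]; field_simp
  -- The equality case of Hölder: this slope makes (1-t) : tα equal to A : B. The inequality becomes
  -- A + B ≤ (Q(A + B)z)^(1/N).
  have h := H ((1 - t) * B / (t * A)) (by positivity)
  have e1 : (1 - t + t * ((1 - t) * B / (t * A))) * z = ((1 - t) / A) * ((A + B) * z) := by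
    field_simp
  have eAA : A ^ (1 - 1 / N) = A / A ^ (1 / N) := by rw [Real.rpow_sub hA0, Real.rpow_one]
  have eBB : B ^ (1 - 1 / N) = B / B ^ (1 / N) := by rw [Real.rpow_sub hB0, Real.rpow_one]
  have pA : 0 < A ^ (1 / N) := Real.rpow_pos_of_pos hA0 _
  have pB : 0 < B ^ (1 / N) := Real.rpow_pos_of_pos hB0 _
  have pt : 0 < t ^ (1 / N) := Real.rpow_pos_of_pos ht _
  have e2 : (1 - t) ^ (1 / N) * s₀ ^ (1 - 1 / N) * y₀ ^ (1 / N) +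
      t ^ (1 / N) * s₁ ^ (1 - 1 / N) * ((1 - t) * B / (t * A) * y₁) ^ (1 / N) =
      ((1 - t) / A) ^ (1 / N) * (A + B) := by
    rw [Real.mul_rpow (by positivity) hy₁.le, mul_assoc, eA,
      show t ^ (1 / N) * s₁ ^ (1 - 1 / N) * (((1 - t) * B / (t * A)) ^ (1 / N) * y₁ ^ (1 / N)) =
        t ^ (1 / N) * ((1 - t) * B / (t * A)) ^ (1 / N) *
          (s₁ ^ (1 - 1 / N) * y₁ ^ (1 / N)) by ring, eB,
      Real.div_rpow (by positivity) (by positivity), Real.mul_rpow h1t.le hB0.le,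
      Real.mul_rpow ht.le hA0.le, eAA, eBB, Real.div_rpow h1t.le hA0.le]
    field_simp
  have hD : 0 < ((1 - t) / A) ^ (1 / N) := by positivity
  rw [e1, e2, Real.mul_rpow (by positivity) (by positivity),
    show (Q ^ (1 / N))⁻¹ * (((1 - t) / A) ^ (1 / N) * (A + B)) =
      ((1 - t) / A) ^ (1 / N) * ((Q ^ (1 / N))⁻¹ * (A + B)) by ring] at h
  have h2 := le_of_mul_le_mul_left h hD
  rw [inv_mul_le_iff₀ (by positivity), ← Real.mul_rpow hQ0.le (by positivity)] at h2
  have h3 : (A + B) ^ N ≤ Q * ((A + B) * z) := by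
    have := Real.rpow_le_rpow (by positivity) h2 hN0.le
    rwa [← Real.rpow_mul (by positivity), one_div_mul_cancel hN0.ne', Real.rpow_one] at this
  have h4 : (A + B) ^ (N - 1) ≤ Q * z := by
    rw [Real.rpow_sub (by positivity), Real.rpow_one, div_le_iff₀ (by positivity)]
    linarith
  have h5 := Real.rpow_le_rpow (by positivity) h4 (by positivity : 0 ≤ 1 / (N - 1))
  rwa [← Real.rpow_mul (by positivity), mul_one_div_cancel hN1.ne', Real.rpow_one,
    Real.mul_rpow hQ0.le hz.le] at h5

/-- The density of a space satisfying `QCD(Q, K, N)` is comparable to a concave one. -/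
theorem QCD.exists_solConcave {m : Measure ℝ} (hN : 1 < N) (hQ : 1 ≤ Q) (hm : HasLocDensity m)
    (hq : QCD m Q K N) (ha : a ∈ m.support) (hb : b ∈ m.support) (hab : a < b) :
    ∃ u, SolConcave (K / (N - 1)) a b u ∧ m.restrict (Icc a b) ≤ icMeasure N a b u ∧
      icMeasure N a b u ≤ ENNReal.ofReal Q • m.restrict (Icc a b) := by
  obtain ⟨h, hh, h_nonneg, rfl, hfin⟩ := hm.exists_measurable
  have hpos := hq.1.ae_pos hh hfin ha hb
  have hN1 : 0 < N - 1 := by linarith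
  have hQ0 : 0 < Q := by linarith
  -- Good points: of full measure in (a, b), hence dense, so that the hull can be built from them.
  let G : Set ℝ := {x | x ∈ Ioo a b ∧ 0 < h x ∧ ApproxCont h x}
  have hGae : ∀ᵐ x, x ∈ Ioo a b → x ∈ G := by
    filter_upwards [hpos, ae_approxCont hh] with x h1 h2 h3
    exact ⟨h3, h1 h3, h2⟩
  have hGd : ∀ c d, a ≤ c → d ≤ b → c < d → ∃ x ∈ G, x ∈ Ioo c d := by
    intro c d hc hd hcd
    have h1 : volume (Ioo c d) ≠ 0 := by simpa using hcd
    by_contra! hcon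
    refine h1 (measure_mono_null (fun x hx => ?_) (ae_iff.1 hGae))
    exact fun himp => hcon x (himp ⟨hc.trans_lt hx.1, hx.2.trans_le hd⟩) hx
  have hd : Ioo a b ⊆ closure G := by
    intro x hx
    rw [Metric.mem_closure_iff]
    intro ε hε
    obtain ⟨y, hy, hy1, hy2⟩ := hGd x (min (x + ε) b) hx.1.le (min_le_right _ _)
      (lt_min (by linarith) hx.2)
    refine ⟨y, hy, ?_⟩
    rw [dist_comm, Real.dist_eq, abs_of_pos (by linarith)]
    linarith [hy2.trans_le (min_le_left _ _)]
  have hcomb : ∀ x y z : ℝ, x < z → z < y → ∃ t, 0 < t ∧ t < 1 ∧ (1 - t) * x + t * y = z ∧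
      y - z = (1 - t) * (y - x) ∧ z - x = t * (y - x) := by
    intro x y z hxz hzy
    have h0 : 0 < y - x := by linarith
    refine ⟨(z - x) / (y - x), div_pos (by linarith) h0, ?_, ?_, ?_, ?_⟩
    · rw [div_lt_one h0]; linarith
    · field_simp; ring
    · field_simp; ring
    · field_simp
  have hκle : ∀ x ∈ G, ∀ y ∈ G, x < y → K / (N - 1) * (y - x) ^ 2 ≤ Real.pi ^ 2 := by
    intro x hx y hy hxy
    obtain ⟨z, hz, hz1, hz2⟩ := hGd x y hx.1.1.le hy.1.2.le hxy
    obtain ⟨t, ht, ht1, e, -⟩ := hcomb x y z hz1 hz2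
    have := hq.not_lt hN hh hpos hx.1 hy.1 ht ht1 hx.2.2 hy.2.2 (by rw [e]; exact hz.2.2) hx.2.1
    rwa [abs_sub_comm, sq_abs] at this
  -- The bound holds between good points; choosing these close to a and b gives it for the whole
  -- interval.
  have hκ : K / (N - 1) * (b - a) ^ 2 ≤ Real.pi ^ 2 := by
    by_contra! hcon
    have hc : Continuous fun ε : ℝ => K / (N - 1) * ((b - ε) - (a + ε)) ^ 2 := by fun_prop
    have h0 : Real.pi ^ 2 < K / (N - 1) * ((b - 0) - (a + 0)) ^ 2 := by simpa using hcon
    have e1 := (hc.tendsto 0).eventually (lt_mem_nhds h0)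
    obtain ⟨ε, ⟨hε, hε2⟩, hε0⟩ := (((e1.and (gt_mem_nhds (show (0 : ℝ) < (b - a) / 2 by linarith))
      ).filter_mono nhdsWithin_le_nhds).and (eventually_mem_nhdsWithin (s := Ioi (0 : ℝ)))).exists
    have hε0 : 0 < ε := hε0
    obtain ⟨x, hx, hx1, hx2⟩ := hGd a (a + ε) le_rfl (by linarith) (by linarith)
    obtain ⟨y, hy, hy1, hy2⟩ := hGd (b - ε) b (by linarith) le_rfl (by linarith)
    have h1 := hκle x hx y hy (by linarith)
    have hK : 0 < K / (N - 1) := by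
      by_contra! hK
      have := mul_nonpos_of_nonpos_of_nonneg hK (sq_nonneg (b - a))
      have := pow_pos Real.pi_pos 2
      linarith
    have h2 : (b - ε - (a + ε)) ^ 2 ≤ (y - x) ^ 2 :=
      pow_le_pow_left₀ (by linarith) (by linarith) 2
    have := mul_le_mul_of_nonneg_left h2 hK.le
    linarith
  have hC : 1 ≤ Q ^ (1 / (N - 1)) := Real.one_le_rpow hQ (by positivity)
  obtain ⟨u, hu, huv⟩ := exists_solConcave_hull (v := fun x => h x ^ (1 / (N - 1))) hab
    (fun x hx => hx.1) hd hκ hC (fun x hx => Real.rpow_pos_of_pos hx.2.1 _) (by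
      intro x hx y hy z hz hxz hzy
      obtain ⟨t, ht, ht1, e, e1, e2⟩ := hcomb x y z hxz hzy
      have h0 : 0 < y - x := by linarith
      have hκ' : K / (N - 1) * (y - x) ^ 2 < Real.pi ^ 2 :=
        kappa_mul_sq_lt hκ h0.le (by linarith [hx.1.1, hy.1.2])
      have eabs : |x - y| = y - x := by rw [abs_sub_comm, abs_of_pos h0]
      have p0 := sFun_pos h0 hκ'
      have hsig : ∀ t, 0 < t → t < 1 → 0 < sFun (K / (N - 1)) (t * (y - x)) := fun t ht ht1 =>
        sFun_pos (by positivity) (kappa_mul_sq_lt hκ'.le (by positivity) (by nlinarith))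
      have esig : ∀ t, sig (K / (N - 1)) t (y - x) =
          sFun (K / (N - 1)) (t * (y - x)) / sFun (K / (N - 1)) (y - x) := fun t => by
        rw [sig, if_neg h0.ne']
      have := add_le_of_forall_slope hN hQ ht ht1
        (s₀ := sig (K / (N - 1)) (1 - t) (y - x)) (s₁ := sig (K / (N - 1)) t (y - x))
        (by rw [esig]; exact div_pos (hsig _ (by linarith) (by linarith)) p0)
        (by rw [esig]; exact div_pos (hsig _ ht ht1) p0) hx.2.1 hy.2.1 hz.2.1 (fun α hα => by
          have := hq.le_of_slope hN hQ hh hpos hx.1 hy.1 hα ht ht1 hx.2.2 hy.2.2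
            (by rw [e]; exact hz.2.2) (by linarith) hx.2.1 hy.2.1 (by rw [e]; exact hz.2.1)
            (by rw [eabs]; exact hκ')
          rwa [e, eabs] at this)
      rw [e1, e2]
      rw [esig, esig, div_mul_eq_mul_div, div_mul_eq_mul_div, ← add_div, div_le_iff₀' p0] at this
      exact this)
  have hcmp : ∀ᵐ x, x ∈ Icc a b → h x ≤ icDens N a b u x ∧ icDens N a b u x ≤ Q * h x := by
    have hne : ∀ c : ℝ, ∀ᵐ x : ℝ, x ≠ c := fun c => compl_mem_ae_iff.2 (measure_singleton c)
    filter_upwards [hGae, hne a, hne b] with x hx hxa hxb hxI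
    have hxG := hx ⟨lt_of_le_of_ne hxI.1 (Ne.symm hxa), lt_of_le_of_ne hxI.2 hxb⟩
    obtain ⟨h1, h2⟩ := huv x hxG
    rw [SolConcave.icDens_of_mem hxI]
    have e : (h x ^ (1 / (N - 1))) ^ (N - 1) = h x := by
      rw [← Real.rpow_mul (h_nonneg x), one_div_mul_cancel hN1.ne', Real.rpow_one]
    have e' : (Q ^ (1 / (N - 1))) ^ (N - 1) = Q := by
      rw [← Real.rpow_mul hQ0.le, one_div_mul_cancel hN1.ne', Real.rpow_one]
    have hr : 0 ≤ h x ^ (1 / (N - 1)) := Real.rpow_nonneg (h_nonneg x) _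
    constructor
    · have := Real.rpow_le_rpow hr h1 hN1.le
      rwa [e] at this
    · have := Real.rpow_le_rpow (hu.nonneg x) h2 hN1.le
      rwa [Real.mul_rpow (by positivity) hr, e, e'] at this
  refine ⟨u, hu, ?_, ?_⟩
  · rw [restrict_withDensity measurableSet_Icc, ← withDensity_indicator measurableSet_Icc]
    refine withDensity_mono ?_
    filter_upwards [hcmp] with x hx
    by_cases hxI : x ∈ Icc a b
    · rw [indicator_of_mem hxI]; exact ENNReal.ofReal_le_ofReal (hx hxI).1
    · rw [indicator_of_notMem hxI]; exact zero_le
  · rw [restrict_withDensity measurableSet_Icc, ← withDensity_indicator measurableSet_Icc,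
      ← withDensity_smul _ (hh.ennreal_ofReal.indicator measurableSet_Icc)]
    refine withDensity_mono ?_
    filter_upwards [hcmp] with x hx
    rw [Pi.smul_apply, smul_eq_mul]
    by_cases hxI : x ∈ Icc a b
    · rw [indicator_of_mem hxI, ← ENNReal.ofReal_mul hQ0.le]
      exact ENNReal.ofReal_le_ofReal (hx hxI).2
    · rw [icDens, indicator_of_notMem hxI]; simp

end

/-! ### The local Lipschitz constant of an affine image -/

lemma locallyLipschitz_affine {f : ℝ → ℝ} (hf : LocallyLipschitz f) (α β : ℝ) :
    LocallyLipschitz fun x => α * f x + β := by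
  have : LipschitzWith (Real.toNNReal |α|) fun y : ℝ => α * y + β := by
    refine LipschitzWith.of_dist_le_mul fun x y => ?_
    rw [Real.coe_toNNReal _ (abs_nonneg α), Real.dist_eq, Real.dist_eq, add_sub_add_right_eq_sub,
      ← mul_sub, abs_mul]
  exact this.locallyLipschitz.comp hf

lemma localLip_affine (f : ℝ → ℝ) (α β x : ℝ) :
    localLip (fun x => α * f x + β) x = ENNReal.ofReal |α| * localLip f x := by
  have : ∀ y, edist (α * f y + β) (α * f x + β) / edist y x =
      ENNReal.ofReal |α| * (edist (f y) (f x) / edist y x) := by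
    intro y
    rw [← mul_div_assoc]
    congr 1
    rw [edist_dist, edist_dist (f y), Real.dist_eq, Real.dist_eq, add_sub_add_right_eq_sub,
      ← mul_sub, abs_mul, ENNReal.ofReal_mul (abs_nonneg α)]
  rw [localLip, localLip]
  simp_rw [this]
  exact ENNReal.limsup_const_mul_of_ne_top ENNReal.ofReal_ne_top

/-! ### The signed power -/

/-- In this form continuity at 0 is visible also for p < 2, where the first factor alone is
singular. -/
lemma abs_rpow_sub_two_mul {p : ℝ} (hp : 1 < p) (y : ℝ) :
    |y| ^ (p - 2) * y = max y 0 ^ (p - 1) - max (-y) 0 ^ (p - 1) := by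
  have hp1 : p - 1 ≠ 0 := by linarith
  rcases lt_trichotomy y 0 with h | rfl | h
  · have h' : 0 < -y := by linarith
    rw [max_eq_right h.le, max_eq_left h'.le, abs_of_neg h, Real.zero_rpow hp1,
      show p - 1 = p - 2 + 1 by ring, Real.rpow_add_one h'.ne']
    ring
  · simp
  · rw [max_eq_left h.le, max_eq_right (by linarith), abs_of_pos h, Real.zero_rpow hp1,
      show p - 1 = p - 2 + 1 by ring, Real.rpow_add_one h.ne']
    ring

lemma continuous_abs_rpow_sub_two_mul {p : ℝ} (hp : 1 < p) :
    Continuous fun y : ℝ => |y| ^ (p - 2) * y := by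
  simp_rw [abs_rpow_sub_two_mul hp]
  have hp1 : 0 ≤ p - 1 := by linarith
  exact ((continuous_id.max continuous_const).rpow_const fun _ => Or.inr hp1).sub
    ((continuous_neg.max continuous_const).rpow_const fun _ => Or.inr hp1)

/-- The tangent line inequality for the convex function |·|^p at y, derived from Young's inequality.
-/
lemma abs_rpow_le_sub {p : ℝ} (hp : 1 < p) (y c : ℝ) :
    |y| ^ p - p * c * (|y| ^ (p - 2) * y) ≤ |y - c| ^ p := by
  have hp0 : 0 < p := by linarith
  have hp1 : 0 < p - 1 := by linarith
  rcases eq_or_ne y 0 with rfl | hy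
  · simp only [abs_zero, Real.zero_rpow hp0.ne', mul_zero, sub_self]
    positivity
  have hy' : 0 < |y| := abs_pos.2 hy
  have hY := Real.young_inequality_of_nonneg (abs_nonneg (y - c))
    (Real.rpow_nonneg (abs_nonneg y) (p - 1)) (Real.HolderConjugate.conjExponent hp)
  rw [Real.conjExponent, ← Real.rpow_mul (abs_nonneg y), mul_div_cancel₀ _ hp1.ne'] at hY
  have e1 : |y| ^ (p - 2) * |y| = |y| ^ (p - 1) := by
    rw [← Real.rpow_add_one hy'.ne']; congr 1; ring
  have e2 : |y| ^ (p - 2) * y * y = |y| ^ p := by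
    rw [mul_assoc, ← abs_mul_abs_self y, ← mul_assoc, e1, ← Real.rpow_add_one hy'.ne']
    congr 1; ring
  have h3 : |y| ^ (p - 2) * y * (y - c) ≤ |y - c| * |y| ^ (p - 1) := by
    rw [← e1]
    calc _ ≤ |(|y| ^ (p - 2) * y * (y - c))| := le_abs_self _
      _ = _ := by
        rw [abs_mul, abs_mul, abs_of_nonneg (Real.rpow_nonneg (abs_nonneg y) _)]; ring
  rw [mul_sub, e2] at h3
  have h4 := h3.trans hY
  have e5 : |y - c| ^ p / p + |y| ^ p / (p / (p - 1)) =
      (|y - c| ^ p + (p - 1) * |y| ^ p) / p := by field_simp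
  rw [e5, le_div_iff₀ hp0] at h4
  linarith

/-! ### Comparison of the best constants -/

section Comparison

variable {m m' : Measure ℝ} {Ω Ω' : Set ℝ} {Q : ℝ}

lemma sSup_mul_le {S : Set ℝ≥0∞} {x y : ℝ≥0∞} (h : ∀ c ∈ S, c * x ≤ y) : sSup S * x ≤ y := by
  rw [ENNReal.sSup_mul]
  exact iSup₂_le h

/-- Intermediate value theorem: the integral is continuous in c and changes sign between the bounds
of f on Ω. -/
lemma exists_centering {p : ℝ} (hp : 1 < p) [IsLocallyFiniteMeasure m] (hΩ : IsCompact Ω)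
    {f : ℝ → ℝ} (hf : Continuous f) : ∃ c, ∫ x in Ω, |f x - c| ^ (p - 2) * (f x - c) ∂m = 0 := by
  have hψ := continuous_abs_rpow_sub_two_mul hp
  have hc : Continuous fun c => ∫ x in Ω, |f x - c| ^ (p - 2) * (f x - c) ∂m :=
    continuous_parametric_integral_of_continuous
      (f := fun c x => |f x - c| ^ (p - 2) * (f x - c)) (hψ.comp (by fun_prop : Continuous fun z : ℝ × ℝ => f z.2 - z.1)) hΩ
  obtain ⟨M, hM⟩ := hΩ.exists_bound_of_continuousOn hf.continuousOn
  refine mem_range_of_exists_le_of_exists_ge hc ⟨M, ?_⟩ ⟨-M, ?_⟩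
  · refine setIntegral_nonpos hΩ.measurableSet fun x hx => ?_
    have := (abs_le.1 (hM x hx)).2
    exact mul_nonpos_of_nonneg_of_nonpos (Real.rpow_nonneg (abs_nonneg _) _) (by linarith)
  · refine setIntegral_nonneg hΩ.measurableSet fun x hx => ?_
    have := (abs_le.1 (hM x hx)).1
    exact mul_nonneg (Real.rpow_nonneg (abs_nonneg _) _) (by linarith)

/-- The constraint is the critical point equation at 0 of the convex function c ↦ ∫|f - c|^p;
integrate the tangent line inequality. -/
lemma lintegral_abs_rpow_le {p : ℝ} (hp : 1 < p) [IsLocallyFiniteMeasure m] (hΩ : IsCompact Ω)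
    {f : ℝ → ℝ} (hf : Continuous f) (h0 : ∫ x in Ω, |f x| ^ (p - 2) * f x ∂m = 0) (c : ℝ) :
    ∫⁻ x in Ω, ENNReal.ofReal (|f x| ^ p) ∂m ≤ ∫⁻ x in Ω, ENNReal.ofReal (|f x - c| ^ p) ∂m := by
  have hp0 : 0 ≤ p := by linarith
  have c1 : Continuous fun x => |f x| ^ p := hf.abs.rpow_const fun _ => Or.inr hp0
  have c2 : Continuous fun x => |f x - c| ^ p :=
    (hf.sub continuous_const).abs.rpow_const fun _ => Or.inr hp0
  have c3 : Continuous fun x => |f x| ^ (p - 2) * f x := (continuous_abs_rpow_sub_two_mul hp).comp hf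
  have i1 : IntegrableOn _ Ω m := c1.continuousOn.integrableOn_compact hΩ
  have i2 : IntegrableOn _ Ω m := c2.continuousOn.integrableOn_compact hΩ
  have i3 : IntegrableOn _ Ω m := c3.continuousOn.integrableOn_compact hΩ
  rw [← ofReal_integral_eq_lintegral_ofReal i1 (Eventually.of_forall fun x => by positivity),
    ← ofReal_integral_eq_lintegral_ofReal i2 (Eventually.of_forall fun x => by positivity)]
  refine ENNReal.ofReal_le_ofReal ?_
  have h2 := integral_mono (i1.sub (i3.const_mul (p * c))) i2 fun x => abs_rpow_le_sub hp (f x) c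
  rw [integral_sub' i1 (i3.const_mul (p * c)), integral_const_mul, h0] at h2
  simpa using h2

lemma inv_mul_lintegral_le (hQ : 0 < Q)
    (h2 : m'.restrict (geoHull Ω') ≤ ENNReal.ofReal Q • m.restrict (geoHull Ω)) (g : ℝ → ℝ≥0∞) :
    (ENNReal.ofReal Q)⁻¹ * ∫⁻ x in geoHull Ω', g x ∂m' ≤ ∫⁻ x in geoHull Ω, g x ∂m := by
  have : ∫⁻ x in geoHull Ω', g x ∂m' ≤ ENNReal.ofReal Q * ∫⁻ x in geoHull Ω, g x ∂m := by
    rw [← smul_eq_mul, ← lintegral_smul_measure]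
    exact lintegral_mono' h2 le_rfl
  calc _ ≤ (ENNReal.ofReal Q)⁻¹ * (ENNReal.ofReal Q * ∫⁻ x in geoHull Ω, g x ∂m) := by gcongr
    _ = _ := by
      rw [← mul_assoc, ENNReal.inv_mul_cancel (ENNReal.ofReal_pos.2 hQ).ne' ENNReal.ofReal_ne_top,
        one_mul]

/-- Recentre f for m': by minimality ∫|f|^p dm ≤ ∫|f - c|^p dm ≤ ∫|f - c|^p dm', and the shift does
not change the gradient. Only the gradient integral loses Q. -/
theorem poincareConst_comparison {p : ℝ} (hp : 1 < p) [IsLocallyFiniteMeasure m]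
    [IsLocallyFiniteMeasure m'] (hΩ : IsCompact Ω) (hΩ' : IsCompact Ω') (hQ : 0 < Q)
    (h1 : m.restrict Ω ≤ m'.restrict Ω')
    (h2 : m'.restrict (geoHull Ω') ≤ ENNReal.ofReal Q • m.restrict (geoHull Ω)) :
    (ENNReal.ofReal Q)⁻¹ * poincareConst p m' Ω' ≤ poincareConst p m Ω := by
  refine le_sSup fun f hf h0 => ?_
  obtain ⟨c, hc⟩ := exists_centering (m := m') hp hΩ' hf.continuous
  have hg : LocallyLipschitz fun x => f x - c := by
    simpa [sub_eq_add_neg] using locallyLipschitz_affine hf 1 (-c)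
  have hlip : ∀ x, localLip (fun x => f x - c) x = localLip f x := fun x => by
    simpa [sub_eq_add_neg] using localLip_affine f 1 (-c) x
  have key : poincareConst p m' Ω' * ∫⁻ x in Ω', ENNReal.ofReal (|f x - c| ^ p) ∂m' ≤
      ∫⁻ x in geoHull Ω', localLip f x ^ p ∂m' := by
    refine sSup_mul_le fun d hd => ?_
    have := hd _ hg hc
    simp_rw [hlip] at this
    exact this
  calc _ ≤ (ENNReal.ofReal Q)⁻¹ * poincareConst p m' Ω' *
        ∫⁻ x in Ω', ENNReal.ofReal (|f x - c| ^ p) ∂m' := by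
        exact mul_le_mul' le_rfl
          ((lintegral_abs_rpow_le hp hΩ hf.continuous h0 c).trans (lintegral_mono' h1 le_rfl))
    _ = (ENNReal.ofReal Q)⁻¹ * (poincareConst p m' Ω' *
        ∫⁻ x in Ω', ENNReal.ofReal (|f x - c| ^ p) ∂m') := mul_assoc _ _ _
    _ ≤ (ENNReal.ofReal Q)⁻¹ * ∫⁻ x in geoHull Ω', localLip f x ^ p ∂m' := by gcongr
    _ ≤ _ := inv_mul_lintegral_le hQ h2 _

/-- Rescaling and enlarging the measure does not decrease the entropy. -/
lemma entropy_comparison [IsLocallyFiniteMeasure m] [IsLocallyFiniteMeasure m']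
    (hΩ : IsCompact Ω) (hΩ' : IsCompact Ω') (h1 : m.restrict Ω ≤ m'.restrict Ω') {f : ℝ → ℝ}
    (hf : Continuous f) (h0 : ∫ x in Ω, (f x ^ 2 - 1) ∂m = 0) {c : ℝ} (hc : 0 < c)
    (hc' : ∫ x in Ω', (f x ^ 2 / c - 1) ∂m' = 0) :
    (∫ x in Ω, f x ^ 2 * Real.log (f x ^ 2) ∂m) / c ≤
      ∫ x in Ω', f x ^ 2 / c * Real.log (f x ^ 2 / c) ∂m' := by
  have hxl := Real.continuous_mul_log
  have c1 : Continuous fun x => f x ^ 2 := by fun_prop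
  have c2 : Continuous fun x => f x ^ 2 * Real.log (f x ^ 2) := hxl.comp c1
  have c3 : Continuous fun x => f x ^ 2 / c * Real.log (f x ^ 2 / c) :=
    hxl.comp (c1.div_const c)
  have c4 : Continuous fun x => f x ^ 2 / c * Real.log (f x ^ 2 / c) - (f x ^ 2 / c - 1) :=
    c3.sub (by fun_prop)
  have j3 : IntegrableOn _ Ω' m' := c3.continuousOn.integrableOn_compact hΩ'
  have j4 : IntegrableOn _ Ω' m' := c4.continuousOn.integrableOn_compact hΩ'
  have j5 : IntegrableOn (fun x => f x ^ 2 / c - 1) Ω' m' :=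
    (by fun_prop : Continuous fun x => f x ^ 2 / c - 1).continuousOn.integrableOn_compact hΩ'
  have i2 : IntegrableOn _ Ω m := c2.continuousOn.integrableOn_compact hΩ
  have i5 : IntegrableOn (fun x => f x ^ 2 - 1) Ω m :=
    (by fun_prop : Continuous fun x => f x ^ 2 - 1).continuousOn.integrableOn_compact hΩ
  have ic : IntegrableOn (fun _ => (c - 1 - Real.log c) / c) Ω m :=
    (continuous_const (y := (c - 1 - Real.log c) / c)).continuousOn.integrableOn_compact hΩ
  -- Subtracting the mean-zero term replaces s log s by s log s - s + 1 ≥ 0, whose integral is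
  -- monotone in the measure.
  have e1 : ∫ x in Ω', f x ^ 2 / c * Real.log (f x ^ 2 / c) ∂m' =
      ∫ x in Ω', (f x ^ 2 / c * Real.log (f x ^ 2 / c) - (f x ^ 2 / c - 1)) ∂m' := by
    rw [integral_sub j3 j5, hc', sub_zero]
  have hnn : ∀ x, 0 ≤ f x ^ 2 / c * Real.log (f x ^ 2 / c) - (f x ^ 2 / c - 1) := fun x =>
    sub_nonneg.2 (Real.self_sub_one_le_mul_log (by positivity))
  have e2 : ∫ x in Ω, (f x ^ 2 / c * Real.log (f x ^ 2 / c) - (f x ^ 2 / c - 1)) ∂m ≤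
      ∫ x in Ω', (f x ^ 2 / c * Real.log (f x ^ 2 / c) - (f x ^ 2 / c - 1)) ∂m' :=
    integral_mono_measure h1 (Eventually.of_forall hnn) j4
  -- The middle term integrates to zero against m by the constraint, and the last constant is
  -- nonnegative since log c ≤ c - 1.
  have e3 : ∀ x, f x ^ 2 / c * Real.log (f x ^ 2 / c) - (f x ^ 2 / c - 1) =
      c⁻¹ * (f x ^ 2 * Real.log (f x ^ 2)) - (Real.log c + 1) / c * (f x ^ 2 - 1) +
        (c - 1 - Real.log c) / c := by
    intro x
    rcases eq_or_ne (f x) 0 with h | h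
    · rw [h]; field_simp; simp; ring
    · rw [Real.log_div (by positivity) hc.ne']; field_simp; ring
  have e4 : ∫ x in Ω, (f x ^ 2 / c * Real.log (f x ^ 2 / c) - (f x ^ 2 / c - 1)) ∂m =
      c⁻¹ * (∫ x in Ω, f x ^ 2 * Real.log (f x ^ 2) ∂m) +
        ∫ x in Ω, (c - 1 - Real.log c) / c ∂m := by
    simp_rw [e3]
    have k2 := i2.const_mul c⁻¹
    have k5 := i5.const_mul ((Real.log c + 1) / c)
    have k25 : IntegrableOn (fun x => c⁻¹ * (f x ^ 2 * Real.log (f x ^ 2)) -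
        (Real.log c + 1) / c * (f x ^ 2 - 1)) Ω m := k2.sub k5
    rw [integral_add k25 ic, integral_sub (i2.const_mul _) (i5.const_mul _), integral_const_mul, integral_const_mul, h0,
      mul_zero, sub_zero]
  have e5 : 0 ≤ ∫ x in Ω, (c - 1 - Real.log c) / c ∂m := by
    refine integral_nonneg fun x => div_nonneg ?_ hc.le
    linarith [Real.log_le_sub_one_of_pos hc]
  rw [e1, div_eq_inv_mul]
  linarith

/-- The Holley-Stroock argument: with c the mean of f² for m' on Ω', f/√c is admissible for m'. The
factor 1/c then appears in both the entropy and the energy, and cancels. -/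
theorem logSobolevConst_comparison [IsLocallyFiniteMeasure m]
    [IsLocallyFiniteMeasure m'] (hΩ : IsCompact Ω) (hΩ' : IsCompact Ω') (hQ : 0 < Q)
    (h1 : m.restrict Ω ≤ m'.restrict Ω')
    (h2 : m'.restrict (geoHull Ω') ≤ ENNReal.ofReal Q • m.restrict (geoHull Ω)) :
    (ENNReal.ofReal Q)⁻¹ * logSobolevConst m' Ω' ≤ logSobolevConst m Ω := by
  refine le_sSup fun f hf h0 => ?_
  rcases eq_or_ne (m Ω) 0 with hz | hz
  · rw [Measure.restrict_eq_zero.2 hz]; simp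
  have hfin : m Ω ≠ ⊤ := hΩ.measure_lt_top.ne
  have hfin' : m' Ω' ≠ ⊤ := hΩ'.measure_lt_top.ne
  have c1 : Continuous fun x => f x ^ 2 := by have := hf.continuous; fun_prop
  have i1 : IntegrableOn (fun x => f x ^ 2) Ω m := c1.continuousOn.integrableOn_compact hΩ
  have j1 : IntegrableOn (fun x => f x ^ 2) Ω' m' := c1.continuousOn.integrableOn_compact hΩ'
  have hV : 0 < m.real Ω := ENNReal.toReal_pos hz hfin
  have hV' : 0 < m'.real Ω' := by
    refine ENNReal.toReal_pos (fun h => hz ?_) hfin'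
    have := h1 univ
    simpa [h] using this
  have hi : ∫ x in Ω, f x ^ 2 ∂m = m.real Ω := by
    rw [integral_sub i1 (integrableOn_const (by exact hfin))] at h0
    simpa [sub_eq_zero] using h0
  have hZ : 0 < ∫ x in Ω', f x ^ 2 ∂m' := by
    refine lt_of_lt_of_le (hi ▸ hV) (integral_mono_measure h1 (Eventually.of_forall fun x => ?_) j1)
    positivity
  set c := (∫ x in Ω', f x ^ 2 ∂m') / m'.real Ω' with hcdef
  have hc : 0 < c := div_pos hZ hV'
  have hc' : ∫ x in Ω', (f x ^ 2 / c - 1) ∂m' = 0 := by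
    rw [integral_sub (j1.div_const c) (integrableOn_const (by exact hfin')), integral_div]
    simp only [integral_const, measureReal_restrict_apply_univ, smul_eq_mul, mul_one]
    rw [hcdef]; field_simp; ring
  have hent := entropy_comparison hΩ hΩ' h1 hf.continuous h0 hc hc'
  have hsq : ∀ x, ((√c)⁻¹ * f x + 0) ^ 2 = f x ^ 2 / c := fun x => by
    rw [add_zero, mul_pow, inv_pow, Real.sq_sqrt hc.le]; field_simp
  have hα : ENNReal.ofReal |(√c)⁻¹| ^ (2 : ℕ) = ENNReal.ofReal c⁻¹ := by
    rw [← ENNReal.ofReal_pow (abs_nonneg _), sq_abs, inv_pow, Real.sq_sqrt hc.le]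
  have key : logSobolevConst m' Ω' *
      (ENNReal.ofReal (∫ x in Ω', f x ^ 2 / c * Real.log (f x ^ 2 / c) ∂m') / 2) ≤
      ENNReal.ofReal c⁻¹ * ∫⁻ x in geoHull Ω', localLip f x ^ 2 ∂m' := by
    refine sSup_mul_le fun d hd => ?_
    have := hd _ (locallyLipschitz_affine hf (√c)⁻¹ 0) (by simp_rw [hsq]; exact hc')
    simp_rw [hsq, localLip_affine, mul_pow, hα] at this
    rw [lintegral_const_mul' _ _ ENNReal.ofReal_ne_top] at this
    rwa [div_eq_mul_inv, mul_right_comm, mul_assoc, ← div_eq_mul_inv] at this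
  set E := ∫ x in Ω, f x ^ 2 * Real.log (f x ^ 2) ∂m with hE
  have hcc : ENNReal.ofReal c * ENNReal.ofReal c⁻¹ = 1 := by
    rw [← ENNReal.ofReal_mul hc.le, mul_inv_cancel₀ hc.ne', ENNReal.ofReal_one]
  have hEc : ENNReal.ofReal E = ENNReal.ofReal c * ENNReal.ofReal (E / c) := by
    rw [← ENNReal.ofReal_mul hc.le, mul_div_cancel₀ _ hc.ne']
  calc (ENNReal.ofReal Q)⁻¹ * logSobolevConst m' Ω' / 2 * ENNReal.ofReal E
      = (ENNReal.ofReal Q)⁻¹ * (ENNReal.ofReal c *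
        (logSobolevConst m' Ω' * (ENNReal.ofReal (E / c) / 2))) := by
        rw [hEc]; simp only [div_eq_mul_inv]; ring
    _ ≤ (ENNReal.ofReal Q)⁻¹ * (ENNReal.ofReal c * (logSobolevConst m' Ω' *
        (ENNReal.ofReal (∫ x in Ω', f x ^ 2 / c * Real.log (f x ^ 2 / c) ∂m') / 2))) := by
        gcongr
    _ ≤ (ENNReal.ofReal Q)⁻¹ * (ENNReal.ofReal c * (ENNReal.ofReal c⁻¹ *
        ∫⁻ x in geoHull Ω', localLip f x ^ 2 ∂m')) := by gcongr
    _ = (ENNReal.ofReal Q)⁻¹ * ∫⁻ x in geoHull Ω', localLip f x ^ 2 ∂m' := by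
        rw [← mul_assoc (ENNReal.ofReal c), hcc, one_mul]
    _ ≤ _ := inv_mul_lintegral_le hQ h2 _

end Comparison

/-! ### Passage from spaces to families -/

lemma HasLocDensity.isLocallyFiniteMeasure {m : Measure ℝ} (hm : HasLocDensity m) :
    IsLocallyFiniteMeasure m := by
  obtain ⟨h, -, -, -, hfin⟩ := hm.exists_measurable
  exact ⟨fun x => ⟨Icc (x - 1) (x + 1), Icc_mem_nhds (by linarith) (by linarith), hfin _ _⟩⟩

lemma HasLocDensity.measure_singleton {m : Measure ℝ} (hm : HasLocDensity m) (x : ℝ) :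
    m {x} = 0 := by
  obtain ⟨h, -, -, rfl⟩ := hm
  exact withDensity_absolutelyContinuous _ _ (by simp)

lemma poincareConst_eq_top {p : ℝ} {m : Measure ℝ} {Ω : Set ℝ} (h : m Ω = 0) :
    poincareConst p m Ω = ⊤ := by
  refine top_le_iff.1 (le_sSup fun f _ _ => ?_)
  rw [Measure.restrict_eq_zero.2 h]; simp

lemma logSobolevConst_eq_top {m : Measure ℝ} {Ω : Set ℝ} (h : m Ω = 0) :
    logSobolevConst m Ω = ⊤ := by
  refine top_le_iff.1 (le_sSup fun f _ _ => ?_)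
  rw [Measure.restrict_eq_zero.2 h]; simp

/-- A bounded closed set that is not null has distinct extreme points. -/
lemma exists_extreme_points {m : Measure ℝ} (hm : HasLocDensity m) {Ω : Set ℝ} (hc : IsClosed Ω)
    {D : ℝ} (hD : Metric.ediam Ω ≤ ENNReal.ofReal D) (h0 : m Ω ≠ 0) :
    IsCompact Ω ∧ ∃ a ∈ Ω, ∃ b ∈ Ω, a < b ∧ Ω ⊆ Icc a b := by
  have hbdd : Bornology.IsBounded Ω :=
    Metric.isBounded_iff_ediam_ne_top.2 (ne_top_of_le_ne_top ENNReal.ofReal_ne_top hD)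
  have hcomp : IsCompact Ω := Metric.isCompact_of_isClosed_isBounded hc hbdd
  have hne : Ω.Nonempty := by
    by_contra h
    rw [not_nonempty_iff_eq_empty.1 h, measure_empty] at h0
    exact h0 rfl
  have hsub : Ω ⊆ Icc (sInf Ω) (sSup Ω) := fun x hx =>
    ⟨csInf_le hcomp.bddBelow hx, le_csSup hcomp.bddAbove hx⟩
  refine ⟨hcomp, sInf Ω, hcomp.sInf_mem hne, sSup Ω, hcomp.sSup_mem hne, ?_, hsub⟩
  by_contra! h
  refine h0 (measure_mono_null (hsub.trans ?_) (hm.measure_singleton (sInf Ω)))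
  intro x hx
  exact le_antisymm (hx.2.trans h) hx.1

lemma CD.qcd_one {m : Measure ℝ} {K N : ℝ} (h : CD m K N) : QCD m 1 K N := by
  refine ⟨h.1, fun μ₀ μ₁ h0 h1 h2 h3 ν hν t ht ht1 => ?_⟩
  filter_upwards [h.2 μ₀ μ₁ h0 h1 h2 h3 ν hν t ht ht1] with γ hγ
  simpa using hγ

lemma CD.qcd {m : Measure ℝ} {Q K N : ℝ} (hN : 1 < N) (hQ : 1 ≤ Q) (h : CD m K N) :
    QCD m Q K N := by
  refine ⟨h.1, fun μ₀ μ₁ h0 h1 h2 h3 ν hν t ht ht1 => ?_⟩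
  filter_upwards [h.2 μ₀ μ₁ h0 h1 h2 h3 ν hν t ht ht1] with γ hγ
  refine le_trans (mul_le_of_le_one_left' ?_) hγ
  rw [ENNReal.inv_le_one]
  refine ENNReal.one_le_rpow ?_ ?_
  · rwa [ENNReal.one_le_ofReal]
  · have : 0 < N := by linarith
    positivity

/-- In dimension one, `CD(K, N)` implies `MCP(K, N)`, for spaces with bounded support. -/
theorem CD.mcp {m : Measure ℝ} {K N D : ℝ} (hN : 1 < N) (hm : HasLocDensity m) (h : CD m K N)
    (hD : Metric.ediam m.support ≤ ENNReal.ofReal D) : MCP m K N := by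
  have hcompl : m m.supportᶜ = 0 := Measure.measure_compl_support
  by_cases h0 : m m.support = 0
  · have hm0 : m = 0 := by
      rw [← Measure.measure_univ_eq_zero, ← union_compl_self m.support]
      exact measure_union_null h0 hcompl
    refine ⟨h.1, fun μ₀ μ₁ hp0 _ h2 => ?_⟩
    have := hp0.1
    rw [hm0, Measure.absolutelyContinuous_zero_iff] at h2
    exact absurd h2 (IsProbabilityMeasure.ne_zero μ₀)
  · obtain ⟨-, a, ha, b, hb, hab, hsub⟩ := exists_extreme_points hm Measure.isClosed_support hD h0
    obtain ⟨u, hu, h1, h2⟩ := h.qcd_one.exists_solConcave hN le_rfl hm ha hb hab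
    have hr : m.restrict (Icc a b) = m :=
      Measure.restrict_eq_self_of_ae_mem (mem_of_superset (mem_ae_iff.2 hcompl) hsub)
    -- With Q = 1 the two comparisons are opposite inequalities, so m is itself a model measure.
    rw [ENNReal.ofReal_one, one_smul, hr] at h2
    rw [hr] at h1
    rw [le_antisymm h1 h2]
    exact hu.mcp hN

lemma famConst_le_famConstBar {K N D Q : ℝ} (hN : 1 < N) (hQ : 1 ≤ Q)
    (L : Measure ℝ → Set ℝ → ℝ≥0∞) : famConst L (QCD1 Q K N) D ≤ famConstBar L (CD1 K N) D := by
  refine le_sInf ?_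
  rintro _ ⟨m, ⟨hm, hcd⟩, hD, rfl⟩
  exact sInf_le ⟨m, ⟨hm, hcd.qcd hN hQ, K, N, hN, hcd.mcp hN hm hD⟩, _, Measure.isClosed_support,
    subset_rfl, hD, rfl⟩

/-- The competitor is the model space on the interval between the extreme points of Ω, of length at
most D. Ω may have gaps, but its geodesic hull contains this interval, which is where the gradients
are compared. -/
lemma inv_mul_famConstBar_le {K N D Q : ℝ} (hN : 1 < N) (hQ : 1 ≤ Q)
    (L : Measure ℝ → Set ℝ → ℝ≥0∞) (htop : ∀ m Ω, m Ω = 0 → L m Ω = ⊤)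
    (hL : ∀ (m m' : Measure ℝ) (Ω Ω' : Set ℝ), IsLocallyFiniteMeasure m →
      IsLocallyFiniteMeasure m' → IsCompact Ω → IsCompact Ω' →
      m.restrict Ω ≤ m'.restrict Ω' →
      m'.restrict (geoHull Ω') ≤ ENNReal.ofReal Q • m.restrict (geoHull Ω) →
      (ENNReal.ofReal Q)⁻¹ * L m' Ω' ≤ L m Ω) :
    (ENNReal.ofReal Q)⁻¹ * famConstBar L (CD1 K N) D ≤ famConst L (QCD1 Q K N) D := by
  refine le_sInf ?_
  rintro _ ⟨m, ⟨hm, hq, -⟩, Ω, hc, hsupp, hD, rfl⟩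
  by_cases h0 : m Ω = 0
  · rw [htop m Ω h0]; exact le_top
  obtain ⟨hcomp, a, ha, b, hb, hab, hsub⟩ := exists_extreme_points hm hc hD h0
  obtain ⟨u, hu, h1, h2⟩ := hq.exists_solConcave hN hQ hm (hsupp ha) (hsupp hb) hab
  have hloc := hu.hasLocDensity hN
  have hS : (icMeasure N a b u).support = Icc a b := hu.support_icMeasure
  have hle : famConstBar L (CD1 K N) D ≤ L (icMeasure N a b u) (Icc a b) := by
    refine sInf_le ⟨_, ⟨hloc, hu.cd hN⟩, ?_, by rw [hS]⟩
    rw [hS, Real.ediam_Icc]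
    refine le_trans ?_ hD
    have := Metric.edist_le_ediam_of_mem hb ha
    rwa [edist_dist, Real.dist_eq, abs_of_pos (sub_pos.2 hab)] at this
  refine le_trans (mul_le_mul' le_rfl hle) (hL m _ Ω _ hm.isLocallyFiniteMeasure
    hloc.isLocallyFiniteMeasure hcomp isCompact_Icc ?_ ?_)
  · calc m.restrict Ω ≤ m.restrict (Icc a b) := Measure.restrict_mono hsub le_rfl
      _ = (m.restrict (Icc a b)).restrict (Icc a b) := by
        rw [Measure.restrict_restrict measurableSet_Icc, inter_self]
      _ ≤ _ := Measure.restrict_mono subset_rfl h1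
  · refine Measure.restrict_le_self.trans (h2.trans ?_)
    gcongr
    exact Icc_subset_geoHull hab ha hb

end QuasiCD

theorem theorem5p4 (K N D Q : ℝ) (hN : 1 < N) (hD : 0 < D) (hQ : 1 ≤ Q) :
    (∀ p : ℝ, 1 < p →
      QuasiCD.famConst (QuasiCD.poincareConst p) (QuasiCD.QCD1 Q K N) D
          ≤ QuasiCD.famConstBar (QuasiCD.poincareConst p) (QuasiCD.CD1 K N) D ∧
      (ENNReal.ofReal Q)⁻¹ * QuasiCD.famConstBar (QuasiCD.poincareConst p) (QuasiCD.CD1 K N) D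
          ≤ QuasiCD.famConst (QuasiCD.poincareConst p) (QuasiCD.QCD1 Q K N) D) ∧
    (QuasiCD.famConst QuasiCD.logSobolevConst (QuasiCD.QCD1 Q K N) D
          ≤ QuasiCD.famConstBar QuasiCD.logSobolevConst (QuasiCD.CD1 K N) D ∧
      (ENNReal.ofReal Q)⁻¹ * QuasiCD.famConstBar QuasiCD.logSobolevConst (QuasiCD.CD1 K N) D
          ≤ QuasiCD.famConst QuasiCD.logSobolevConst (QuasiCD.QCD1 Q K N) D) := by
  have hQ0 : 0 < Q := by linarith
  refine ⟨fun p hp => ⟨QuasiCD.famConst_le_famConstBar hN hQ _,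
    QuasiCD.inv_mul_famConstBar_le hN hQ _ (fun _ _ => QuasiCD.poincareConst_eq_top)
      fun m m' Ω Ω' _ _ hΩ hΩ' h1 h2 => QuasiCD.poincareConst_comparison hp hΩ hΩ' hQ0 h1 h2⟩,
    QuasiCD.famConst_le_famConstBar hN hQ _,
    QuasiCD.inv_mul_famConstBar_le hN hQ _ (fun _ _ => QuasiCD.logSobolevConst_eq_top)
      fun m m' Ω Ω' _ _ hΩ hΩ' h1 h2 => QuasiCD.logSobolevConst_comparison hΩ hΩ' hQ0 h1 h2⟩
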